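/- Let $k$ be an algebraically closed field, let $X$ be a smooth projective variety over $k$, and let $G$ be a finite group whose order is not divisible by the characteristic of $k$, acting on $X$ by automorphisms over $k$. Let $D^b(X)=D^b(\mathrm{Coh}(X))$, let $\mathrm{Coh}_G(X)$ be the category of $G$-equivariant coherent sheaves (for the right action of $G$ on $\mathrm{Coh}(X)$ by $\phi_g=g^*$), let $D^b_G(X)=D^b(\mathrm{Coh}_G(X))$, and let $\mathrm{Res}:D^b_G(X)\to D^b(X)$ be the functor that forgets the equivariant structure. For a closed point $x\in X$ with stabilizer $G_x$, let $\mathcal O_x$ be the skyscraper sheaf, and let $P_x=\mathrm{Ind}_{G_x}^G(\mathcal O_x^{G_x})=\bigoplus_{[g]\in G_x\backslash G}g^*\mathcal O_x\in D^b_G(X)$ be the $G$-point sheaf, induced from $\mathcal O_x$ with the trivial $G_x$-action. A stability condition on a triangulated category $\mathcal D$ is a pair $(Z,\mathcal P)$ of a homomorphism $Z:K(\mathcal D)\to\mathbb C$ and full additive (isomorphism-closed) subcategories $\mathcal P(\phi)\subset\mathcal D$ $(\phi\in\mathbb R)$ such that (a) $Z(E)\in\mathbb R_{>0}e^{i\pi\phi}$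 for $0\ne E\in\mathcal P(\phi)$; (b) $\mathcal P(\phi+1)=\mathcal P(\phi)[1]$; (c) $\mathrm{Hom}(A_1,A_2)=0$ for $A_i\in\mathcal P(\phi_i)$, $\phi_1>\phi_2$; (d) every nonzero object has a finite Harder–Narasimhan filtration; and which is locally finite: there is $0<\eta<1/2$ such that for all $t\in\mathbb R$ the quasi-abelian category $\mathcal P((t-\eta,t+\eta))$ of the objects which are zero or have all their Harder–Narasimhan phases in $(t-\eta,t+\eta)$ is of finite length. An object is stable of phase $\phi$ if it is a simple object of $\mathcal P(\phi)$. A stability condition on $D^b(X)$ is $G$-invariant if $g^*\mathcal P(\phi)=\mathcal P(\phi)$ and $Z\circ g^*=Z$ for all $g\in G$, $\phi\in\mathbb R$. A stability condition on $D^b(X)$ (respectively on $D^b_G(X)$) is geometric if all the sheaves $\mathcal O_x$ (respectively all the $G$-point sheaves $P_x$), for closed points $x\in X$, are stable of one and the same phase. Let $\sigma=(Z,\mathcal P)$ be a $G$-invariant stability condition on $D^b(X)$, and let $\mathrm{Res}^{-1}(\sigma)=(Z\circ\mathrm{Res},\mathrm{Res}^{-1}\mathcal P)$, where $(\mathrm{Res}^{-1}\mathcal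 P)(\phi)=\{\mathcal E\in D^b_G(X)\mid\mathrm{Res}(\mathcal E)\in\mathcal P(\phi)\}$. Let $x\in X$ be a closed point and $\phi_0\in\mathbb R$. 1. If $\mathcal O_x$ is $\sigma$-stable of phase $\phi_0$, then $P_x$ is $\mathrm{Res}^{-1}(\sigma)$-stable of phase $\phi_0$. 2. If $P_x$ is $\mathrm{Res}^{-1}(\sigma)$-stable of phase $\phi_0$ and every subobject $A$ of $\mathcal O_x$ in $\mathcal P(\phi_0)$ satisfies $g^*A\cong A$ for all $g\in G_x$, then $\mathcal O_x$ is $\sigma$-stable of phase $\phi_0$. In particular $\mathrm{Res}^{-1}$ preserves geometricity: $\mathrm{Res}^{-1}(\sigma)$ is a stability condition on $D^b_G(X)$, and it is geometric whenever $\sigma$ is geometric. -/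

import Mathlib

set_option linter.unusedSectionVars false

open CategoryTheory Limits AlgebraicGeometry

universe w v u

noncomputable section

namespace GStab

/-- A right action of a group on a category: autoequivalences `φ g` and isomorphisms
`ε_{g,h} : φ_g φ_h ≅ φ_{hg}` (functors are composed as `φ h ⋙ φ g = φ_g ∘ φ_h`) with the
associativity condition. -/
structure RightAction (G : Type w) [Group G] (C : Type u) [Category.{v} C] where
  φ : G → C ⥤ C
  isEquivalence : ∀ g, (φ g).IsEquivalence
  ε : ∀ g h k : G, h * g = k → (φ h ⋙ φ g ≅ φ k)
  assoc : ∀ (f g h gf hg hgf : G) (e₁ : g * f = gf) (e₂ : h * g = hg) (e₃ : h * gf = hgf)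
    (e₄ : hg * f = hgf) (F : C),
    (φ f).map ((ε g h hg e₂).hom.app F) ≫ (ε f hg hgf e₄).hom.app F =
      (ε f g gf e₁).hom.app ((φ h).obj F) ≫ (ε gf h hgf e₃).hom.app F


namespace RightAction

variable {G : Type w} [Group G] {C : Type u} [Category.{v} C]

instance (A : RightAction G C) (g : G) : (A.φ g).IsEquivalence := A.isEquivalence g

/-- The restriction of an action to a subgroup. -/
def restrict (A : RightAction G C) (H : Subgroup G) : RightAction H C where
  φ h := A.φ h
  isEquivalence _ := inferInstance
  ε g h k e := A.ε g h k (by rw [← e]; rfl)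
  assoc _ _ _ _ _ _ _ _ _ _ F := A.assoc _ _ _ _ _ _ _ _ _ _ F

/-- Equivariant objects: objects `F` with isomorphisms `θ_g : F ≅ φ_g F` such that
`θ_{hg} = ε_{g,h} ∘ φ_g(θ_h) ∘ θ_g`. -/
structure Equivariant (A : RightAction G C) where
  obj : C
  θ : ∀ g : G, obj ≅ (A.φ g).obj obj
  θ_mul : ∀ (g h k : G) (e : h * g = k),
    (θ k).hom = (θ g).hom ≫ (A.φ g).map (θ h).hom ≫ (A.ε g h k e).hom.app obj

namespace Equivariant

variable {A : RightAction G C}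

/-- Morphisms of equivariant objects. -/
@[ext]
structure Hom (E F : A.Equivariant) where
  hom : E.obj ⟶ F.obj
  comm : ∀ g : G, (E.θ g).hom ≫ (A.φ g).map hom = hom ≫ (F.θ g).hom := by cat_disch

attribute [simp] Hom.comm

@[simp]
lemma Hom.comm_assoc {E F : A.Equivariant} (f : Hom E F) (g : G) {X : C}
    (a : (A.φ g).obj F.obj ⟶ X) :
    (E.θ g).hom ≫ (A.φ g).map f.hom ≫ a = f.hom ≫ (F.θ g).hom ≫ a := by
  rw [← Category.assoc, Hom.comm, Category.assoc]

@[simps id_hom comp_hom]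
instance : Category A.Equivariant where
  Hom := Hom
  id E := { hom := 𝟙 _ }
  comp f g := { hom := f.hom ≫ g.hom }

@[ext]
lemma hom_ext {E F : A.Equivariant} {f g : E ⟶ F} (h : f.hom = g.hom) : f = g := Hom.ext h

variable (A) in
/-- The functor forgetting the linearization. -/
@[simps]
def forget : A.Equivariant ⥤ C where
  obj E := E.obj
  map f := f.hom

instance : (forget A).Faithful where
  map_injective h := hom_ext h

instance : (forget A).ReflectsIsomorphisms where
  reflects {E F} f hf := by
    have : IsIso f.hom := hf
    refine ⟨⟨{ hom := inv f.hom, comm := fun g => ?_ }, ?_, ?_⟩⟩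
    · rw [← cancel_epi f.hom, ← Hom.comm_assoc]
      simp
    · ext; simp
    · ext; simp

section Preadditive

variable [Preadditive C] [HasFiniteProducts C]

instance (g : G) : (A.φ g).Additive :=
  have := HasBinaryBiproducts.of_hasBinaryProducts (C := C)
  have := preservesBinaryBiproducts_of_preservesBinaryProducts (A.φ g)
  Functor.additive_of_preservesBinaryBiproducts _

variable {E F : A.Equivariant}

instance : Zero (E ⟶ F) := ⟨{ hom := 0 }⟩
instance : Add (E ⟶ F) := ⟨fun f g => { hom := f.hom + g.hom }⟩
instance : Neg (E ⟶ F) := ⟨fun f => { hom := -f.hom }⟩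
instance : Sub (E ⟶ F) := ⟨fun f g => { hom := f.hom - g.hom }⟩
instance : SMul ℕ (E ⟶ F) := ⟨fun n f => { hom := n • f.hom }⟩
instance : SMul ℤ (E ⟶ F) := ⟨fun n f => { hom := n • f.hom }⟩

instance : AddCommGroup (E ⟶ F) :=
  Function.Injective.addCommGroup (fun f : E ⟶ F => f.hom) (fun _ _ h => hom_ext h)
    rfl (fun _ _ => rfl) (fun _ => rfl) (fun _ _ => rfl) (fun _ _ => rfl) (fun _ _ => rfl)

@[simp] lemma add_hom (f g : E ⟶ F) : (f + g).hom = f.hom + g.hom := rfl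
@[simp] lemma zero_hom : (0 : E ⟶ F).hom = 0 := rfl

instance : Preadditive A.Equivariant where
  homGroup _ _ := inferInstance
  add_comp _ _ _ _ _ _ := by ext; simp
  comp_add _ _ _ _ _ _ := by ext; simp

instance : (forget A).Additive where

end Preadditive

section Limits

variable {J : Type*} [Category* J] {D : J ⥤ A.Equivariant}

variable (D) in
/-- The linearizations of the objects of a diagram, as a natural isomorphism. -/
def diagIso (g : G) : D ⋙ forget A ≅ (D ⋙ forget A) ⋙ A.φ g :=
  NatIso.ofComponents (fun j => (D.obj j).θ g) (fun f => ((D.map f).comm g).symm)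

/-- A projection of a cone over the underlying diagram. -/
def proj (c : Cone (D ⋙ forget A)) (j : J) : c.pt ⟶ (D.obj j).obj := c.π.app j

lemma lim_ext {c : Cone (D ⋙ forget A)} (hc : IsLimit c) (g : G) {X : C}
    {a b : X ⟶ (A.φ g).obj c.pt}
    (h : ∀ j, a ≫ (A.φ g).map (proj c j) = b ≫ (A.φ g).map (proj c j)) : a = b :=
  (isLimitOfPreserves (A.φ g) hc).hom_ext h

/-- The induced linearization of a limit. -/
def coneθ {c : Cone (D ⋙ forget A)} (hc : IsLimit c) (g : G) : c.pt ≅ (A.φ g).obj c.pt :=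
  hc.conePointsIsoOfNatIso (isLimitOfPreserves (A.φ g) hc) (diagIso D g)

lemma coneθ_hom_proj {c : Cone (D ⋙ forget A)} (hc : IsLimit c) (g : G) (j : J) :
    (coneθ hc g).hom ≫ (A.φ g).map (proj c j) = proj c j ≫ ((D.obj j).θ g).hom :=
  hc.conePointsIsoOfNatIso_hom_comp (isLimitOfPreserves (A.φ g) hc) (diagIso D g) j

/-- The equivariant cone on a limit of the underlying diagram. -/
def cone {c : Cone (D ⋙ forget A)} (hc : IsLimit c) : Cone D where
  pt :=
    { obj := c.pt
      θ := coneθ hc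
      θ_mul g h k e := lim_ext hc k fun j => by
        have h1 := (A.ε g h k e).hom.naturality (proj c j)
        dsimp at h1
        simp only [Category.assoc]
        rw [coneθ_hom_proj, (D.obj j).θ_mul g h k e, ← h1, ← Functor.map_comp_assoc,
          coneθ_hom_proj, Functor.map_comp_assoc, reassoc_of% coneθ_hom_proj] }
  π :=
    { app j := { hom := proj c j, comm := fun g => coneθ_hom_proj hc g j }
      naturality _ _ f := by ext; exact c.π.naturality f }

/-- The lift of an equivariant cone. -/
def liftHom {c : Cone (D ⋙ forget A)} (hc : IsLimit c) (s : Cone D) : s.pt.obj ⟶ c.pt :=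
  hc.lift ((forget A).mapCone s)

lemma liftHom_proj {c : Cone (D ⋙ forget A)} (hc : IsLimit c) (s : Cone D) (j : J) :
    liftHom hc s ≫ proj c j = (s.π.app j).hom := hc.fac ((forget A).mapCone s) j

lemma liftHom_comm {c : Cone (D ⋙ forget A)} (hc : IsLimit c) (s : Cone D) (g : G) :
    (s.pt.θ g).hom ≫ (A.φ g).map (liftHom hc s) = liftHom hc s ≫ (coneθ hc g).hom :=
  lim_ext hc g fun j => by
    have h2 := (s.π.app j).comm g
    dsimp at h2
    rw [Category.assoc, Category.assoc, coneθ_hom_proj, reassoc_of% liftHom_proj, ← Functor.map_comp,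
      liftHom_proj, h2]

/-- The equivariant cone is a limit. -/
def coneIsLimit {c : Cone (D ⋙ forget A)} (hc : IsLimit c) : IsLimit (cone hc) where
  lift s :=
    { hom := liftHom hc s
      comm := liftHom_comm hc s }
  fac s j := by ext; exact liftHom_proj hc s j
  uniq s m hm := by
    ext
    exact hc.uniq ((forget A).mapCone s) m.hom (fun j => congr_arg Hom.hom (hm j))

instance [HasLimitsOfShape J C] : HasLimitsOfShape J A.Equivariant where
  has_limit _ := ⟨⟨_, coneIsLimit (limit.isLimit _)⟩⟩

instance [HasLimitsOfShape J C] : PreservesLimitsOfShape J (forget A) where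
  preservesLimit {_} := preservesLimit_of_preserves_limit_cone
    (coneIsLimit (limit.isLimit _)) (IsLimit.ofIsoLimit (limit.isLimit _)
      (Cone.ext (Iso.refl _) (fun _ => (Category.id_comp _).symm)))

/-- A coprojection of a cocone under the underlying diagram. -/
def incl (c : Cocone (D ⋙ forget A)) (j : J) : (D.obj j).obj ⟶ c.pt := c.ι.app j

lemma colim_ext {c : Cocone (D ⋙ forget A)} (hc : IsColimit c) {X : C} {a b : c.pt ⟶ X}
    (h : ∀ j, incl c j ≫ a = incl c j ≫ b) : a = b := hc.hom_ext h

/-- The induced linearization of a colimit. -/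
def coconeθ {c : Cocone (D ⋙ forget A)} (hc : IsColimit c) (g : G) : c.pt ≅ (A.φ g).obj c.pt :=
  hc.coconePointsIsoOfNatIso (isColimitOfPreserves (A.φ g) hc) (diagIso D g)

lemma incl_coconeθ_hom {c : Cocone (D ⋙ forget A)} (hc : IsColimit c) (g : G) (j : J) :
    incl c j ≫ (coconeθ hc g).hom = ((D.obj j).θ g).hom ≫ (A.φ g).map (incl c j) :=
  hc.comp_coconePointsIsoOfNatIso_hom (isColimitOfPreserves (A.φ g) hc) (diagIso D g) j

/-- The equivariant cocone on a colimit of the underlying diagram. -/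
def cocone {c : Cocone (D ⋙ forget A)} (hc : IsColimit c) : Cocone D where
  pt :=
    { obj := c.pt
      θ := coconeθ hc
      θ_mul g h k e := colim_ext hc fun j => by
        have h1 := (A.ε g h k e).hom.naturality (incl c j)
        dsimp at h1
        rw [incl_coconeθ_hom, (D.obj j).θ_mul g h k e, reassoc_of% incl_coconeθ_hom]
        simp only [Category.assoc]
        rw [← h1, ← Functor.map_comp_assoc, ← Functor.map_comp_assoc, incl_coconeθ_hom] }
  ι :=
    { app j := { hom := incl c j, comm := fun g => (incl_coconeθ_hom hc g j).symm }
      naturality _ _ f := by ext; exact c.ι.naturality f }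

/-- The descent of an equivariant cocone. -/
def descHom {c : Cocone (D ⋙ forget A)} (hc : IsColimit c) (s : Cocone D) : c.pt ⟶ s.pt.obj :=
  hc.desc ((forget A).mapCocone s)

lemma incl_descHom {c : Cocone (D ⋙ forget A)} (hc : IsColimit c) (s : Cocone D) (j : J) :
    incl c j ≫ descHom hc s = (s.ι.app j).hom := hc.fac ((forget A).mapCocone s) j

lemma descHom_comm {c : Cocone (D ⋙ forget A)} (hc : IsColimit c) (s : Cocone D) (g : G) :
    (coconeθ hc g).hom ≫ (A.φ g).map (descHom hc s) = descHom hc s ≫ (s.pt.θ g).hom :=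
  colim_ext hc fun j => by
    have h2 := (s.ι.app j).comm g
    dsimp at h2
    rw [reassoc_of% incl_coconeθ_hom, ← Functor.map_comp, reassoc_of% incl_descHom, incl_descHom, h2]

/-- The equivariant cocone is a colimit. -/
def coconeIsColimit {c : Cocone (D ⋙ forget A)} (hc : IsColimit c) : IsColimit (cocone hc) where
  desc s :=
    { hom := descHom hc s
      comm := descHom_comm hc s }
  fac s j := by ext; exact incl_descHom hc s j
  uniq s m hm := by
    ext
    exact hc.uniq ((forget A).mapCocone s) m.hom (fun j => congr_arg Hom.hom (hm j))

instance [HasColimitsOfShape J C] : HasColimitsOfShape J A.Equivariant where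
  has_colimit _ := ⟨⟨_, coconeIsColimit (colimit.isColimit _)⟩⟩

instance [HasColimitsOfShape J C] : PreservesColimitsOfShape J (forget A) where
  preservesColimit {_} := preservesColimit_of_preserves_colimit_cocone
    (coconeIsColimit (colimit.isColimit _))
    (IsColimit.ofIsoColimit (colimit.isColimit _)
      (Cocone.ext (Iso.refl _) (fun _ => Category.comp_id _)))

end Limits

section Abelian

variable [Abelian C]

instance : HasFiniteProducts A.Equivariant := ⟨fun _ => inferInstance⟩
instance : PreservesFiniteLimits (forget A) := ⟨fun _ _ _ => inferInstance⟩
instance : PreservesFiniteColimits (forget A) := ⟨fun _ _ _ => inferInstance⟩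

instance : Abelian A.Equivariant :=
  have : HasKernels A.Equivariant := ⟨fun _ => inferInstance⟩
  have : HasCokernels A.Equivariant := ⟨fun _ => inferInstance⟩
  have (E F : A.Equivariant) (f : E ⟶ F) : IsIso (Abelian.coimageImageComparison f) :=
    have : IsIso ((forget A).map (Abelian.coimageImageComparison f)) :=
      ((MorphismProperty.isomorphisms C).arrow_mk_iso_iff
        (Abelian.PreservesCoimageImageComparison.iso (forget A) f)).2
        (inferInstance : IsIso (Abelian.coimageImageComparison ((forget A).map f)))
    isIso_of_reflects_iso _ (forget A)
  Abelian.ofCoimageImageComparisonIsIso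

end Abelian

end Equivariant
section Induction

variable [Abelian C] {A : RightAction G C} {H : Subgroup G} (F : (A.restrict H).Equivariant)

attribute [local instance] Abelian.hasFiniteBiproducts

/-- The linearization `F ⟶ φ_h F` of an `H`-equivariant object, for `h ∈ H`. -/
def lin (h : G) (hh : h ∈ H) : F.obj ⟶ (A.φ h).obj F.obj := (F.θ ⟨h, hh⟩).hom

instance (h : G) (hh : h ∈ H) : IsIso (lin F h hh) := inferInstanceAs (IsIso (F.θ ⟨h, hh⟩).hom)

lemma lin_mul (g h k : G) (hg : g ∈ H) (hh : h ∈ H) (hk : k ∈ H) (e : h * g = k) :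
    lin F k hk = lin F g hg ≫ (A.φ g).map (lin F h hh) ≫ (A.ε g h k e).hom.app F.obj :=
  F.θ_mul ⟨g, hg⟩ ⟨h, hh⟩ ⟨k, hk⟩ (Subtype.ext e)

/-- For `b ∈ H a`, the isomorphism `φ_a F ⟶ φ_b F` given by the linearization of `F`. -/
def trans (a b : G) (hab : b * a⁻¹ ∈ H) : (A.φ a).obj F.obj ⟶ (A.φ b).obj F.obj :=
  (A.φ a).map (lin F (b * a⁻¹) hab) ≫ (A.ε a (b * a⁻¹) b (by simp)).hom.app F.obj

lemma trans_comp (a b c : G) (hab : b * a⁻¹ ∈ H) (hbc : c * b⁻¹ ∈ H) (hac : c * a⁻¹ ∈ H) :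
    trans F a b hab ≫ trans F b c hbc = trans F a c hac := by
  have h1 := (A.ε a (b * a⁻¹) b (by simp)).hom.naturality (lin F (c * b⁻¹) hbc)
  have h2 := A.assoc a (b * a⁻¹) (c * b⁻¹) b (c * a⁻¹) c (by simp) (by group) (by simp) (by simp)
    F.obj
  dsimp at h1
  simp only [trans, Category.assoc]
  rw [lin_mul F (b * a⁻¹) (c * b⁻¹) (c * a⁻¹) hab hbc hac (by group), Functor.map_comp,
    Functor.map_comp, Category.assoc, Category.assoc, h2, reassoc_of% h1]

lemma map_trans (g a b ag bg : G) (hab : b * a⁻¹ ∈ H) (ha : a * g = ag) (hb : b * g = bg)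
    (habg : bg * ag⁻¹ ∈ H) :
    (A.φ g).map (trans F a b hab) ≫ (A.ε g b bg hb).hom.app F.obj =
      (A.ε g a ag ha).hom.app F.obj ≫ trans F ag bg habg := by
  obtain ⟨h, rfl⟩ : ∃ h, b = h * a := ⟨b * a⁻¹, by simp⟩
  obtain rfl : bg = h * ag := by rw [← hb, ← ha, mul_assoc]
  have key (h' : G) (e : h' = h) (m : h' ∈ H) (m' : h * a * a⁻¹ ∈ H) (m'' : h * ag * ag⁻¹ ∈ H) :
      trans F a (h * a) m' = (A.φ a).map (lin F h' m) ≫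
        (A.ε a h' (h * a) (by rw [e])).hom.app F.obj ∧
      trans F ag (h * ag) m'' = (A.φ ag).map (lin F h' m) ≫
        (A.ε ag h' (h * ag) (by rw [e])).hom.app F.obj := by
    constructor
    · obtain rfl : h' = h * a * a⁻¹ := by simp [e]
      rfl
    · obtain rfl : h' = h * ag * ag⁻¹ := by simp [e]
      rfl
  have hh : h ∈ H := by simpa using hab
  rw [(key h rfl hh hab habg).1, (key h rfl hh hab habg).2]
  have h1 := (A.ε g a ag ha).hom.naturality (lin F h hh)
  have h2 := A.assoc g a h ag (h * a) (h * ag) ha rfl rfl hb F.obj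
  dsimp at h1
  rw [Functor.map_comp, Category.assoc, h2, reassoc_of% h1]

instance (a b : G) (hab : b * a⁻¹ ∈ H) : IsIso (trans F a b hab) := by
  dsimp only [trans]
  infer_instance

lemma trans_self (a : G) (ha : a * a⁻¹ ∈ H) : trans F a a ha = 𝟙 _ := by
  rw [← cancel_epi (trans F a a ha), trans_comp F a a a ha ha ha, Category.comp_id]

variable (H) in
/-- The set `H \ G` of cosets `H g`. -/
abbrev Cosets : Type w := Quotient (QuotientGroup.rightRel H)

/-- The coset `H g`. -/
abbrev coset (H : Subgroup G) (g : G) : Cosets H := Quotient.mk _ g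

/-- A chosen representative of a coset. -/
abbrev rep (i : Cosets H) : G := Quotient.out i

lemma rep_coset (H : Subgroup G) (g : G) : g * (rep (coset H g))⁻¹ ∈ H :=
  QuotientGroup.rightRel_apply.1 (Quotient.mk_out (s := QuotientGroup.rightRel H) g)

lemma coset_eq {a b : G} (h : b * a⁻¹ ∈ H) : coset H a = coset H b :=
  Quotient.sound (QuotientGroup.rightRel_apply.2 h)

lemma coset_rep (i : Cosets H) : coset H (rep i) = i := Quotient.out_eq i

variable [Finite G]

/-- The object `⨁_{[g] ∈ H \ G} φ_g F` underlying the induced equivariant object. -/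
abbrev indObj : C := ⨁ fun i : Cosets H => (A.φ (rep i)).obj F.obj

/-- The projection of the induced object to a summand. -/
abbrev indπ (i : Cosets H) : indObj F ⟶ (A.φ (rep i)).obj F.obj :=
  biproduct.π (fun i : Cosets H => (A.φ (rep i)).obj F.obj) i

lemma indπ_trans {i i' : Cosets H} (h : i = i') (h' : rep i' * (rep i)⁻¹ ∈ H) :
    indπ F i ≫ trans F _ _ h' = indπ F i' := by
  subst h
  rw [trans_self, Category.comp_id]

/-- The isomorphism `φ_g (⨁ φ_r F) ≅ ⨁ φ_g φ_r F`. -/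
def mapInd (g : G) : (A.φ g).obj (indObj F) ≅
    ⨁ fun i : Cosets H => (A.φ g).obj ((A.φ (rep i)).obj F.obj) :=
  have := preservesBiproduct_of_preservesProduct (A.φ g)
    (f := fun i : Cosets H => (A.φ (rep i)).obj F.obj)
  (A.φ g).mapBiproduct _

lemma map_π (g : G) (i : Cosets H) :
    (A.φ g).map (indπ F i) = (mapInd F g).hom ≫
      biproduct.π (fun i : Cosets H => (A.φ g).obj ((A.φ (rep i)).obj F.obj)) i := by
  have := preservesBiproduct_of_preservesProduct (A.φ g)
    (f := fun i : Cosets H => (A.φ (rep i)).obj F.obj)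
  have h : (mapInd F g).hom = biproduct.lift (fun j : Cosets H => (A.φ g).map (indπ F j)) :=
    Functor.mapBiproduct_hom _ _
  rw [h]
  exact (biproduct.lift_π (f := fun i : Cosets H => (A.φ g).obj ((A.φ (rep i)).obj F.obj))
    (fun j : Cosets H => (A.φ g).map (indπ F j)) i).symm

lemma map_ind_ext (g : G) {Y : C} {a b : Y ⟶ (A.φ g).obj (indObj F)}
    (h : ∀ i, a ≫ (A.φ g).map (indπ F i) = b ≫ (A.φ g).map (indπ F i)) : a = b := by
  rw [← cancel_mono (mapInd F g).hom]
  refine biproduct.hom_ext _ _ fun i => ?_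
  simpa only [Category.assoc, map_π] using h i

/-- The morphism `⨁ φ_r F ⟶ φ_g (⨁ φ_r F)` whose component towards `φ_g φ_r F` is
`φ_{r'} F ≅ φ_{r g} F ≅ φ_g φ_r F`, where `r'` is the representative of the coset `H r g`. -/
def indHom (g : G) : indObj F ⟶ (A.φ g).obj (indObj F) :=
  biproduct.lift (fun j : Cosets H => indπ F (coset H (rep j * g)) ≫
      trans F _ (rep j * g) (rep_coset H _) ≫ (A.ε g (rep j) _ rfl).inv.app F.obj) ≫
    (mapInd F g).inv

lemma indHom_map_π (g : G) (j : Cosets H) :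
    indHom F g ≫ (A.φ g).map (indπ F j) = indπ F (coset H (rep j * g)) ≫
      trans F _ (rep j * g) (rep_coset H _) ≫ (A.ε g (rep j) _ rfl).inv.app F.obj := by
  rw [map_π, indHom, Category.assoc, Iso.inv_hom_id_assoc]
  exact biproduct.lift_π (f := fun i : Cosets H => (A.φ g).obj ((A.φ (rep i)).obj F.obj)) _ _

/-- The inverse of `indHom`. -/
def indInv (g : G) : (A.φ g).obj (indObj F) ⟶ indObj F :=
  biproduct.lift fun i : Cosets H => (A.φ g).map (indπ F (coset H (rep i * g⁻¹))) ≫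
    (A.ε g _ _ rfl).hom.app F.obj ≫ trans F (rep (coset H (rep i * g⁻¹)) * g) (rep i)
      (by simpa [mul_assoc] using rep_coset H (rep i * g⁻¹))

lemma indInv_π (g : G) (i : Cosets H) :
    indInv F g ≫ indπ F i = (A.φ g).map (indπ F (coset H (rep i * g⁻¹))) ≫
    (A.ε g _ _ rfl).hom.app F.obj ≫ trans F (rep (coset H (rep i * g⁻¹)) * g) (rep i)
      (by simpa [mul_assoc] using rep_coset H (rep i * g⁻¹)) :=
  biproduct.lift_π _ _

lemma coset_mul_eq {a b g : G} (h : coset H a = coset H b) : coset H (a * g) = coset H (b * g) := by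
  have h' : b * a⁻¹ ∈ H := QuotientGroup.rightRel_apply.1 (Quotient.exact h)
  exact coset_eq (by simpa [mul_assoc] using h')

lemma mem_of_coset_eq {a b : G} (h : coset H a = coset H b) : b * a⁻¹ ∈ H :=
  QuotientGroup.rightRel_apply.1 (Quotient.exact h)

lemma indHom_indInv (g : G) : indHom F g ≫ indInv F g = 𝟙 _ := by
  refine biproduct.hom_ext _ _ fun i => ?_
  have hi : coset H (rep (coset H (rep i * g⁻¹)) * g) = i := by
    rw [coset_mul_eq (coset_rep _)]
    simp
  rw [Category.assoc, indInv_π, reassoc_of% indHom_map_π, Iso.inv_hom_id_app_assoc, trans_comp,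
    indπ_trans F hi, Category.id_comp]
  exact mem_of_coset_eq ((coset_rep _).trans (hi.trans (coset_rep _).symm))

lemma indInv_indHom (g : G) : indInv F g ≫ indHom F g = 𝟙 _ := by
  refine map_ind_ext F g fun j => ?_
  set i' := coset H (rep (coset H (rep j * g)) * g⁻¹) with hi'
  have hi : i' = j := by
    rw [hi', coset_mul_eq (coset_rep _)]
    simp
  have hm : rep j * (rep i')⁻¹ ∈ H := by simp [hi, H.one_mem]
  have hm' : rep j * g * (rep i' * g)⁻¹ ∈ H := by simp [hi, H.one_mem]
  rw [Category.assoc, indHom_map_π, reassoc_of% indInv_π, reassoc_of% trans_comp F _ _ _ _ _ hm',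
    ← reassoc_of% map_trans F g (rep i') (rep j) _ _ hm rfl rfl, Iso.hom_inv_id_app, Category.id_comp]
  simp only [Functor.comp_obj, Category.comp_id, ← Functor.map_comp]
  rw [indπ_trans F hi hm]

lemma indHom_mul (g h k : G) (e : h * g = k) :
    indHom F k = indHom F g ≫ (A.φ g).map (indHom F h) ≫ (A.ε g h k e).hom.app (indObj F) := by
  refine map_ind_ext F k fun j => ?_
  have h1 := (A.ε g h k e).hom.naturality (indπ F j)
  dsimp at h1
  rw [Category.assoc, Category.assoc, ← h1, ← Functor.map_comp_assoc, indHom_map_π, indHom_map_π]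
  set i := coset H (rep j * h) with hi
  have hm : rep j * k * (rep i * g)⁻¹ ∈ H := by
    simpa [mul_assoc, ← e] using rep_coset H (rep j * h)
  have hc : coset H (rep i * g) = coset H (rep j * k) := coset_eq hm
  have hm' : rep (coset H (rep j * k)) * (rep (coset H (rep i * g)))⁻¹ ∈ H := by
    simp [hc, H.one_mem]
  have h2 := A.assoc g h (rep j) k (rep j * h) (rep j * k) e rfl rfl (by simp [← e, mul_assoc])
    F.obj
  have h3 := map_trans F g (rep i) (rep j * h) (rep i * g) (rep j * k) (rep_coset H _) rfl
    (by simp [← e, mul_assoc]) hm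
  have h4 : (A.ε g (rep i) (rep i * g) rfl).inv.app F.obj ≫
      (A.φ g).map (trans F (rep i) (rep j * h) (rep_coset H _)) =
      trans F (rep i * g) (rep j * k) hm ≫
        (A.ε g (rep j * h) (rep j * k) (by simp [← e, mul_assoc])).inv.app F.obj := by
    rw [← cancel_epi ((A.ε g (rep i) (rep i * g) rfl).hom.app F.obj), Iso.hom_inv_id_app_assoc,
      ← reassoc_of% h3, Iso.hom_inv_id_app]
    exact (Category.comp_id _).symm
  have h5 : (A.ε g (rep j * h) (rep j * k) (by simp [← e, mul_assoc])).inv.app F.obj ≫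
      (A.φ g).map ((A.ε h (rep j) (rep j * h) rfl).inv.app F.obj) ≫
        (A.ε g h k e).hom.app ((A.φ (rep j)).obj F.obj) =
      (A.ε k (rep j) (rep j * k) rfl).inv.app F.obj := by
    rw [← cancel_mono ((A.ε k (rep j) (rep j * k) rfl).hom.app F.obj), Category.assoc,
      Category.assoc, ← h2, ← Functor.map_comp_assoc, Iso.inv_hom_id_app, Iso.inv_hom_id_app]
    dsimp only [Functor.comp_obj]
    erw [CategoryTheory.Functor.map_id, Category.id_comp]
    exact Iso.inv_hom_id_app _ _
  rw [← indπ_trans F hc hm', Functor.map_comp, Functor.map_comp]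
  simp only [Category.assoc]
  rw [reassoc_of% indHom_map_π, reassoc_of% h4]
  erw [h5]
  rw [reassoc_of% trans_comp, reassoc_of% trans_comp]
  exact mem_of_coset_eq ((coset_rep _).trans hc)

/-- The equivariant object `Ind F = ⨁_{[g] ∈ H \ G} φ_g F` induced from an `H`-equivariant
object `F`. -/
def ind : A.Equivariant where
  obj := indObj F
  θ g :=
    { hom := indHom F g
      inv := indInv F g
      hom_inv_id := indHom_indInv F g
      inv_hom_id := indInv_indHom F g }
  θ_mul g h k e := indHom_mul F g h k e

end Induction

end RightAction


/-- The functor `M ↦ M^~` preserves monomorphisms. -/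
instance (R : CommRingCat.{u}) : (tilde.functor R).PreservesMonomorphisms where
  preserves {M N} f hf := by
    have hinj : Function.Injective f.hom := (ModuleCat.mono_iff_injective f).1 hf
    apply Functor.mono_of_mono_map (Scheme.Modules.toPresheaf _)
    have (U : (TopologicalSpace.Opens (Spec (CommRingCat.of R)))ᵒᵖ) :
        Mono (((Scheme.Modules.toPresheaf _).map ((tilde.functor R).map f)).app U) := by
      rw [AddCommGrpCat.mono_iff_injective]
      intro x y hxy
      apply Subtype.ext
      funext p
      have := congr_fun (congr_arg Subtype.val hxy) p
      let q : PrimeSpectrum R := p.1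
      exact IsLocalizedModule.map_injective q.asIdeal.primeCompl
        (LocalizedModule.mkLinearMap q.asIdeal.primeCompl M)
        (LocalizedModule.mkLinearMap q.asIdeal.primeCompl N) f.hom hinj this
    exact NatTrans.mono_of_mono_app _

instance (R : CommRingCat.{u}) : PreservesFiniteLimits (tilde.functor R) :=
  have := (tilde.functor R).preservesHomology_of_preservesMonos_and_cokernels
  Functor.preservesFiniteLimits_of_preservesHomology _

variable {X Y : Scheme.{u}}

instance (j : X ⟶ Y) [IsOpenImmersion j] :
    (Scheme.Modules.restrictFunctor j).PreservesMonomorphisms where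
  preserves {M N} f hf := by
    apply Functor.mono_of_mono_map (Scheme.Modules.toPresheaf _)
    have hf' : Mono ((Scheme.Modules.toPresheaf _).map f) := inferInstance
    have (U : (TopologicalSpace.Opens X)ᵒᵖ) :
        Mono (((Scheme.Modules.toPresheaf _).map
          ((Scheme.Modules.restrictFunctor j).map f)).app U) :=
      (NatTrans.mono_iff_mono_app _).1 hf' (.op (j ''ᵁ U.unop))
    exact NatTrans.mono_of_mono_app _

instance (j : X ⟶ Y) [IsOpenImmersion j] : (Scheme.Modules.restrictFunctor j).Additive where

instance (j : X ⟶ Y) [IsOpenImmersion j] :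
    PreservesFiniteLimits (Scheme.Modules.restrictFunctor j) :=
  have := (Scheme.Modules.restrictFunctor j).preservesHomology_of_preservesMonos_and_cokernels
  Functor.preservesFiniteLimits_of_preservesHomology _

/-- A sheaf of modules `M` on a (locally noetherian) scheme is coherent if over each affine open
`Spec R` it is the sheaf `N^~` associated with a finitely generated `R`-module `N`. -/
def IsCoherent (X : Scheme.{u}) : ObjectProperty X.Modules := fun M =>
  ∀ (R : CommRingCat.{u}) (j : Spec R ⟶ X) [IsOpenImmersion j],
    ∃ N : ModuleCat.{u} R, Module.Finite R N ∧ Nonempty (M.restrict j ≅ tilde N)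

instance : (IsCoherent X).IsClosedUnderIsomorphisms where
  of_iso {M N} e hM R j _ := by
    obtain ⟨P, hP, ⟨i⟩⟩ := hM R j
    exact ⟨P, hP, ⟨((Scheme.Modules.restrictFunctor j).mapIso e).symm ≪≫ i⟩⟩


open ZeroObject in
instance : (IsCoherent X).ContainsZero where
  exists_zero := ⟨(0 : X.Modules), isZero_zero _, fun R j _ => ⟨ModuleCat.of R PUnit, inferInstance,
    ⟨((Scheme.Modules.restrictFunctor j).map_isZero (isZero_zero _)).iso
      ((tilde.functor R).map_isZero (ModuleCat.isZero_of_subsingleton _))⟩⟩⟩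

lemma isNoetherianRing_of_isOpenImmersion [IsLocallyNoetherian X] (R : CommRingCat.{u})
    (j : Spec R ⟶ X) [IsOpenImmersion j] : IsNoetherianRing R :=
  have := isLocallyNoetherian_of_isOpenImmersion j
  isLocallyNoetherian_Spec.1 this


instance [IsLocallyNoetherian X] : (IsCoherent X).IsClosedUnderKernels where
  kernels_le := by
    rintro _ ⟨f, k, hk, ⟨hM, hN⟩⟩ R j _
    obtain ⟨A, hA, ⟨a⟩⟩ := hM R j
    obtain ⟨B, hB, ⟨b⟩⟩ := hN R j
    have := isNoetherianRing_of_isOpenImmersion R j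
    let F := Scheme.Modules.restrictFunctor j
    obtain ⟨g, hg⟩ := (tilde.functor R).map_surjective (a.inv ≫ F.map f ≫ b.hom)
    refine ⟨kernel g, Module.Finite.equiv (ModuleCat.kernelIsoKer g).toLinearEquiv.symm, ⟨?_⟩⟩
    exact F.mapIso (hk.conePointUniqueUpToIso (kernelIsKernel f)) ≪≫ PreservesKernel.iso F f ≪≫
      kernel.mapIso (F.map f) ((tilde.functor R).map g) a b (by rw [hg]; exact (Iso.hom_inv_id_assoc a _).symm) ≪≫
      (PreservesKernel.iso (tilde.functor R) g).symm

instance : (IsCoherent X).IsClosedUnderCokernels where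
  cokernels_le := by
    rintro _ ⟨f, k, hk, ⟨hM, hN⟩⟩ R j _
    obtain ⟨A, hA, ⟨a⟩⟩ := hM R j
    obtain ⟨B, hB, ⟨b⟩⟩ := hN R j
    let F := Scheme.Modules.restrictFunctor j
    obtain ⟨g, hg⟩ := (tilde.functor R).map_surjective (a.inv ≫ F.map f ≫ b.hom)
    refine ⟨cokernel g, Module.Finite.of_surjective (cokernel.π g).hom
      ((ModuleCat.epi_iff_surjective _).1 inferInstance), ⟨?_⟩⟩
    exact F.mapIso (hk.coconePointUniqueUpToIso (cokernelIsCokernel f)) ≪≫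
      PreservesCokernel.iso F f ≪≫
      cokernel.mapIso (F.map f) ((tilde.functor R).map g) a b
        (by rw [hg]; exact (Iso.hom_inv_id_assoc a _).symm) ≪≫
      (PreservesCokernel.iso (tilde.functor R) g).symm

attribute [local instance] HasBinaryBiproducts.of_hasBinaryProducts in
instance : (IsCoherent X).IsClosedUnderBinaryProducts :=
  ObjectProperty.IsClosedUnderLimitsOfShape.mk' (by
    rintro _ ⟨D, hD⟩ R j _
    obtain ⟨A, hA, ⟨a⟩⟩ := hD ⟨.left⟩ R j
    obtain ⟨B, hB, ⟨b⟩⟩ := hD ⟨.right⟩ R j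
    let F := Scheme.Modules.restrictFunctor j
    refine ⟨A ⨯ B, ?_, ⟨?_⟩⟩
    · exact Module.Finite.equiv ((ModuleCat.biprodIsoProd A B).symm ≪≫ biprod.isoProd A B).toLinearEquiv
    exact F.mapIso (HasLimit.isoOfNatIso (diagramIsoPair D)) ≪≫ PreservesLimitPair.iso F _ _ ≪≫
      prod.mapIso a b ≪≫ (PreservesLimitPair.iso (tilde.functor R) A B).symm)

instance : (IsCoherent X).IsClosedUnderFiniteProducts := .mk'

/-- The category of coherent sheaves. -/
abbrev Coh (X : Scheme.{u}) := (IsCoherent X).FullSubcategory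

instance [IsLocallyNoetherian X] : Abelian (Coh X) := inferInstance

section Action

variable {k : Type u} [Field k] {X : Over (Spec (.of k))} {G : Type w} [Group G]

/-- The automorphism of the underlying scheme given by a group element. -/
def act (ρ : G →* Aut X) (g : G) : X.left ⟶ X.left := (ρ g).hom.left

instance (ρ : G →* Aut X) (g : G) : IsIso (act ρ g) :=
  (inferInstance : IsIso ((Over.forget _).mapIso (ρ g)).hom)

lemma act_mul (ρ : G →* Aut X) (g h k : G) (e : h * g = k) : act ρ g ≫ act ρ h = act ρ k := by
  rw [← e]
  simp only [act, map_mul]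
  rfl

lemma act_one (ρ : G →* Aut X) : act ρ 1 = 𝟙 _ := by
  simp only [act, map_one]
  rfl

lemma isCoherent_restrict {Y Z : Scheme.{u}} (f : Y ⟶ Z) [IsOpenImmersion f] {M : Z.Modules}
    (hM : IsCoherent Z M) : IsCoherent Y (M.restrict f) := fun R j _ => by
  obtain ⟨N, hN, ⟨e⟩⟩ := hM R (j ≫ f)
  exact ⟨N, hN, ⟨((Scheme.Modules.restrictFunctorComp j f).app M).symm ≪≫ e⟩⟩

/-- The restriction functor on coherent sheaves along an open immersion. -/
def cohRestrict {Y Z : Scheme.{u}} (f : Y ⟶ Z) [IsOpenImmersion f] : Coh Z ⥤ Coh Y :=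
  ObjectProperty.lift _ ((IsCoherent Z).ι ⋙ Scheme.Modules.restrictFunctor f)
    fun M => isCoherent_restrict f M.property

/-- `g^* h^* M ≅ k^* M` for `g ≫ h = k`. -/
def restrictCompIso {W Y Z : Scheme.{u}} (f : W ⟶ Y) (g : Y ⟶ Z) (h : W ⟶ Z) [IsOpenImmersion f]
    [IsOpenImmersion g] [IsOpenImmersion h] (e : f ≫ g = h) :
    Scheme.Modules.restrictFunctor g ⋙ Scheme.Modules.restrictFunctor f ≅
      Scheme.Modules.restrictFunctor h :=
  (Scheme.Modules.restrictFunctorComp f g).symm ≪≫ Scheme.Modules.restrictFunctorCongr e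

lemma image_eq {W Y Z : Scheme.{u}} {f : W ⟶ Y} {g : Y ⟶ Z} {h : W ⟶ Z} [IsOpenImmersion f]
    [IsOpenImmersion g] [IsOpenImmersion h] (e : f ≫ g = h) (U : W.Opens) :
    h ''ᵁ U = g ''ᵁ (f ''ᵁ U) := by
  subst e
  simp

lemma map_map {Y : Scheme.{u}} (M : Y.Modules) {U V W : Y.Opensᵒᵖ} (a : U ⟶ V) (b : V ⟶ W)
    (c : U ⟶ W) : M.presheaf.map a ≫ M.presheaf.map b = M.presheaf.map c :=
  (M.presheaf.map_comp a b).symm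

lemma restrictCompIso_app {W Y Z : Scheme.{u}} {f : W ⟶ Y} {g : Y ⟶ Z} {h : W ⟶ Z}
    [IsOpenImmersion f] [IsOpenImmersion g] [IsOpenImmersion h] (e : f ≫ g = h) (M : Z.Modules)
    (U : W.Opens) : ((restrictCompIso f g h e).hom.app M).app U =
      M.presheaf.map (eqToHom (image_eq e U)).op :=
  map_map M (eqToHom (image_eq (h := f ≫ g) rfl U)).op
    (eqToHom (show h ''ᵁ U = (f ≫ g) ''ᵁ U by subst e; rfl)).op (eqToHom (image_eq e U)).op

/-- `g^* h^* M ≅ k^* M` for coherent sheaves and `g ≫ h = k`. -/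
def cohRestrictComp {W Y Z : Scheme.{u}} (f : W ⟶ Y) (g : Y ⟶ Z) (h : W ⟶ Z) [IsOpenImmersion f]
    [IsOpenImmersion g] [IsOpenImmersion h] (e : f ≫ g = h) :
    cohRestrict g ⋙ cohRestrict f ≅ cohRestrict h :=
  NatIso.ofComponents
    (fun M => ObjectProperty.isoMk _ ((restrictCompIso f g h e).app M.obj))
    (fun f => ObjectProperty.hom_ext _ ((restrictCompIso _ _ h e).hom.naturality f.hom))

/-- The pullback along the identity is isomorphic to the identity. -/
def cohRestrictId (Y : Scheme.{u}) : cohRestrict (𝟙 Y) ≅ 𝟭 (Coh Y) :=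
  NatIso.ofComponents
    (fun M => ObjectProperty.isoMk _ (Scheme.Modules.restrictFunctorId.app M.obj))
    (fun f => ObjectProperty.hom_ext _ (Scheme.Modules.restrictFunctorId.hom.naturality f.hom))

instance cohRestrict_isEquivalence {Y Z : Scheme.{u}} (f : Y ⟶ Z) [IsIso f] :
    (cohRestrict f).IsEquivalence :=
  (CategoryTheory.Equivalence.mk (cohRestrict f) (cohRestrict (inv f))
    ((cohRestrictId _).symm ≪≫ (cohRestrictComp _ _ _ (IsIso.inv_hom_id f)).symm)
    (cohRestrictComp _ _ _ (IsIso.hom_inv_id f) ≪≫ cohRestrictId _)).isEquivalence_functor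

/-- The right action of `G` on the category of coherent sheaves by pullback of sheaves,
`φ_g = g^*`, with `g^* h^* ≅ (h g)^*`. -/
def cohAction (ρ : G →* Aut X) : RightAction G (Coh X.left) where
  φ g := cohRestrict (act ρ g)
  isEquivalence g := inferInstance
  ε g h k e := cohRestrictComp _ _ _ (act_mul ρ g h k e)
  assoc f g h gf hg hgf e₁ e₂ e₃ e₄ F := by
    apply ObjectProperty.hom_ext
    refine Scheme.Modules.hom_ext _ _ fun U => ?_
    have h₁ := restrictCompIso_app (act_mul ρ f g gf e₁) ((cohRestrict (act ρ h)).obj F).obj U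
    have h₂ := restrictCompIso_app (act_mul ρ gf h hgf e₃) F.obj U
    have h₃ := restrictCompIso_app (act_mul ρ g h hg e₂) F.obj (act ρ f ''ᵁ U)
    have h₄ := restrictCompIso_app (act_mul ρ f hg hgf e₄) F.obj U
    have h₁₂ := congr_arg₂ (· ≫ ·) h₁ h₂
    have h₃₄ := congr_arg₂ (· ≫ ·) h₃ h₄
    refine h₃₄.trans (Eq.trans ?_ h₁₂.symm)
    let c := (eqToHom ((image_eq (act_mul ρ gf h hgf e₃) U).trans
      (congr_arg (act ρ h ''ᵁ ·) (image_eq (act_mul ρ f g gf e₁) U)))).op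
    exact (map_map F.obj _ _ c).trans (map_map F.obj (eqToHom (congr_arg (act ρ h ''ᵁ ·)
      (image_eq (act_mul ρ f g gf e₁) U))).op
        (eqToHom (image_eq (act_mul ρ gf h hgf e₃) U)).op c).symm

end Action

section SkyscraperSheaf

variable {k : Type u} [Field k] {X : Over (Spec (.of k))} {G : Type w} [Group G]

/-- The `k`-rational points of a scheme over `k`. -/
abbrev Point (X : Over (Spec (.of k))) := Over.mk (𝟙 (Spec (.of k))) ⟶ X

/-- The morphism of schemes underlying a `k`-rational point. -/
abbrev Point.hom (x : Point X) : Spec (.of k) ⟶ X.left := Over.Hom.left x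

lemma Point.hom_comp (x : Point X) : x.hom ≫ X.hom = 𝟙 _ := Over.w x

/-- The direct image of the structure sheaf. -/
abbrev pushUnit {W Y : Scheme.{u}} (p : W ⟶ Y) : Y.Modules :=
  (Scheme.Modules.pushforward p).obj (SheafOfModules.unit W.ringCatSheaf)

lemma isZero_of_subsingleton_sections {Y : Scheme.{u}} (M : Y.Modules)
    (h : ∀ U : Y.Opens, Subsingleton Γ(M, U)) : IsZero M := by
  rw [IsZero.iff_id_eq_zero]
  refine Scheme.Modules.hom_ext _ _ fun U => ?_
  ext x
  exact (h U).elim _ _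

lemma isCoherent_pushUnit_of_fac {K R : CommRingCat.{u}} (y : Spec K ⟶ Spec R)
    (q : Spec R ⟶ Spec K) (hq : y ≫ q = 𝟙 _) :
    ∃ N : ModuleCat.{u} R, Module.Finite R N ∧ Nonempty (pushUnit y ≅ tilde N) := by
  obtain ⟨f, rfl⟩ := Spec.map_surjective y
  have := isIso_fromTildeΓ_pushforward f (SheafOfModules.unit (Spec K).ringCatSheaf)
  refine ⟨_, ?_, ⟨(asIso (pushUnit (Spec.map f)).fromTildeΓ).symm⟩⟩
  let N : ModuleCat R := (modulesSpecToSheaf.obj (pushUnit (Spec.map f))).presheaf.obj (.op ⊤)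
  change Module.Finite R N
  let one : N := (1 : Γ(Spec K, Spec.map f ⁻¹ᵁ ⊤))
  refine Module.Finite.of_surjective (LinearMap.toSpanSingleton R N one) fun s => ?_
  let s' : Γ(Spec K, Spec.map f ⁻¹ᵁ ⊤) := s
  obtain ⟨g, rfl⟩ := Spec.map_surjective q
  have hfg : g ≫ f = 𝟙 _ := by
    apply Spec.map_injective
    rw [Spec.map_comp, hq, Spec.map_id]
  let t : K := (Scheme.ΓSpecIso K).hom s'
  refine ⟨g t, ?_⟩
  rw [LinearMap.toSpanSingleton_apply]
  have h1 : f (g t) = t := congr($hfg t)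
  have h2 : (Spec.map f).appTop ((Scheme.ΓSpecIso R).inv (g t)) =
      (Scheme.ΓSpecIso K).inv (f (g t)) :=
    (congr($(Scheme.ΓSpecIso_inv_naturality f) (g t))).symm
  have h3 : (Scheme.ΓSpecIso K).inv t = s' := congr($((Scheme.ΓSpecIso K).hom_inv_id) s')
  rw [h1, h3] at h2
  have h4 : (Spec R).presheaf.map (⊤ : (Spec R).Opens).leTop.op ((Scheme.ΓSpecIso R).inv (g t)) =
      (Scheme.ΓSpecIso R).inv (g t) := congr($((Spec R).presheaf.map_id (.op ⊤)) _)
  refine Eq.trans ?_ h2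
  refine Eq.trans ?_ (mul_one (M := Γ(Spec K, ⊤)) _)
  exact congr_arg (fun a => (Spec.map f).appTop a * 1) h4

lemma isCoherent_pushUnit (p : Point X) : IsCoherent X.left (pushUnit p.hom) := fun R j _ => by
  by_cases hj : Set.range p.hom ⊆ Set.range j
  · let y := IsOpenImmersion.lift j p.hom hj
    have hy : y ≫ j = p.hom := IsOpenImmersion.lift_fac j p.hom hj
    obtain ⟨N, hN, ⟨e⟩⟩ := isCoherent_pushUnit_of_fac y (j ≫ X.hom)
      (by rw [← Category.assoc, hy, p.hom_comp])
    refine ⟨N, hN, ⟨?_ ≪≫ e⟩⟩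
    exact (Scheme.Modules.restrictFunctor j).mapIso
      ((Scheme.Modules.pushforwardCongr hy.symm).app _ ≪≫
        ((Scheme.Modules.pushforwardComp y j).app _).symm) ≪≫
      (Scheme.Modules.restrictFunctorAdjCounitIso j).app _
  · refine ⟨ModuleCat.of R PUnit, inferInstance, ⟨IsZero.iso ?_
      ((tilde.functor R).map_isZero (ModuleCat.isZero_of_subsingleton _))⟩⟩
    refine isZero_of_subsingleton_sections _ fun U => ?_
    have h0 : p.hom ⁻¹ᵁ (j ''ᵁ U) = ⊥ := by
      obtain ⟨_, ⟨t, rfl⟩, ht⟩ := Set.not_subset.1 hj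
      ext t'
      obtain rfl : t' = t := Subsingleton.elim _ _
      simp only [TopologicalSpace.Opens.coe_bot, Set.mem_empty_iff_false, iff_false]
      rintro ⟨z, -, hz⟩
      exact ht ⟨z, hz⟩
    change Subsingleton Γ(Spec (.of k), p.hom ⁻¹ᵁ (j ''ᵁ U))
    rw [h0]
    infer_instance

/-- The skyscraper sheaf `𝒪_x` of a `k`-rational point `x`, i.e. the direct image of `𝒪_{Spec k}`
under `x : Spec k ⟶ X`. -/
def skyscraper (x : Point X) : Coh X.left := ⟨pushUnit x.hom, isCoherent_pushUnit x⟩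

/-- The stabilizer of a point. -/
def stab (ρ : G →* Aut X) (x : Point X) : Subgroup G where
  carrier := {g | x ≫ (ρ g).hom = x}
  one_mem' := by
    have : (ρ 1).hom = 𝟙 X := by rw [map_one]; rfl
    change x ≫ (ρ 1).hom = x
    rw [this, Category.comp_id]
  mul_mem' {a b} ha hb := by
    have ha : x ≫ (ρ a).hom = x := ha
    have hb : x ≫ (ρ b).hom = x := hb
    have : (ρ (a * b)).hom = (ρ b).hom ≫ (ρ a).hom := by rw [map_mul]; rfl
    change x ≫ (ρ (a * b)).hom = x
    rw [this, ← Category.assoc, hb, ha]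
  inv_mem' {a} ha := by
    have ha : x ≫ (ρ a).hom = x := ha
    have : (ρ a⁻¹).hom = (ρ a).inv := by rw [map_inv]; rfl
    change x ≫ (ρ a⁻¹).hom = x
    rw [this]
    exact (Iso.comp_inv_eq (ρ a : X ≅ X)).2 ha.symm

/-- If `h` is an open immersion with `p ≫ h = p`, the canonical isomorphism
`p_* 𝒪 ≅ h^* h_* p_* 𝒪 ≅ h^* p_* 𝒪`. -/
def pushUnitIso {W Y : Scheme.{u}} (p : W ⟶ Y) (h : Y ⟶ Y) [IsOpenImmersion h] (e : p ≫ h = p) :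
    pushUnit p ≅ (pushUnit p).restrict h :=
  ((Scheme.Modules.restrictFunctorAdjCounitIso h).app (pushUnit p)).symm ≪≫
    (Scheme.Modules.restrictFunctor h).mapIso ((Scheme.Modules.pushforwardComp p h).app _ ≪≫
      (Scheme.Modules.pushforwardCongr e).app _)

lemma preimage_image_of_fac {W Y : Scheme.{u}} {p : W ⟶ Y} {h : Y ⟶ Y} [IsOpenImmersion h]
    (e : p ≫ h = p) (U : Y.Opens) : p ⁻¹ᵁ (h ''ᵁ U) = p ⁻¹ᵁ U := by
  conv_lhs => rw [← e]
  simp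

/-- On sections over `U`, the isomorphism `pushUnitIso` is the identity of
`Γ(W, p⁻¹ U) = Γ(W, p⁻¹ (h U))`. -/
lemma pushUnitIso_app {W Y : Scheme.{u}} {p : W ⟶ Y} {h : Y ⟶ Y} [IsOpenImmersion h]
    (e : p ≫ h = p) (U : Y.Opens) :
    (pushUnitIso p h e).hom.app U = (Scheme.Modules.presheaf (SheafOfModules.unit W.ringCatSheaf)).map (eqToHom (preimage_image_of_fac e U)).op := by
  have h1 : ((Scheme.Modules.restrictFunctorAdjCounitIso h).inv.app (pushUnit p)).app U =
    (pushUnit p).presheaf.map (eqToHom (h.preimage_image_eq U)).op := rfl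
  have h2 : ((Scheme.Modules.pushforwardCongr e).hom.app
      (SheafOfModules.unit W.ringCatSheaf)).app (h ''ᵁ U) =
      (Scheme.Modules.presheaf (SheafOfModules.unit W.ringCatSheaf)).map
        (eqToHom (by rw [e])).op := rfl
  refine (congr_arg₂ (· ≫ ·) h1 ((Category.id_comp _).trans h2)).trans ?_
  exact map_map (Y := W) (SheafOfModules.unit W.ringCatSheaf)
    (eqToHom (congr_arg (p ⁻¹ᵁ ·) (h.preimage_image_eq U))).op (eqToHom (congr_arg (· ⁻¹ᵁ (h ''ᵁ U)) e.symm)).op _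

end SkyscraperSheaf

section PointSheaf

variable {k : Type u} [Field k] {X : Over (Spec (.of k))} {G : Type w} [Group G]

lemma Point.hom_act (ρ : G →* Aut X) (x : Point X) (g : G) (hg : g ∈ stab ρ x) :
    x.hom ≫ act ρ g = x.hom :=
  congr_arg Over.Hom.left (show x ≫ (ρ g).hom = x from hg)

/-- The skyscraper sheaf `𝒪_x` with the linearization with respect to the stabilizer `G_x` for
which `G_x` acts trivially on the fibre: on sections over `U`, the map `𝒪_x ⟶ g^* 𝒪_x` is the
identity of `Γ(Spec k, x⁻¹ U) = Γ(Spec k, x⁻¹ (g U))`. -/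
def skyscraperLin (ρ : G →* Aut X) (x : Point X) :
    ((cohAction ρ).restrict (stab ρ x)).Equivariant where
  obj := skyscraper x
  θ h := ObjectProperty.isoMk _ (pushUnitIso x.hom (act ρ h.1) (x.hom_act ρ h.1 h.2))
  θ_mul g h l e := by
    apply ObjectProperty.hom_ext
    refine Scheme.Modules.hom_ext _ _ fun U => ?_
    have e' : h.1 * g.1 = l.1 := congr_arg Subtype.val e
    have hg := x.hom_act ρ g.1 g.2
    have hh := x.hom_act ρ h.1 h.2
    have hk := x.hom_act ρ l.1 l.2
    have h₁ := pushUnitIso_app hk U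
    have h₂ := pushUnitIso_app hg U
    have h₃ := pushUnitIso_app hh (act ρ g.1 ''ᵁ U)
    have h₄ := restrictCompIso_app (act_mul ρ g.1 h.1 l.1 e') (skyscraper x).obj U
    refine h₁.trans (Eq.trans ?_ (congr_arg₂ (· ≫ ·) h₂ (congr_arg₂ (· ≫ ·) h₃ h₄)).symm)
    let M : (Spec (.of k)).Modules := SheafOfModules.unit (Spec (.of k)).ringCatSheaf
    let a := (eqToHom (preimage_image_of_fac hg U)).op
    let b := (eqToHom (preimage_image_of_fac hh (act ρ g.1 ''ᵁ U))).op
    let c := (eqToHom (congr_arg (x.hom ⁻¹ᵁ ·) (image_eq (act_mul ρ g.1 h.1 l.1 e') U))).op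
    exact ((congr_arg (M.presheaf.map a ≫ ·) (map_map M b c (b ≫ c))).trans
      (map_map M a (b ≫ c) _)).symm

variable [IsLocallyNoetherian X.left] [Finite G]

/-- The `G`-equivariant sheaf `P_x` of the orbit of `x`, induced from the `G_x`-equivariant
sheaf `𝒪_x`. -/
def pointSheaf (ρ : G →* Aut X) (x : Point X) : (cohAction ρ).Equivariant :=
  RightAction.ind (skyscraperLin ρ x)

end PointSheaf

section BoundedDerived

variable {A : Type*} [Category* A] [Abelian A] [HasDerivedCategory A]
  {B : Type*} [Category* B] [Abelian B] [HasDerivedCategory B]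

open DerivedCategory

/-- An object of an abelian category as a complex in degree zero. -/
def single (E : A) : Bounded A :=
  ⟨(singleFunctor A 0).obj E, ⟨⟨0, inferInstance⟩, ⟨0, inferInstance⟩⟩⟩

lemma bounded_map (F : A ⥤ B) [F.Additive] [PreservesFiniteLimits F] [PreservesFiniteColimits F]
    (E : DerivedCategory A) (hE : TStructure.t.bounded E) :
    TStructure.t.bounded (F.mapDerivedCategory.obj E) := by
  obtain ⟨⟨a, ha⟩, ⟨b, hb⟩⟩ := hE
  have : E.IsGE a := ha
  have : E.IsLE b := hb
  obtain ⟨K, _, _, ⟨e⟩⟩ := exists_iso_Q_obj_of_isGE_of_isLE E a b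
  let e' := F.mapDerivedCategory.mapIso e ≪≫ F.mapDerivedCategoryFactors.app K
  exact ⟨⟨a, _, e', inferInstance⟩, ⟨b, _, e', inferInstance⟩⟩

/-- The functor `D^b(A) ⥤ D^b(B)` induced by an exact functor `A ⥤ B`. -/
def mapBounded (F : A ⥤ B) [F.Additive] [PreservesFiniteLimits F] [PreservesFiniteColimits F] :
    Bounded A ⥤ Bounded B :=
  ObjectProperty.lift _ (Bounded.ι ⋙ F.mapDerivedCategory) fun E => bounded_map F E.obj E.property

instance (F : A ⥤ B) [F.Additive] [PreservesFiniteLimits F] [PreservesFiniteColimits F] :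
    (mapBounded F).CommShift ℤ :=
  inferInstanceAs ((ObjectProperty.lift _ (Bounded.ι ⋙ F.mapDerivedCategory) _).CommShift ℤ)

instance (F : A ⥤ B) [F.Additive] [PreservesFiniteLimits F] [PreservesFiniteColimits F] :
    (mapBounded F).IsTriangulated :=
  inferInstanceAs ((ObjectProperty.lift _ (Bounded.ι ⋙ F.mapDerivedCategory) _).IsTriangulated)

end BoundedDerived

section Stability

open Pretriangulated

variable (D : Type*) [Category* D] [Preadditive D] [HasZeroObject D] [HasShift D ℤ]
  [∀ n : ℤ, (shiftFunctor D n).Additive] [Pretriangulated D]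

/-- The relations `[E₂] = [E₁] + [E₃]` given by the distinguished triangles
`E₁ ⟶ E₂ ⟶ E₃ ⟶ E₁⟦1⟧`. -/
def K0Relations : AddSubgroup (FreeAbelianGroup D) :=
  AddSubgroup.closure {a | ∃ T ∈ distTriang D,
    a = FreeAbelianGroup.of T.obj₂ - FreeAbelianGroup.of T.obj₁ - FreeAbelianGroup.of T.obj₃}

/-- The Grothendieck group of a triangulated category. -/
abbrev K0 := FreeAbelianGroup D ⧸ K0Relations D

variable {D}

/-- The class of an object in the Grothendieck group. -/
def K0.mk (E : D) : K0 D := QuotientAddGroup.mk (FreeAbelianGroup.of E)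

/-- The homomorphism `[E] ↦ [F E]` of Grothendieck groups induced by a triangulated functor `F`. -/
def K0.map {D' : Type*} [Category* D'] [Preadditive D'] [HasZeroObject D'] [HasShift D' ℤ]
    [∀ n : ℤ, (shiftFunctor D' n).Additive] [Pretriangulated D'] (F : D ⥤ D') [F.CommShift ℤ]
    [F.IsTriangulated] : K0 D →+ K0 D' :=
  QuotientAddGroup.map _ _ (FreeAbelianGroup.map F.obj) (by
    rw [K0Relations, AddSubgroup.closure_le]
    rintro _ ⟨T, hT, rfl⟩
    change FreeAbelianGroup.map F.obj _ ∈ K0Relations D'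
    refine AddSubgroup.subset_closure ⟨F.mapTriangle.obj T, F.map_distinguished T hT, ?_⟩
    simp)

variable (D) in
/-- A pair `(Z, P)` of a central charge and of a collection of full subcategories `P φ`. -/
structure StabilityData where
  Z : K0 D →+ ℂ
  P : ℝ → ObjectProperty D

/-- A filtration `0 = E₀ ⟶ E₁ ⟶ ⋯ ⟶ Eₙ = E` whose factors, the cones `Aᵢ` of `Eᵢ ⟶ Eᵢ₊₁`, are
nonzero and lie in subcategories `P φᵢ` with strictly decreasing phases `φᵢ`. -/
structure HNFiltration (P : ℝ → ObjectProperty D) (E : D) where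
  n : ℕ
  phase : Fin n → ℝ
  phase_anti : StrictAnti phase
  obj : Fin (n + 1) → D
  isZero_first : IsZero (obj 0)
  lastIso : obj (Fin.last n) ≅ E
  factor : Fin n → D
  factor_mem : ∀ i, P (phase i) (factor i)
  factor_ne_zero : ∀ i, ¬ IsZero (factor i)
  exists_triangle : ∀ i : Fin n, ∃ (a : obj i.castSucc ⟶ obj i.succ) (b : obj i.succ ⟶ factor i)
    (c : factor i ⟶ (obj i.castSucc)⟦(1 : ℤ)⟧), Triangle.mk a b c ∈ distTriang D

namespace StabilityData

variable (σ : StabilityData D)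

/-- The full subcategory `P(I)` of the objects which are zero or whose Harder-Narasimhan phases
all lie in `I`. -/
def PInterval (I : Set ℝ) : ObjectProperty D := fun E =>
  ∃ F : HNFiltration σ.P E, ∀ i, F.phase i ∈ I

/-- The category of objects satisfying `Q` is of finite length as a quasi-abelian category:
ascending and descending chains of strict subobjects of any object are stationary. Strict
monomorphisms are those which are kernels. -/
def IsFiniteLength (Q : ObjectProperty D) : Prop :=
  ∀ E : Q.FullSubcategory,
    WellFoundedLT {S : Subobject E // Nonempty (NormalMono S.arrow)} ∧
      WellFoundedGT {S : Subobject E // Nonempty (NormalMono S.arrow)}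

/-- Locally finite Bridgeland stability conditions. -/
structure IsStabilityCondition : Prop where
  closedUnderIsomorphisms : ∀ φ, (σ.P φ).IsClosedUnderIsomorphisms
  closedUnderFiniteProducts : ∀ φ, (σ.P φ).IsClosedUnderFiniteProducts
  exists_Z_eq : ∀ (φ : ℝ) (E : D), σ.P φ E → ¬ IsZero E →
    ∃ m : ℝ, 0 < m ∧ σ.Z (K0.mk E) = m * Complex.exp (Complex.I * Real.pi * φ)
  shift_iff : ∀ (φ : ℝ) (E : D), σ.P (φ + 1) (E⟦(1 : ℤ)⟧) ↔ σ.P φ E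
  hom_eq_zero : ∀ (φ₁ φ₂ : ℝ) (A₁ A₂ : D), φ₂ < φ₁ → σ.P φ₁ A₁ → σ.P φ₂ A₂ →
    ∀ f : A₁ ⟶ A₂, f = 0
  exists_hn : ∀ E : D, ¬ IsZero E → Nonempty (HNFiltration σ.P E)
  locallyFinite : ∃ η : ℝ, 0 < η ∧ η < 1 / 2 ∧
    ∀ t : ℝ, IsFiniteLength (σ.PInterval (Set.Ioo (t - η) (t + η)))

/-- `E` is stable of phase `φ`: it is a simple object of the category `P φ`. -/
def IsStable (φ : ℝ) (E : D) : Prop :=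
  ∃ h : σ.P φ E, Simple (⟨E, h⟩ : (σ.P φ).FullSubcategory)

end StabilityData

end Stability

section Main

attribute [local instance] MvPolynomial.gradedAlgebra in
/-- Smooth projective varieties over `k`: integral schemes which are smooth over `k` and admit a
closed immersion over `k` into a projective space. -/
class SmoothProjectiveVariety {k : Type u} [Field k] (X : Over (Spec (.of k))) : Prop where
  isIntegral : IsIntegral X.left
  smooth : Smooth X.hom
  projective : ∃ (n : ℕ)
    (i : X.left ⟶ Proj (MvPolynomial.homogeneousSubmodule (Fin (n + 1)) k)), IsClosedImmersion i ∧
      i ≫ Proj.toSpecZero _ ≫ Spec.map (CommRingCat.ofHom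
        (algebraMap k (MvPolynomial.homogeneousSubmodule (Fin (n + 1)) k 0))) = X.hom

variable {k : Type u} [Field k] {X : Over (Spec (.of k))}

instance [h : SmoothProjectiveVariety X] : IsLocallyNoetherian X.left :=
  have := h.smooth
  LocallyOfFiniteType.isLocallyNoetherian X.hom

instance [SmoothProjectiveVariety X] : HasDerivedCategory (Coh X.left) :=
  HasDerivedCategory.standard _

variable {G : Type w} [Group G] (ρ : G →* Aut X)

instance [SmoothProjectiveVariety X] : HasDerivedCategory (cohAction ρ).Equivariant :=
  HasDerivedCategory.standard _

variable [SmoothProjectiveVariety X]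

variable (X) in
/-- `D^b(X)`, the bounded derived category of coherent sheaves. -/
abbrev Db := DerivedCategory.Bounded (Coh X.left)

/-- `D^b_G(X)`, the bounded derived category of `G`-equivariant coherent sheaves. -/
abbrev DbG := DerivedCategory.Bounded (cohAction ρ).Equivariant

/-- The functor `g^*` on `D^b(X)`. -/
abbrev pullbackDb (g : G) : Db X ⥤ Db X := mapBounded ((cohAction ρ).φ g)

/-- The functor `D^b_G(X) ⥤ D^b(X)` forgetting the equivariant structure. -/
abbrev res : DbG ρ ⥤ Db X := mapBounded (RightAction.Equivariant.forget (cohAction ρ))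

/-- The skyscraper sheaf `𝒪_x`, as an object of `D^b(X)`. -/
def skyscraperDb (x : Point X) : Db X := single (skyscraper x)

/-- The `G`-point sheaf `P_x`, as an object of `D^b_G(X)`. -/
def pointSheafDb [Finite G] (x : Point X) : DbG ρ := single (pointSheaf ρ x)

/-- `G`-invariance of `σ = (Z, P)`: `g^* P(φ) = P(φ)` and `Z(g^* E) = Z(E)`. -/
structure IsGInvariant (σ : StabilityData (Db X)) : Prop where
  map_P : ∀ (g : G) (φ : ℝ), (σ.P φ).map (pullbackDb ρ g) = σ.P φ
  Z_map : ∀ g : G, σ.Z.comp (K0.map (pullbackDb ρ g)) = σ.Z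

/-- `Res⁻¹ (Z, P) = (Z ∘ Res, Res⁻¹ P)`. -/
def resInv (σ : StabilityData (Db X)) : StabilityData (DbG ρ) where
  Z := σ.Z.comp (K0.map (res ρ))
  P φ := (σ.P φ).inverseImage (res ρ)

/-- Geometric stability conditions on `D^b(X)`: all the skyscraper sheaves of points are stable of
the same phase. -/
def IsGeometric (σ : StabilityData (Db X)) : Prop :=
  σ.IsStabilityCondition ∧ ∃ φ : ℝ, ∀ x : Point X, σ.IsStable φ (skyscraperDb x)

/-- Geometric stability conditions on `D^b_G(X)`: all the `G`-point sheaves are stable of the same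
phase. -/
def IsGeometricEquivariant [Finite G] (τ : StabilityData (DbG ρ)) : Prop :=
  τ.IsStabilityCondition ∧ ∃ φ : ℝ, ∀ x : Point X, τ.IsStable φ (pointSheafDb ρ x)

end Main

end GStab

end

open GStab

/-!
The restriction `Res : D^b_G(X) ⥤ D^b(X)` has the functor `Ind`, induced by the exact functor
`M ↦ ⨁ g^* M` over all `g ∈ G`, both as a left and as a right adjoint. The composite
`E ⟶ Ind Res E ⟶ E` of the unit and the counit is the multiplication by the order of `G`, which is
invertible, and `M ⟶ Res Ind M ⟶ M` is the identity. The structure `AmbiAdjunction` records this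
situation. Morphisms `Res E ⟶ Res F` can be averaged to morphisms `E ⟶ F`, and `E` is a direct
summand of `Ind Res E`. By invariance, `Res Ind M = ⨁ g^* M` is semistable of phase `φ` if `M` is.

*`Res⁻¹ σ` is a stability condition* (`IsStabilityCondition.inverseImage`). The essential point is
that the Harder-Narasimhan filtration of `Res E` lifts to `E`. Consider the last triangle
`B ⟶ Res E ⟶ A` of the filtration. The projection of `Ind Res E` onto its summand `E` induces an
idempotent of `Ind B`, since there are no nonzero morphisms from `Ind B` to `Ind A`; the image of
this idempotent is the lift of `B` (`AmbiAdjunction.exists_isTri_lift`). The idempotent has an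
image because bounded derived categories are idempotent complete; this is proved by induction on
the amplitude of a complex, with the truncation triangles (`splits_of_distTriang`).

*Semistable objects.* The category `P φ` is abelian (`IsStabilityCondition.abelian`): the phases
of the cone of a morphism of `P φ` lie in `[φ, φ + 1]`, and its central charge lies on a line
which forces them to be `φ` or `φ + 1`. By local finiteness every nonzero object of `P φ` has a
simple subobject. An object is simple if and only if it is nonzero, semisimple and indecomposable;
semisimplicity is studied by descent along the adjunctions, and indecomposability, in the form of
the triviality of idempotents, by sheaf theory.

*From `𝒪_x` to `P_x`.* If `𝒪_x` is stable, `Res P_x` is a direct sum of stable objects `g^* 𝒪_x`,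
so it is semisimple in `P φ`. As in Maschke's theorem, averaging retractions shows that `P_x` is
semisimple (`isSemisimpleObj_inverseImage`). There are no nonzero morphisms between the skyscraper
sheaves of different points, so an idempotent endomorphism of `P_x` is block diagonal; its blocks
are `0` or `1`, and they agree because the equivariant structure permutes the summands
transitively (`hasTrivialIdempotents_ind`).

*From `P_x` to `𝒪_x`.* If `P_x` is stable, take a simple subobject `S` of `Res P_x` in `P φ`. The
adjoint `Ind S ⟶ P_x` is nonzero, hence an epimorphism, and `Res P_x` is a quotient of the
semisimple object `⨁ g^* S` (`isSemisimpleObj_of_isStable_inverseImage`). Its direct summand `𝒪_x`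
is thus semisimple, and since the endomorphisms of `𝒪_x` are scalars, it is simple.
-/

noncomputable section

namespace GStab

/-! ### Semisimple objects of abelian categories -/

section Semisimple

variable {C : Type*} [Category* C]

/-- An object is semisimple if each of its subobjects is a direct summand. -/
def IsSemisimpleObj (X : C) : Prop := ∀ (Y : C) (f : Y ⟶ X) [Mono f], IsSplitMono f

/-- All idempotent endomorphisms of `X` are trivial. -/
def HasTrivialIdempotents [HasZeroMorphisms C] (X : C) : Prop :=
  ∀ e : X ⟶ X, e ≫ e = e → e = 0 ∨ e = 𝟙 X

lemma HasTrivialIdempotents.of_fullyFaithful [Preadditive C] {D : Type*} [Category* D]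
    [Preadditive D] {F : C ⥤ D} [F.Additive] (hF : F.FullyFaithful) {X : C}
    (hX : HasTrivialIdempotents X) : HasTrivialIdempotents (F.obj X) := fun e he => by
  obtain ⟨f, rfl⟩ := hF.map_surjective e
  rw [← F.map_comp] at he
  rcases hX f (hF.map_injective he) with rfl | rfl
  · exact Or.inl (F.map_zero _ _)
  · exact Or.inr (F.map_id _)

lemma HasTrivialIdempotents.of_map [Preadditive C] {D : Type*} [Category* D]
    [Preadditive D] (F : C ⥤ D) [F.Additive] [F.Faithful] {X : C}
    (hX : HasTrivialIdempotents (F.obj X)) : HasTrivialIdempotents X := fun e he => by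
  rcases hX (F.map e) (by rw [← F.map_comp, he]) with h | h
  · exact Or.inl (F.map_injective (by rw [h, F.map_zero]))
  · exact Or.inr (F.map_injective (by rw [h, F.map_id]))

lemma IsSemisimpleObj.of_mono {X Y : C} (hX : IsSemisimpleObj X) (i : Y ⟶ X) [Mono i] :
    IsSemisimpleObj Y := fun Z f _ => by
  have := hX Z (f ≫ i)
  exact ⟨⟨⟨i ≫ retraction (f ≫ i), by rw [← Category.assoc, IsSplitMono.id]⟩⟩⟩

lemma isSemisimpleObj_of_simple [HasZeroMorphisms C] [HasZeroObject C] (S : C) [Simple S] :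
    IsSemisimpleObj S := fun Y f _ => by
  by_cases h : f = 0
  · have hY : IsZero Y := by
      rw [IsZero.iff_id_eq_zero, ← cancel_mono f, h, comp_zero, comp_zero]
    exact ⟨⟨⟨0, hY.eq_of_src _ _⟩⟩⟩
  · have := isIso_of_mono_of_nonzero h
    infer_instance

/-- A nonzero semisimple object without nontrivial idempotents is simple: the projection onto a
nonzero subobject must be the identity. -/
lemma IsSemisimpleObj.simple [HasZeroMorphisms C] {X : C} (hX : IsSemisimpleObj X)
    (h0 : 𝟙 X ≠ 0) (hi : HasTrivialIdempotents X) : Simple X where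
  mono_isIso_iff_nonzero {Y} f _ := by
    refine ⟨fun h hf => h0 ?_, fun hf => ?_⟩
    · subst hf
      rw [← IsIso.inv_hom_id (0 : Y ⟶ X), comp_zero]
    · have := hX Y f
      rcases hi (retraction f ≫ f) (by simp) with h | h
      · refine (hf ?_).elim
        rw [← Category.id_comp f, ← IsSplitMono.id f, Category.assoc, h, comp_zero]
      · exact ⟨retraction f, IsSplitMono.id f, h⟩

variable [Abelian C]

lemma IsSemisimpleObj.of_epi {X Y : C} (hX : IsSemisimpleObj X) (p : X ⟶ Y) [Epi p] :
    IsSemisimpleObj Y := by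
  have := hX _ (kernel.ι p)
  let r := retraction (kernel.ι p)
  have hr : kernel.ι p ≫ r = 𝟙 _ := IsSplitMono.id _
  have hw : kernel.ι p ≫ (𝟙 X - r ≫ kernel.ι p) = 0 := by simp [reassoc_of% hr]
  -- the complementary projection `1 - r ≫ ι` descends to a section of `p`
  let s : Y ⟶ X := (Abelian.epiIsCokernelOfKernel _ (kernelIsKernel p)).desc
    (CokernelCofork.ofπ _ hw)
  have hs : p ≫ s = 𝟙 X - r ≫ kernel.ι p :=
    (Abelian.epiIsCokernelOfKernel _ (kernelIsKernel p)).fac (CokernelCofork.ofπ _ hw)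
      WalkingParallelPair.one
  have hsp : s ≫ p = 𝟙 Y := by
    rw [← cancel_epi p, reassoc_of% hs]
    simp
  have : Mono s := mono_of_mono_fac hsp
  exact hX.of_mono s

lemma IsSemisimpleObj.biprod {X Y : C} (hX : IsSemisimpleObj X) (hY : IsSemisimpleObj Y) :
    IsSemisimpleObj (X ⊞ Y) := fun B m _ => by
  -- `K = B ∩ X` splits off `X`, and `I = B / K` splits off `Y`
  let k := kernel.ι (m ≫ biprod.snd)
  have hk : k ≫ m ≫ biprod.snd = 0 := kernel.condition _
  have : Mono (k ≫ m ≫ biprod.fst) := Preadditive.mono_of_cancel_zero _ fun g hg => by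
    rw [← cancel_mono k, ← cancel_mono m, zero_comp, zero_comp]
    apply biprod.hom_ext
    · simpa using hg
    · simp [hk]
  have h1 := hX _ (k ≫ m ≫ biprod.fst)
  let r := retraction (k ≫ m ≫ biprod.fst)
  have hr : k ≫ m ≫ biprod.fst ≫ r = 𝟙 _ := by
    have := IsSplitMono.id (k ≫ m ≫ biprod.fst)
    rwa [Category.assoc, Category.assoc] at this
  have h2 := hY _ (Abelian.image.ι (m ≫ biprod.snd))
  let ρ := retraction (Abelian.image.ι (m ≫ biprod.snd))
  have hρ : Abelian.image.ι (m ≫ biprod.snd) ≫ ρ = 𝟙 _ := IsSplitMono.id _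
  let q := Abelian.factorThruImage (m ≫ biprod.snd)
  have hq : q ≫ Abelian.image.ι (m ≫ biprod.snd) = m ≫ biprod.snd := Abelian.image.fac _
  have hkq : k ≫ q = 0 := by
    rw [← cancel_mono (Abelian.image.ι (m ≫ biprod.snd)), Category.assoc, hq, hk, zero_comp]
  have hlim : IsLimit (KernelFork.ofι k hkq) :=
    KernelFork.IsLimit.ofι' k hkq fun g hg =>
      ⟨kernel.lift _ g (by rw [← hq, reassoc_of% hg, zero_comp]), kernel.lift_ι _ _ _⟩
  have hw : k ≫ (𝟙 B - m ≫ biprod.fst ≫ r ≫ k) = 0 := by simp [reassoc_of% hr]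
  let w' : Abelian.image (m ≫ biprod.snd) ⟶ B :=
    (Abelian.epiIsCokernelOfKernel _ hlim).desc (CokernelCofork.ofπ _ hw)
  have hw' : q ≫ w' = 𝟙 B - m ≫ biprod.fst ≫ r ≫ k :=
    (Abelian.epiIsCokernelOfKernel _ hlim).fac (CokernelCofork.ofπ _ hw) WalkingParallelPair.one
  refine ⟨⟨⟨biprod.fst ≫ r ≫ k + biprod.snd ≫ ρ ≫ w', ?_⟩⟩⟩
  rw [Preadditive.comp_add, ← reassoc_of% hq, reassoc_of% hρ, hw']
  abel

open ZeroObject in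
/-- An object with finitely many jointly monic morphisms to semisimple objects is semisimple. -/
lemma isSemisimpleObj_of_jointly_mono {ι : Type*} [Finite ι] {X : C} {S : ι → C}
    (hS : ∀ i, IsSemisimpleObj (S i)) (π : ∀ i, X ⟶ S i)
    (hπ : ∀ (Y : C) (f : Y ⟶ X), (∀ i, f ≫ π i = 0) → f = 0) : IsSemisimpleObj X := by
  have := Fintype.ofFinite ι
  classical
  have key (s : Finset ι) : ∃ (Z : C) (p : X ⟶ Z), IsSemisimpleObj Z ∧
      ∀ (Y : C) (f : Y ⟶ X), f ≫ p = 0 → ∀ i ∈ s, f ≫ π i = 0 := by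
    induction s using Finset.induction_on with
    | empty =>
      refine ⟨(0 : C), 0, fun Y f _ => ⟨⟨⟨0, ?_⟩⟩⟩, by simp⟩
      rw [← cancel_mono f]
      exact (isZero_zero C).eq_of_tgt _ _
    | insert i t _ ih =>
      obtain ⟨Z, p, hZ, hp⟩ := ih
      refine ⟨S i ⊞ Z, biprod.lift (π i) p, (hS i).biprod hZ, fun Y f hf j hj => ?_⟩
      have hf1 : f ≫ π i = 0 := by simpa using congr($hf ≫ biprod.fst)
      have hf2 : f ≫ p = 0 := by simpa using congr($hf ≫ biprod.snd)
      rcases Finset.mem_insert.1 hj with rfl | hj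
      · exact hf1
      · exact hp Y f hf2 j hj
  obtain ⟨Z, p, hZ, hp⟩ := key Finset.univ
  have : Mono p := Preadditive.mono_of_cancel_zero _ fun f hf =>
    hπ _ f fun i => hp _ f hf i (Finset.mem_univ i)
  exact hZ.of_mono p

end Semisimple

/-! ### Harder–Narasimhan filtrations -/

section HarderNarasimhan

open Pretriangulated

variable {D : Type*} [Category* D] [Preadditive D] [HasZeroObject D] [HasShift D ℤ]
  [∀ n : ℤ, (shiftFunctor D n).Additive] [Pretriangulated D]

section Exactness

variable {X Y Z W : D} {a : X ⟶ Y} {b : Y ⟶ Z} {c : Z ⟶ X⟦(1 : ℤ)⟧}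
  (hT : Triangle.mk a b c ∈ distTriang D)
include hT

lemma exists_lift₂ (f : W ⟶ Y) (hf : f ≫ b = 0) : ∃ g : W ⟶ X, f = g ≫ a :=
  Triangle.coyoneda_exact₂ _ hT f hf

lemma exists_desc₂ (f : Y ⟶ W) (hf : a ≫ f = 0) : ∃ g : Z ⟶ W, f = b ≫ g :=
  Triangle.yoneda_exact₂ _ hT f hf

lemma exists_lift₃ (f : W ⟶ Z) (hf : f ≫ c = 0) : ∃ g : W ⟶ Y, f = g ≫ b :=
  Triangle.coyoneda_exact₃ _ hT f hf

lemma exists_desc₃ (f : Z ⟶ W) (hf : b ≫ f = 0) : ∃ g : X⟦(1 : ℤ)⟧ ⟶ W, f = c ≫ g :=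
  Triangle.yoneda_exact₃ _ hT f hf

/-- A morphism to the first object of a distinguished triangle is determined by its composition with
the first morphism if there are no nonzero morphisms to the desuspension of the third object. -/
lemma eq_zero_of_comp_mor₁ (h : ∀ g : W ⟶ Z⟦(-1 : ℤ)⟧, g = 0) (f : W ⟶ X) (hf : f ≫ a = 0) :
    f = 0 := by
  obtain ⟨g, hg⟩ : ∃ g : W ⟶ Z⟦(-1 : ℤ)⟧, f = g ≫ (Triangle.mk a b c).invRotate.mor₁ :=
    Triangle.coyoneda_exact₂ _ (inv_rot_of_distTriang _ hT) f hf
  rw [hg, h g]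
  exact zero_comp

lemma isZero_obj₁_iff_isIso : IsZero X ↔ IsIso b := Triangle.isZero₁_iff_isIso₂ _ hT

lemma mor₁_comp_mor₂ : a ≫ b = 0 := comp_distTriang_mor_zero₁₂ _ hT

end Exactness

/-- `X`, `Y`, `Z` are the objects of a distinguished triangle `X ⟶ Y ⟶ Z ⟶ X⟦1⟧`. -/
def IsTri (X Y Z : D) : Prop :=
  ∃ (a : X ⟶ Y) (b : Y ⟶ Z) (c : Z ⟶ X⟦(1 : ℤ)⟧), Triangle.mk a b c ∈ distTriang D

lemma IsTri.of_iso {X Y Z X' Y' Z' : D} (h : IsTri X Y Z) (e₁ : X ≅ X') (e₂ : Y ≅ Y')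
    (e₃ : Z ≅ Z') : IsTri X' Y' Z' := by
  obtain ⟨a, b, c, hT⟩ := h
  refine ⟨e₁.inv ≫ a ≫ e₂.hom, e₂.inv ≫ b ≫ e₃.hom, e₃.inv ≫ c ≫ e₁.hom⟦1⟧', ?_⟩
  have h1 : (e₁.inv ≫ a ≫ e₂.hom) ≫ e₂.inv = e₁.inv ≫ a := by simp
  have h2 : (e₂.inv ≫ b ≫ e₃.hom) ≫ e₃.inv = e₂.inv ≫ b := by simp
  have h3 : (e₃.inv ≫ c ≫ e₁.hom⟦1⟧') ≫ e₁.inv⟦1⟧' = e₃.inv ≫ c := by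
    simp only [Category.assoc, ← Functor.map_comp, Iso.hom_inv_id, CategoryTheory.Functor.map_id,
      Category.comp_id]
  exact isomorphic_distinguished _ hT _ (Triangle.isoMk _ _ e₁.symm e₂.symm e₃.symm h1 h2 h3)

lemma IsTri.shift {X Y Z : D} (h : IsTri X Y Z) (n : ℤ) : IsTri (X⟦n⟧) (Y⟦n⟧) (Z⟦n⟧) := by
  obtain ⟨a, b, c, hT⟩ := h
  exact ⟨_, _, _, Triangle.shift_distinguished _ hT n⟩

lemma IsTri.map {D' : Type*} [Category* D'] [Preadditive D'] [HasZeroObject D'] [HasShift D' ℤ]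
    [∀ n : ℤ, (shiftFunctor D' n).Additive] [Pretriangulated D'] (F : D ⥤ D') [F.CommShift ℤ]
    [F.IsTriangulated] {X Y Z : D} (h : IsTri X Y Z) : IsTri (F.obj X) (F.obj Y) (F.obj Z) := by
  obtain ⟨a, b, c, hT⟩ := h
  exact ⟨_, _, _, F.map_distinguished _ hT⟩

lemma isTri_self_zero (X : D) {Z : D} (hZ : IsZero Z) : IsTri X X Z :=
  IsTri.of_iso ⟨_, _, _, contractible_distinguished X⟩ (Iso.refl _) (Iso.refl _)
    ((isZero_zero D).iso hZ)

lemma isTri_zero_self (X : D) {Z : D} (hZ : IsZero Z) : IsTri Z X X :=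
  IsTri.of_iso ⟨_, _, _, contractible_distinguished₁ X⟩ ((isZero_zero D).iso hZ) (Iso.refl _)
    (Iso.refl _)

/-- `HasHN P l E`: the object `E` has a Harder-Narasimhan filtration whose phases are the members
of `l`, listed in increasing order (so that the head of `l` is the phase of the last factor). -/
inductive HasHN (P : ℝ → ObjectProperty D) : List ℝ → D → Prop
  | nil {E : D} (hE : IsZero E) : HasHN P [] E
  | cons {φ : ℝ} {l : List ℝ} {E' E A : D} (h : HasHN P l E') (hT : IsTri E' E A) (hA : P φ A)
      (h0 : ¬ IsZero A) (hl : ∀ ψ ∈ l, φ < ψ) : HasHN P (φ :: l) E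

namespace HasHN

variable {P : ℝ → ObjectProperty D}

lemma of_iso {l : List ℝ} {E F : D} (h : HasHN P l E) (e : E ≅ F) : HasHN P l F := by
  cases h with
  | nil hE => exact .nil (hE.of_iso e.symm)
  | cons h hT hA h0 hl => exact .cons h (hT.of_iso (Iso.refl _) e (Iso.refl _)) hA h0 hl

lemma of_isZero_tgt {l : List ℝ} {E : D} (h : HasHN P l E) (h0 : l = []) : IsZero E := by
  subst h0
  cases h
  assumption

/-- The conversion of an `HNFiltration` into the inductive form, which adds one factor at a time. -/
lemma of_hnFiltration {E : D} (F : HNFiltration P E) :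
    ∃ l, HasHN P l E ∧ ∀ ψ ∈ l, ∃ i, F.phase i = ψ := by
  have key (i : Fin (F.n + 1)) : ∃ l, HasHN P l (F.obj i) ∧
      ∀ ψ ∈ l, ∃ j : Fin F.n, j.castSucc < i ∧ F.phase j = ψ := by
    induction i using Fin.induction with
    | zero => exact ⟨[], .nil F.isZero_first, by simp⟩
    | succ i ih =>
      obtain ⟨l, hl, hl'⟩ := ih
      refine ⟨F.phase i :: l, .cons hl (F.exists_triangle i) (F.factor_mem i)
        (F.factor_ne_zero i) fun ψ hψ => ?_, fun ψ hψ => ?_⟩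
      · obtain ⟨j, hj, rfl⟩ := hl' ψ hψ
        exact F.phase_anti (Fin.castSucc_lt_castSucc_iff.1 hj)
      · rcases List.mem_cons.1 hψ with rfl | hψ
        · exact ⟨i, Fin.castSucc_lt_succ, rfl⟩
        · obtain ⟨j, hj, rfl⟩ := hl' ψ hψ
          exact ⟨j, hj.trans Fin.castSucc_lt_succ, rfl⟩
  obtain ⟨l, hl, hl'⟩ := key (Fin.last _)
  exact ⟨l, hl.of_iso F.lastIso, fun ψ hψ => (hl' ψ hψ).imp fun _ h => h.2⟩

/-- The conversion of the inductive form of a Harder-Narasimhan filtration into an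
`HNFiltration`. -/
lemma exists_hnFiltration {l : List ℝ} {E : D} (h : HasHN P l E) :
    ∃ F : HNFiltration P E, ∀ i, F.phase i ∈ l := by
  induction h with
  | @nil E hE =>
    exact ⟨{ n := 0, phase := Fin.elim0, phase_anti := fun i => i.elim0, obj := fun _ => E,
             isZero_first := hE, lastIso := Iso.refl _, factor := Fin.elim0,
             factor_mem := fun i => i.elim0, factor_ne_zero := fun i => i.elim0,
             exists_triangle := fun i => i.elim0 }, fun i => i.elim0⟩
  | @cons φ l E' E A h hT hA h0 hl ih =>
    obtain ⟨F, hF⟩ := ih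
    have htri (i : Fin (F.n + 1)) : IsTri (Fin.snoc (α := fun _ => D) F.obj E i.castSucc)
        (Fin.snoc (α := fun _ => D) F.obj E i.succ) (Fin.snoc (α := fun _ => D) F.factor A i) := by
      cases i using Fin.lastCases with
      | last =>
        rw [Fin.succ_last, Fin.snoc_castSucc, Fin.snoc_last, Fin.snoc_last]
        exact hT.of_iso F.lastIso.symm (Iso.refl _) (Iso.refl _)
      | cast j =>
        rw [Fin.succ_castSucc, Fin.snoc_castSucc, Fin.snoc_castSucc, Fin.snoc_castSucc]
        exact F.exists_triangle j
    refine ⟨{ n := F.n + 1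
              phase := Fin.snoc (α := fun _ => ℝ) F.phase φ
              phase_anti := ?_
              obj := Fin.snoc (α := fun _ => D) F.obj E
              isZero_first := ?_
              lastIso := eqToIso (Fin.snoc_last ..)
              factor := Fin.snoc (α := fun _ => D) F.factor A
              factor_mem := ?_
              factor_ne_zero := ?_
              exists_triangle := htri }, ?_⟩
    · intro i j hij
      cases j using Fin.lastCases with
      | last =>
        cases i using Fin.lastCases with
        | last => exact (lt_irrefl _ hij).elim
        | cast i =>
          rw [Fin.snoc_castSucc, Fin.snoc_last]
          exact hl _ (hF i)
      | cast j =>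
        cases i using Fin.lastCases with
        | last => exact (lt_asymm hij (Fin.castSucc_lt_last j)).elim
        | cast i =>
          rw [Fin.snoc_castSucc, Fin.snoc_castSucc]
          exact F.phase_anti (Fin.castSucc_lt_castSucc_iff.1 hij)
    · rw [← Fin.castSucc_zero, Fin.snoc_castSucc]
      exact F.isZero_first
    · intro i
      cases i using Fin.lastCases with
      | last => simpa only [Fin.snoc_last] using hA
      | cast i => simpa only [Fin.snoc_castSucc] using F.factor_mem i
    · intro i
      cases i using Fin.lastCases with
      | last => simpa only [Fin.snoc_last] using h0
      | cast i => simpa only [Fin.snoc_castSucc] using F.factor_ne_zero i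
    · intro i
      cases i using Fin.lastCases with
      | last =>
        change Fin.snoc (α := fun _ => ℝ) F.phase φ (Fin.last _) ∈ _
        rw [Fin.snoc_last]
        exact List.mem_cons_self
      | cast i =>
        change Fin.snoc (α := fun _ => ℝ) F.phase φ i.castSucc ∈ _
        rw [Fin.snoc_castSucc]
        exact List.mem_cons_of_mem _ (hF i)

/-- A triangulated functor which maps `P φ` to `P' φ` and reflects zero objects maps
Harder-Narasimhan filtrations to Harder-Narasimhan filtrations with the same phases. -/
lemma map {D' : Type*} [Category* D'] [Preadditive D'] [HasZeroObject D'] [HasShift D' ℤ]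
    [∀ n : ℤ, (shiftFunctor D' n).Additive] [Pretriangulated D'] {P' : ℝ → ObjectProperty D'}
    (F : D ⥤ D') [F.CommShift ℤ] [F.IsTriangulated] (hF : ∀ φ A, P φ A → P' φ (F.obj A))
    (h0 : ∀ A, IsZero (F.obj A) → IsZero A) {l : List ℝ} {E : D} (h : HasHN P l E) :
    HasHN P' l (F.obj E) := by
  induction h with
  | nil hE => exact .nil (F.map_isZero hE)
  | cons h hT hA hA0 hl ih => exact .cons ih (hT.map F) (hF _ _ hA) (fun h => hA0 (h0 _ h)) hl

end HasHN

lemma isZero_of_shift {E : D} (n : ℤ) (h : IsZero (E⟦n⟧)) : IsZero E := by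
  rw [IsZero.iff_id_eq_zero] at h ⊢
  exact (shiftFunctor D n).map_injective (by
    rw [CategoryTheory.Functor.map_id, h, CategoryTheory.Functor.map_zero])

/-- The objects without nonzero morphisms to `Y` are closed under extensions. -/
lemma IsTri.hom_eq_zero {X E Z Y : D} (h : IsTri X E Z) (hX : ∀ f : X ⟶ Y, f = 0)
    (hZ : ∀ f : Z ⟶ Y, f = 0) (f : E ⟶ Y) : f = 0 := by
  obtain ⟨a, b, c, hT⟩ := h
  obtain ⟨g, hg⟩ := exists_desc₂ hT f (hX _)
  rw [hg, hZ g, comp_zero]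

lemma IsTri.hom_eq_zero' {X E Z Y : D} (h : IsTri X E Z) (hX : ∀ f : Y ⟶ X, f = 0)
    (hZ : ∀ f : Y ⟶ Z, f = 0) (f : Y ⟶ E) : f = 0 := by
  obtain ⟨a, b, c, hT⟩ := h
  obtain ⟨g, hg⟩ := exists_lift₂ hT f (hZ _)
  rw [hg, hX g, zero_comp]

lemma HasHN.hom_eq_zero {P : ℝ → ObjectProperty D} {l : List ℝ} {E Y : D} (h : HasHN P l E)
    (hY : ∀ φ ∈ l, ∀ A, P φ A → ∀ f : A ⟶ Y, f = 0) (f : E ⟶ Y) : f = 0 := by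
  induction h with
  | nil hE => exact hE.eq_of_src _ _
  | cons h hT hA _ _ ih =>
    exact hT.hom_eq_zero (ih fun φ hφ => hY φ (List.mem_cons_of_mem _ hφ))
      (hY _ List.mem_cons_self _ hA) f

lemma HasHN.hom_eq_zero' {P : ℝ → ObjectProperty D} {l : List ℝ} {E Y : D} (h : HasHN P l E)
    (hY : ∀ φ ∈ l, ∀ A, P φ A → ∀ f : Y ⟶ A, f = 0) (f : Y ⟶ E) : f = 0 := by
  induction h with
  | nil hE => exact hE.eq_of_tgt _ _
  | cons h hT hA _ _ ih =>
    exact hT.hom_eq_zero' (ih fun φ hφ => hY φ (List.mem_cons_of_mem _ hφ))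
      (hY _ List.mem_cons_self _ hA) f

end HarderNarasimhan

/-! ### The categories of semistable objects -/

namespace StabilityData

open Pretriangulated

variable {D : Type*} [Category* D] [Preadditive D] [HasZeroObject D] [HasShift D ℤ]
  [∀ n : ℤ, (shiftFunctor D n).Additive] [Pretriangulated D] {σ : StabilityData D}

lemma pInterval_iff {I : Set ℝ} {E : D} :
    σ.PInterval I E ↔ ∃ l, HasHN σ.P l E ∧ ∀ φ ∈ l, φ ∈ I := by
  constructor
  · rintro ⟨F, hF⟩
    obtain ⟨l, hl, hl'⟩ := HasHN.of_hnFiltration F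
    refine ⟨l, hl, fun φ hφ => ?_⟩
    obtain ⟨i, rfl⟩ := hl' φ hφ
    exact hF i
  · rintro ⟨l, hl, hl'⟩
    obtain ⟨F, hF⟩ := hl.exists_hnFiltration
    exact ⟨F, fun i => hl' _ (hF i)⟩

namespace IsStabilityCondition

variable (hσ : σ.IsStabilityCondition)
include hσ

lemma of_iso {φ : ℝ} {E F : D} (h : σ.P φ E) (e : E ≅ F) : σ.P φ F :=
  have := hσ.closedUnderIsomorphisms φ
  (σ.P φ).prop_of_iso e h

lemma of_isZero (φ : ℝ) {E : D} (h : IsZero E) : σ.P φ E :=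
  have := hσ.closedUnderIsomorphisms φ
  have := hσ.closedUnderFiniteProducts φ
  have : (σ.P φ).ContainsZero :=
    ⟨⊤_ D, (isZero_zero D).of_iso ((isZero_zero D).isoIsTerminal terminalIsTerminal).symm,
      (σ.P φ).prop_terminal⟩
  (σ.P φ).prop_of_isZero h

lemma shift_iff_int (n : ℤ) (φ : ℝ) (E : D) : σ.P (φ + n) (E⟦n⟧) ↔ σ.P φ E := by
  have hadd (n : ℤ) : E⟦n + 1⟧ ≅ (E⟦n⟧)⟦(1 : ℤ)⟧ := (shiftFunctorAdd D n 1).app E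
  have step (n : ℤ) : σ.P (φ + (n + 1 : ℤ)) (E⟦n + 1⟧) ↔ σ.P (φ + n) (E⟦n⟧) := by
    rw [← hσ.shift_iff (φ + n), Int.cast_add, Int.cast_one, ← add_assoc]
    exact ⟨fun h => hσ.of_iso h (hadd n), fun h => hσ.of_iso h (hadd n).symm⟩
  induction n using Int.induction_on with
  | zero =>
    have e : E⟦(0 : ℤ)⟧ ≅ E := (shiftFunctorZero D ℤ).app E
    simp only [Int.cast_zero, add_zero]
    exact ⟨fun h => hσ.of_iso h e, fun h => hσ.of_iso h e.symm⟩
  | succ n ih => exact (step n).trans ih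
  | pred n ih =>
    have := step (-(n : ℤ) - 1)
    rw [sub_add_cancel] at this
    exact this.symm.trans ih

/-- There are no nonzero morphisms from `P φ` to `P ψ⟦n⟧` if `ψ + n < φ`. -/
lemma hom_shift_eq_zero {φ ψ : ℝ} {n : ℤ} (h : ψ + n < φ) {A B : D} (hA : σ.P φ A)
    (hB : σ.P ψ B) (f : A ⟶ B⟦n⟧) : f = 0 :=
  hσ.hom_eq_zero _ _ _ _ h hA ((hσ.shift_iff_int n ψ B).2 hB) f

lemma hasHN_of_mem {φ : ℝ} {E : D} (h : σ.P φ E) : ∃ l, HasHN σ.P l E ∧ ∀ ψ ∈ l, ψ = φ := by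
  by_cases h0 : IsZero E
  · exact ⟨[], .nil h0, by simp⟩
  · exact ⟨[φ], .cons (.nil (isZero_zero D)) (isTri_zero_self E (isZero_zero D)) h h0 (by simp),
      by simp⟩

lemma exists_hasHN (E : D) : ∃ l, HasHN σ.P l E := by
  by_cases h0 : IsZero E
  · exact ⟨[], .nil h0⟩
  · obtain ⟨F⟩ := hσ.exists_hn E h0
    obtain ⟨l, hl, -⟩ := HasHN.of_hnFiltration F
    exact ⟨l, hl⟩

/-- An object whose only Harder-Narasimhan phase is `φ` lies in `P φ`. -/
lemma mem_of_hasHN {φ : ℝ} {l : List ℝ} {E : D} (h : HasHN σ.P l E) (hl : ∀ ψ ∈ l, ψ = φ) :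
    σ.P φ E := by
  cases h with
  | nil hE => exact hσ.of_isZero φ hE
  | @cons ψ l E' _ A h hT hA h0 hlt =>
    obtain rfl : ψ = φ := hl ψ List.mem_cons_self
    cases l with
    | nil =>
      obtain ⟨a, b, c, hT⟩ := hT
      have : IsIso b := (isZero_obj₁_iff_isIso hT).1 (h.of_isZero_tgt rfl)
      exact hσ.of_iso hA (asIso b).symm
    | cons χ l =>
      have h1 := hlt χ List.mem_cons_self
      rw [hl χ (List.mem_cons_of_mem _ List.mem_cons_self)] at h1
      exact (lt_irrefl _ h1).elim

lemma hasHN_shift {l : List ℝ} {E : D} (h : HasHN σ.P l E) (n : ℤ) :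
    HasHN σ.P (l.map (· + (n : ℝ))) (E⟦n⟧) := by
  induction h with
  | nil hE => exact .nil ((shiftFunctor D n).map_isZero hE)
  | cons h hT hA h0 hl ih =>
    exact .cons ih (hT.shift n) ((hσ.shift_iff_int _ _ _).2 hA) (fun h => h0 (isZero_of_shift n h))
      (by simpa using hl)

/-- Morphisms from objects of larger phases to objects of smaller phases vanish. -/
lemma hom_eq_zero_of_hasHN {l l' : List ℝ} {E F : D} (hE : HasHN σ.P l E) (hF : HasHN σ.P l' F)
    (h : ∀ φ ∈ l, ∀ ψ ∈ l', ψ < φ) (f : E ⟶ F) : f = 0 :=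
  hE.hom_eq_zero (fun φ hφ _ hA => hF.hom_eq_zero' fun ψ hψ _ hB =>
    hσ.hom_eq_zero φ ψ _ _ (h φ hφ ψ hψ) hA hB) f

/-- The Harder-Narasimhan factor of largest phase maps nontrivially to the object. -/
lemma exists_hom_of_max {l : List ℝ} {E : D} (h : HasHN σ.P l E) (hl : l ≠ []) :
    ∃ φ ∈ l, (∀ ψ ∈ l, ψ ≤ φ) ∧ ∃ (A : D) (f : A ⟶ E), σ.P φ A ∧ f ≠ 0 := by
  induction h with
  | nil hE => exact (hl rfl).elim
  | @cons φ l E' E A h hT hA h0 hlt ih =>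
    by_cases hl' : l = []
    · subst hl'
      obtain ⟨a, b, c, hT⟩ := hT
      have : IsIso b := (isZero_obj₁_iff_isIso hT).1 (h.of_isZero_tgt rfl)
      refine ⟨φ, by simp, by simp, A, inv b, hA, fun hb => h0 ?_⟩
      rw [IsZero.iff_id_eq_zero, ← IsIso.inv_hom_id b, hb, zero_comp]
    · obtain ⟨φ', hφ', hmax, A', f, hA', hf⟩ := ih hl'
      obtain ⟨a, b, c, hT⟩ := hT
      have hlt' := hlt φ' hφ'
      refine ⟨φ', List.mem_cons_of_mem _ hφ', ?_, A', f ≫ a, hA', fun h => hf ?_⟩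
      · intro ψ hψ
        rcases List.mem_cons.1 hψ with rfl | hψ
        · exact hlt'.le
        · exact hmax ψ hψ
      · -- a morphism killed by `a` factors through `A⟦-1⟧`, whose phase is smaller
        exact eq_zero_of_comp_mor₁ hT
          (hσ.hom_shift_eq_zero (by push_cast; linarith) hA' hA) f h

/-- The object maps nontrivially to its Harder-Narasimhan factor of smallest phase. -/
lemma exists_hom_of_min {φ : ℝ} {l : List ℝ} {E : D} (h : HasHN σ.P (φ :: l) E) :
    ∃ (A : D) (f : E ⟶ A), σ.P φ A ∧ f ≠ 0 := by
  cases h with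
  | @cons _ _ E' _ A h hT hA h0 hlt =>
    obtain ⟨a, b, c, hT⟩ := hT
    refine ⟨A, b, hA, fun hb => h0 ?_⟩
    obtain ⟨t, ht⟩ := exists_desc₃ hT (𝟙 A) (by rw [hb, zero_comp])
    have h1 := hσ.hasHN_shift h 1
    obtain ⟨m, hm, hm'⟩ := hσ.hasHN_of_mem hA
    have : t = 0 := hσ.hom_eq_zero_of_hasHN h1 hm (by
      intro ψ hψ χ hχ
      obtain ⟨ψ', hψ', rfl⟩ := List.mem_map.1 hψ
      rw [hm' χ hχ]
      have := hlt ψ' hψ'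
      push_cast
      linarith) t
    rw [IsZero.iff_id_eq_zero]
    rw [ht, this, comp_zero]

/-- If `E` receives no nonzero morphisms from objects of phase greater than `b` and has no nonzero
morphisms to objects of phase smaller than `a`, its phases lie in `[a, b]`. -/
lemma phases_mem_Icc {l : List ℝ} {E : D} (h : HasHN σ.P l E) {a b : ℝ}
    (ha : ∀ ψ < a, ∀ A, σ.P ψ A → ∀ f : E ⟶ A, f = 0)
    (hb : ∀ ψ > b, ∀ A, σ.P ψ A → ∀ f : A ⟶ E, f = 0) : ∀ ψ ∈ l, a ≤ ψ ∧ ψ ≤ b := by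
  cases hl : l with
  | nil => simp
  | cons φ l' =>
    subst hl
    obtain ⟨χ, hχ, hmax, A, f, hA, hf⟩ := hσ.exists_hom_of_max h (by simp)
    obtain ⟨B, g, hB, hg⟩ := hσ.exists_hom_of_min h
    have h1 : χ ≤ b := not_lt.1 fun hlt => hf (hb χ hlt A hA f)
    have h2 : a ≤ φ := not_lt.1 fun hlt => hg (ha φ hlt B hB g)
    have h3 : ∀ ψ ∈ φ :: l', φ ≤ ψ := by
      cases h with
      | cons _ _ _ _ hlt =>
        intro ψ hψ
        rcases List.mem_cons.1 hψ with rfl | hψ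
        · exact le_rfl
        · exact (hlt ψ hψ).le
    exact fun ψ hψ => ⟨h2.trans (h3 ψ hψ), (hmax ψ hψ).trans h1⟩

/-- Semistability of phase `φ` is detected by the vanishing of morphisms. -/
lemma mem_of_hom_eq_zero {φ : ℝ} {E : D}
    (ha : ∀ ψ < φ, ∀ A, σ.P ψ A → ∀ f : E ⟶ A, f = 0)
    (hb : ∀ ψ > φ, ∀ A, σ.P ψ A → ∀ f : A ⟶ E, f = 0) : σ.P φ E := by
  obtain ⟨l, hl⟩ := hσ.exists_hasHN E
  exact hσ.mem_of_hasHN hl fun ψ hψ =>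
    le_antisymm (hσ.phases_mem_Icc hl ha hb ψ hψ).2 (hσ.phases_mem_Icc hl ha hb ψ hψ).1

/-- Direct summands of semistable objects are semistable of the same phase. -/
lemma mem_of_retract {φ : ℝ} {E F : D} (h : σ.P φ F) (r : Retract E F) : σ.P φ E := by
  refine hσ.mem_of_hom_eq_zero (fun ψ hψ A hA f => ?_) (fun ψ hψ A hA f => ?_)
  · rw [← Category.id_comp f, ← r.retract, Category.assoc,
      hσ.hom_eq_zero _ _ _ _ hψ h hA (r.r ≫ f), comp_zero]
  · rw [← Category.comp_id f, ← r.retract, ← Category.assoc,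
      hσ.hom_eq_zero _ _ _ _ hψ hA h (f ≫ r.i), zero_comp]

end IsStabilityCondition

end StabilityData

section CentralCharge

open Pretriangulated

variable {D : Type*} [Category* D] [Preadditive D] [HasZeroObject D] [HasShift D ℤ]
  [∀ n : ℤ, (shiftFunctor D n).Additive] [Pretriangulated D]

lemma K0.mk_eq_add {X Y Z : D} (h : IsTri X Y Z) : K0.mk Y = K0.mk X + K0.mk Z := by
  obtain ⟨a, b, c, hT⟩ := h
  have h1 : FreeAbelianGroup.of Y - FreeAbelianGroup.of X - FreeAbelianGroup.of Z ∈
      K0Relations D := AddSubgroup.subset_closure ⟨_, hT, rfl⟩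
  have h2 := (QuotientAddGroup.eq_zero_iff _).2 h1
  have h3 : K0.mk Y - K0.mk X - K0.mk Z = 0 := h2
  rw [← sub_eq_zero, ← h3]
  abel

lemma K0.mk_eq_zero {X : D} (h : IsZero X) : K0.mk X = 0 := by
  have := K0.mk_eq_add (isTri_self_zero X h)
  simpa using this

namespace StabilityData

variable {σ : StabilityData D}

/-- The component of `Z(E)` orthogonal to the ray of phase `φ`. -/
def orthZ (σ : StabilityData D) (φ : ℝ) (E : D) : ℝ :=
  (σ.Z (K0.mk E) * Complex.exp (-(Complex.I * Real.pi * φ))).im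

lemma orthZ_eq_add (φ : ℝ) {X Y Z : D} (h : IsTri X Y Z) :
    σ.orthZ φ Y = σ.orthZ φ X + σ.orthZ φ Z := by
  simp [orthZ, K0.mk_eq_add h, add_mul]

namespace IsStabilityCondition

variable (hσ : σ.IsStabilityCondition)
include hσ

/-- The component of the central charge orthogonal to the ray of phase `φ` is a positive multiple of
`sin (π (ψ - φ))` for nonzero objects of `P ψ`. -/
lemma exists_orthZ_eq {φ : ℝ} (ψ : ℝ) {E : D} (h : σ.P ψ E) (h0 : ¬ IsZero E) :
    ∃ m : ℝ, 0 < m ∧ σ.orthZ φ E = m * Real.sin (Real.pi * (ψ - φ)) := by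
  obtain ⟨m, hm, h⟩ := hσ.exists_Z_eq ψ E h h0
  refine ⟨m, hm, ?_⟩
  have : Complex.I * Real.pi * ψ + -(Complex.I * Real.pi * φ) =
      ((Real.pi * (ψ - φ) : ℝ) : ℂ) * Complex.I := by
    push_cast
    ring
  rw [orthZ, h, mul_assoc, ← Complex.exp_add, this, Complex.im_ofReal_mul,
    Complex.exp_ofReal_mul_I_im]

lemma orthZ_self {φ : ℝ} {E : D} (h : σ.P φ E) : σ.orthZ φ E = 0 := by
  by_cases h0 : IsZero E
  · simp [orthZ, K0.mk_eq_zero h0]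
  · obtain ⟨m, -, h⟩ := hσ.exists_orthZ_eq (φ := φ) φ h h0
    simp [h]

/-- If the phases of `E` lie in `[φ, φ + 1]` and `Z(E)` lies on the line through the ray of phase
`φ`, the phases of `E` are `φ` or `φ + 1`, as all the other factors contribute to the same side of
that line. -/
lemma phases_eq_of_orthZ {φ : ℝ} {l : List ℝ} {E : D} (h : HasHN σ.P l E)
    (hl : ∀ ψ ∈ l, φ ≤ ψ ∧ ψ ≤ φ + 1) :
    0 ≤ σ.orthZ φ E ∧ (σ.orthZ φ E = 0 → ∀ ψ ∈ l, ψ = φ ∨ ψ = φ + 1) := by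
  induction h with
  | nil hE => simp [orthZ, K0.mk_eq_zero hE]
  | @cons ψ l E' E A h hT hA h0 _ ih =>
    obtain ⟨ih1, ih2⟩ := ih fun χ hχ => hl χ (List.mem_cons_of_mem _ hχ)
    obtain ⟨h1, h2⟩ := hl ψ List.mem_cons_self
    obtain ⟨m, hm, hA'⟩ := hσ.exists_orthZ_eq (φ := φ) ψ hA h0
    have hpi := Real.pi_pos
    have hsin : 0 ≤ Real.sin (Real.pi * (ψ - φ)) :=
      Real.sin_nonneg_of_nonneg_of_le_pi (by nlinarith) (by nlinarith)
    have hA0 : 0 ≤ σ.orthZ φ A := by rw [hA']; positivity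
    rw [orthZ_eq_add φ hT]
    refine ⟨by positivity, fun hE => ?_⟩
    have e1 : σ.orthZ φ E' = 0 := by linarith
    have e2 : σ.orthZ φ A = 0 := by linarith
    intro χ hχ
    rcases List.mem_cons.1 hχ with rfl | hχ
    · by_contra! hne
      have : 0 < Real.sin (Real.pi * (χ - φ)) := by
        refine Real.sin_pos_of_pos_of_lt_pi ?_ ?_
        · have := lt_of_le_of_ne h1 (Ne.symm hne.1)
          exact mul_pos hpi (by linarith)
        · have := lt_of_le_of_ne h2 hne.2
          nlinarith
      rw [hA'] at e2
      exact (mul_pos hm this).ne' e2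
    · exact ih2 e1 χ hχ

open ZeroObject in
/-- The cone of a morphism of `P φ` is an extension of an object of `P φ` by an object of
`P (φ + 1)`. -/
lemma exists_isTri_of_cone {φ : ℝ} {A B C : D} (hA : σ.P φ A) (hB : σ.P φ B)
    (h : IsTri A B C) : ∃ K Q : D, σ.P φ K ∧ σ.P φ Q ∧ IsTri (K⟦(1 : ℤ)⟧) C Q := by
  obtain ⟨l, hl⟩ := hσ.exists_hasHN C
  have hA1 : σ.P (φ + 1) (A⟦(1 : ℤ)⟧) := (hσ.shift_iff _ _).2 hA
  have hC : IsTri B C (A⟦(1 : ℤ)⟧) := by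
    obtain ⟨a, b, c, hT⟩ := h
    exact ⟨_, _, _, rot_of_distTriang _ hT⟩
  have hph := hσ.phases_mem_Icc hl (a := φ) (b := φ + 1)
    (fun ψ hψ E hE => hC.hom_eq_zero (hσ.hom_eq_zero _ _ _ _ hψ hB hE)
      (hσ.hom_eq_zero _ _ _ _ (by linarith) hA1 hE))
    (fun ψ hψ E hE => hC.hom_eq_zero' (hσ.hom_eq_zero _ _ _ _ (by linarith) hE hB)
      (hσ.hom_eq_zero _ _ _ _ (by linarith) hE hA1))
  have hZ : σ.orthZ φ C = 0 := by
    have := σ.orthZ_eq_add φ h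
    rw [hσ.orthZ_self hA, hσ.orthZ_self hB] at this
    linarith
  have hph' := (hσ.phases_eq_of_orthZ hl hph).2 hZ
  suffices h : ∃ X Q : D, σ.P (φ + 1) X ∧ σ.P φ Q ∧ IsTri X C Q by
    obtain ⟨X, Q, hX, hQ, h⟩ := h
    let e : X ≅ (X⟦(-1 : ℤ)⟧)⟦(1 : ℤ)⟧ := ((shiftEquiv D (1 : ℤ)).counitIso.app X).symm
    exact ⟨X⟦(-1 : ℤ)⟧, Q, (hσ.shift_iff _ _).1 (hσ.of_iso hX e), hQ,
      h.of_iso e (Iso.refl _) (Iso.refl _)⟩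
  cases hl with
  | nil hE => exact ⟨C, (0 : D), hσ.of_isZero _ hE, hσ.of_isZero _ (isZero_zero D),
      isTri_self_zero C (isZero_zero D)⟩
  | @cons ψ l E' _ F h hT hF h0 hlt =>
    rcases hph' ψ List.mem_cons_self with rfl | rfl
    · refine ⟨E', F, hσ.mem_of_hasHN h fun χ hχ => ?_, hF, hT⟩
      rcases hph' χ (List.mem_cons_of_mem _ hχ) with rfl | h
      · exact (lt_irrefl _ (hlt _ hχ)).elim
      · exact h
    · refine ⟨C, (0 : D), hσ.mem_of_hasHN (.cons h hT hF h0 hlt) fun χ hχ => ?_,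
        hσ.of_isZero _ (isZero_zero D), isTri_self_zero C (isZero_zero D)⟩
      rcases List.mem_cons.1 hχ with rfl | hχ
      · rfl
      · have h1 := hlt χ hχ
        rcases hph' χ (List.mem_cons_of_mem _ hχ) with h | h <;> linarith

lemma ι_hom_shift_eq_zero (φ : ℝ) ⦃X Y : (σ.P φ).FullSubcategory⦄ ⦃n : ℤ⦄
    (f : (σ.P φ).ι.obj X ⟶ ((σ.P φ).ι.obj Y)⟦n⟧) (hn : n < 0) : f = 0 :=
  hσ.hom_shift_eq_zero (by have : (n : ℝ) < 0 := by exact_mod_cast hn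
                           linarith) X.property Y.property f

/-- Every morphism of `P φ` has a cone of the shape `K⟦1⟧ ⟶ C ⟶ Q` with `K` and `Q` in `P φ`; these
are its kernel and its cokernel. -/
lemma admissibleMorphism_eq_top (φ : ℝ) :
    Triangulated.AbelianSubcategory.admissibleMorphism (σ.P φ).ι = ⊤ := by
  refine MorphismProperty.ext _ _ fun X₁ X₂ f => ?_
  simp only [MorphismProperty.top_apply, iff_true]
  intro X₃ f₂ f₃ hT
  obtain ⟨K, Q, hK, hQ, α, β, γ, hT'⟩ :=
    hσ.exists_isTri_of_cone X₁.property X₂.property ⟨_, _, _, hT⟩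
  exact ⟨⟨K, hK⟩, ⟨Q, hQ⟩, α, β, γ, hT'⟩

lemma hasFiniteProducts (φ : ℝ) : HasFiniteProducts (σ.P φ).FullSubcategory :=
  have := hσ.closedUnderFiniteProducts φ
  inferInstance

/-- The category of semistable objects of a given phase is abelian. -/
@[reducible]
def abelian [IsTriangulated D] (φ : ℝ) : Abelian (σ.P φ).FullSubcategory :=
  have := hσ.hasFiniteProducts φ
  Triangulated.AbelianSubcategory.abelian (σ.P φ).ι (hσ.ι_hom_shift_eq_zero φ)
    (hσ.admissibleMorphism_eq_top φ)

end IsStabilityCondition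
end StabilityData
end CentralCharge

/-! ### Finite length -/

section Subobjects

variable {C : Type*} [Category* C]

lemma nonempty_normalMono [HasZeroMorphisms C] {X Y Z : C} (f : X ⟶ Y) [Mono f] (g : Y ⟶ Z)
    (w : f ≫ g = 0) (h : ∀ (W : C) (t : W ⟶ Y), t ≫ g = 0 → ∃ l : W ⟶ X, l ≫ f = t) :
    Nonempty (NormalMono f) :=
  ⟨{ Z := Z, g := g, w := w
     isLimit := KernelFork.IsLimit.ofι' f w fun t ht =>
      ⟨(h _ t ht).choose, (h _ t ht).choose_spec⟩ }⟩

lemma exists_of_normalMono [HasZeroMorphisms C] {X Y : C} {f : X ⟶ Y}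
    (hf : Nonempty (NormalMono f)) : ∃ (Z : C) (g : Y ⟶ Z), f ≫ g = 0 ∧
      ∀ (W : C) (t : W ⟶ Y), t ≫ g = 0 → ∃ l : W ⟶ X, l ≫ f = t := by
  obtain ⟨n⟩ := hf
  exact ⟨n.Z, n.g, n.w, fun W t ht => ⟨_, (KernelFork.IsLimit.lift' n.isLimit t ht).2⟩⟩

lemma nonempty_normalMono_mk_arrow [HasZeroMorphisms C] {X Y : C} {f : X ⟶ Y} [Mono f]
    (hf : Nonempty (NormalMono f)) : Nonempty (NormalMono (Subobject.mk f).arrow) := by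
  obtain ⟨Z, g, w, h⟩ := exists_of_normalMono hf
  refine nonempty_normalMono _ g ?_ fun W t ht => ?_
  · rw [← Subobject.underlyingIso_hom_comp_eq_mk, Category.assoc, w, comp_zero]
  · obtain ⟨l, rfl⟩ := h W t ht
    exact ⟨l ≫ (Subobject.underlyingIso f).inv, by simp⟩

/-- A functor which maps a class of subobjects of `X` to strict subobjects of `F X` and reflects
their inclusions transfers the chain conditions from `F X` to `X`. -/
lemma wellFounded_subobject_of_functor {A B : Type*} [Category* A] [Category* B]
    [HasZeroMorphisms B] (F : A ⥤ B) (X : A) (p : Subobject X → Prop)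
    (hn : ∀ S, p S → Nonempty (NormalMono (F.map S.arrow)))
    (hle : ∀ S T, p S → p T → ∀ k : F.obj (S : A) ⟶ F.obj (T : A),
      k ≫ F.map T.arrow = F.map S.arrow → S ≤ T)
    (h : WellFoundedLT {S : Subobject (F.obj X) // Nonempty (NormalMono S.arrow)} ∧
      WellFoundedGT {S : Subobject (F.obj X) // Nonempty (NormalMono S.arrow)}) :
    WellFoundedLT {S // p S} ∧ WellFoundedGT {S // p S} := by
  have hm (S : {S // p S}) : Mono (F.map S.1.arrow) :=
    mono_of_isLimit_fork (hn S.1 S.2).some.isLimit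
  let Φ (S : {S // p S}) : {S : Subobject (F.obj X) // Nonempty (NormalMono S.arrow)} :=
    have := hm S
    ⟨Subobject.mk (F.map S.1.arrow), nonempty_normalMono_mk_arrow (hn S.1 S.2)⟩
  have hΦ (S T : {S // p S}) : Φ S ≤ Φ T ↔ S ≤ T := by
    have := hm S
    have := hm T
    constructor
    · intro h
      exact hle _ _ S.2 T.2 (Subobject.ofMkLEMk _ _ h) (Subobject.ofMkLEMk_comp h)
    · intro h
      exact Subobject.mk_le_mk_of_comm (F.map (Subobject.ofLE _ _ h))
        (by rw [← F.map_comp, Subobject.ofLE_arrow])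
  have hΦ' : StrictMono Φ := fun S T h =>
    lt_of_le_not_ge ((hΦ _ _).2 h.le) fun h' => h.not_ge ((hΦ _ _).1 h')
  have := h.1
  have := h.2
  exact ⟨hΦ'.wellFoundedLT, hΦ'.wellFoundedGT⟩

end Subobjects

namespace StabilityData

open Pretriangulated

variable {D : Type*} [Category* D] [Preadditive D] [HasZeroObject D] [HasShift D ℤ]
  [∀ n : ℤ, (shiftFunctor D n).Additive] [Pretriangulated D] {σ : StabilityData D}

lemma pInterval_of_mem {hσ : σ.IsStabilityCondition} {φ : ℝ} {I : Set ℝ} (h : φ ∈ I) {E : D}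
    (hE : σ.P φ E) : σ.PInterval I E := by
  obtain ⟨l, hl, hl'⟩ := hσ.hasHN_of_mem hE
  exact pInterval_iff.2 ⟨l, hl, fun ψ hψ => by rwa [hl' ψ hψ]⟩

namespace IsStabilityCondition

variable (hσ : σ.IsStabilityCondition)
include hσ

/-- A monomorphism of `P φ` is the first morphism of a distinguished triangle in `P φ`. -/
lemma exists_distTriang_of_mono [IsTriangulated D] {φ : ℝ} {A E : (σ.P φ).FullSubcategory}
    (m : A ⟶ E) [Mono m] : ∃ (B : (σ.P φ).FullSubcategory) (p : E ⟶ B)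
      (δ : B.obj ⟶ A.obj⟦(1 : ℤ)⟧), Triangle.mk m.hom p.hom δ ∈ distTriang D := by
  let := hσ.abelian φ
  obtain ⟨X, i, δ, hT⟩ := Triangulated.AbelianSubcategory.exists_distinguished_triangle_of_epi
    (hσ.ι_hom_shift_eq_zero φ) (hσ.admissibleMorphism_eq_top φ) (cokernel.π m)
  have hX := Triangulated.AbelianSubcategory.isLimitKernelForkOfDistTriang
    (hσ.ι_hom_shift_eq_zero φ) _ _ _ hT
  have hm : IsLimit (KernelFork.ofι m (cokernel.condition m)) :=
    Abelian.monoIsKernelOfCokernel _ (colimit.isColimit (parallelPair m 0))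
  let e : X ≅ A := hX.conePointUniqueUpToIso hm
  have he : e.hom ≫ m = i := hX.conePointUniqueUpToIso_hom_comp hm WalkingParallelPair.zero
  let e' : X.obj ≅ A.obj := (σ.P φ).ι.mapIso e
  have he' : m.hom = e'.inv ≫ i.hom := by
    rw [Iso.eq_inv_comp]
    exact congr_arg (fun t => t.hom) he
  refine ⟨_, cokernel.π m, δ ≫ e'.hom⟦1⟧', isomorphic_distinguished _ hT _
    (Triangle.isoMk _ _ e'.symm (Iso.refl _) (Iso.refl _)
      ((Category.comp_id _).trans he') ((Category.comp_id _).trans (Category.id_comp _).symm) ?_)⟩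
  have h1 : (δ ≫ e'.hom⟦1⟧') ≫ e'.inv⟦1⟧' = δ := by
    rw [Category.assoc, ← Functor.map_comp, Iso.hom_inv_id, CategoryTheory.Functor.map_id,
      Category.comp_id]
  exact h1.trans (Category.id_comp _).symm

/-- Every nonzero object of `P φ` has a simple subobject: subobjects in `P φ` are strict subobjects
in `P ((φ - η, φ + η))`. -/
lemma exists_simple_subobject [IsTriangulated D] {φ : ℝ} (E : (σ.P φ).FullSubcategory)
    (hE : ¬ IsZero E.obj) : ∃ (S : (σ.P φ).FullSubcategory) (i : S ⟶ E), Simple S ∧ i ≠ 0 := by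
  let := hσ.abelian φ
  obtain ⟨η, hη, hη', hfin⟩ := hσ.locallyFinite
  let Q := σ.PInterval (Set.Ioo (φ - η) (φ + η))
  have hQ : σ.P φ ≤ Q := fun A hA =>
    pInterval_of_mem (hσ := hσ) (by constructor <;> linarith) hA
  let j := ObjectProperty.ιOfLE hQ
  have hn (S : Subobject E) : Nonempty (NormalMono (j.map S.arrow)) := by
    obtain ⟨B, p, δ, hT⟩ := hσ.exists_distTriang_of_mono S.arrow
    have : Mono (j.map S.arrow) := Preadditive.mono_of_cancel_zero _ fun {W} t ht => by
      apply ObjectProperty.hom_ext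
      refine eq_zero_of_comp_mor₁ hT (fun g => ?_) t.hom congr(($ht).hom)
      obtain ⟨l, hl, hl'⟩ := pInterval_iff.1 W.property
      obtain ⟨l₂, hl₂, hl₂'⟩ := hσ.hasHN_of_mem B.property
      refine hσ.hom_eq_zero_of_hasHN hl (hσ.hasHN_shift hl₂ (-1)) (fun χ hχ ψ hψ => ?_) g
      obtain ⟨ψ', hψ', rfl⟩ := List.mem_map.1 hψ
      have := (hl' χ hχ).1
      rw [hl₂' ψ' hψ']
      push_cast
      linarith
    refine nonempty_normalMono _ (j.map p) ?_ fun W t ht => ?_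
    · exact ObjectProperty.hom_ext _ (mor₁_comp_mor₂ hT)
    · obtain ⟨g, hg⟩ := exists_lift₂ hT t.hom congr(($ht).hom)
      exact ⟨ObjectProperty.homMk g, ObjectProperty.hom_ext _ hg.symm⟩
  have hwf := wellFounded_subobject_of_functor j E (fun _ => True) (fun S _ => hn S)
    (fun S T _ _ k hk => Subobject.le_of_comm (j.preimage k)
      (j.map_injective (by rw [j.map_comp, j.map_preimage, hk]))) (hfin φ _)
  have : IsArtinianObject E := by
    have := hwf.1
    have hmono : StrictMono (fun S : Subobject E => (⟨S, trivial⟩ : {S : Subobject E // True})) :=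
      fun _ _ h => h
    exact ⟨hmono.wellFoundedLT⟩
  have hE' : ¬ IsZero E := fun h => hE ((σ.P φ).ι.map_isZero h)
  refine ⟨simpleSubobject hE', simpleSubobjectArrow hE', inferInstance, fun h => ?_⟩
  have : 𝟙 (simpleSubobject hE') = 0 := by
    rw [← cancel_mono (simpleSubobjectArrow hE'), h, comp_zero, comp_zero]
  exact id_nonzero _ this

end IsStabilityCondition
end StabilityData

/-! ### Descent of stability conditions along an ambidextrous adjunction -/

lemma adj_eq_zero {C C' : Type*} [Category* C] [Category* C'] [HasZeroMorphisms C]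
    [HasZeroMorphisms C'] {L : C ⥤ C'} {R : C' ⥤ C} (adj : L ⊣ R) {X : C} {Y : C'}
    (h : ∀ g : L.obj X ⟶ Y, g = 0) (f : X ⟶ R.obj Y) : f = 0 :=
  (adj.homEquiv X Y).symm.injective ((h _).trans (h _).symm)

/-- A functor `I` which is left and right adjoint to `R`, such that the composites
`𝟭 ⟶ R ⋙ I ⟶ 𝟭` and `𝟭 ⟶ I ⋙ R ⟶ 𝟭` of units and counits are isomorphisms. The example to
have in mind is the restriction `R` and the induction `I` of representations of a finite group
whose order is invertible: there the first composite is the multiplication by the order. -/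
structure AmbiAdjunction {C C' : Type*} [Category* C] [Category* C'] (I : C ⥤ C') (R : C' ⥤ C) where
  adj₁ : I ⊣ R
  adj₂ : R ⊣ I
  isIso_trace (E : C') : IsIso (adj₂.unit.app E ≫ adj₁.counit.app E)
  isIso_trace' (M : C) : IsIso (adj₁.unit.app M ≫ adj₂.counit.app M)

namespace AmbiAdjunction

section

variable {C C' : Type*} [Category* C] [Category* C'] {I : C ⥤ C'} {R : C' ⥤ C}
  (T : AmbiAdjunction I R)

/-- The composite `E ⟶ I R E ⟶ E` of the unit and the counit. -/
def trace (E : C') : E ⟶ E := T.adj₂.unit.app E ≫ T.adj₁.counit.app E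

instance (E : C') : IsIso (T.trace E) := T.isIso_trace E

/-- The average of a morphism `R E ⟶ R F` over the group, as a morphism `E ⟶ F`. -/
def avg {E F : C'} (r : R.obj E ⟶ R.obj F) : E ⟶ F :=
  T.adj₂.unit.app E ≫ I.map r ≫ T.adj₁.counit.app F

lemma map_avg {E F G : C'} (a : E ⟶ F) (r : R.obj F ⟶ R.obj G) :
    T.avg (R.map a ≫ r) = a ≫ T.avg r := by
  have h : a ≫ T.adj₂.unit.app F = T.adj₂.unit.app E ≫ I.map (R.map a) :=
    T.adj₂.unit.naturality a
  rw [avg, avg, reassoc_of% h, I.map_comp, Category.assoc]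

lemma avg_map {E F G : C'} (r : R.obj E ⟶ R.obj F) (b : F ⟶ G) :
    T.avg (r ≫ R.map b) = T.avg r ≫ b := by
  have h : I.map (R.map b) ≫ T.adj₁.counit.app G = T.adj₁.counit.app F ≫ b :=
    T.adj₁.counit.naturality b
  rw [avg, avg, I.map_comp, Category.assoc, Category.assoc, Category.assoc, h]

lemma avg_id (E : C') : T.avg (𝟙 (R.obj E)) = T.trace E := by
  rw [avg, I.map_id]
  exact congr_arg (T.adj₂.unit.app E ≫ ·) (Category.id_comp _)

lemma trace_comp {E F : C'} (a : E ⟶ F) : T.trace E ≫ a = a ≫ T.trace F := by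
  rw [← avg_id, ← avg_id, ← avg_map, ← map_avg, Category.id_comp, Category.comp_id]

include T in
lemma faithful : R.Faithful where
  map_injective {E F} f g h := by
    rw [← cancel_epi (T.trace E), ← avg_id, ← avg_map, ← avg_map, h]

include T in
lemma isZero_of_isZero_map [HasZeroMorphisms C] [HasZeroMorphisms C'] [R.PreservesZeroMorphisms]
    {E : C'} (h : IsZero (R.obj E)) : IsZero E := by
  have := T.faithful
  rw [IsZero.iff_id_eq_zero] at h ⊢
  exact R.map_injective (by rw [R.map_id, h, R.map_zero])

include T in
lemma isZero_of_isZero_map' [HasZeroMorphisms C] [HasZeroMorphisms C'] [R.PreservesZeroMorphisms]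
    {M : C} (h : IsZero (I.obj M)) : IsZero M := by
  have := T.isIso_trace' M
  have h0 : T.adj₁.unit.app M = 0 := (R.map_isZero h).eq_of_tgt _ _
  rw [IsZero.iff_id_eq_zero]
  refine (IsIso.hom_inv_id (T.adj₁.unit.app M ≫ T.adj₂.counit.app M)).symm.trans ?_
  simp only [h0, zero_comp]

end

open Pretriangulated

variable {D : Type*} [Category* D] [Preadditive D] [HasZeroObject D] [HasShift D ℤ]
  [∀ n : ℤ, (shiftFunctor D n).Additive] [Pretriangulated D]
  {D' : Type*} [Category* D'] [Preadditive D'] [HasZeroObject D'] [HasShift D' ℤ]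
  [∀ n : ℤ, (shiftFunctor D' n).Additive] [Pretriangulated D']

/-- Two distinguished triangles with the same middle object, such that there are no nonzero
morphisms between their outer objects in the relevant degrees, are isomorphic. -/
lemma _root_.GStab.exists_iso_of_hom_eq_zero {X Y Z X' Z' : D} (h : IsTri X Y Z)
    (h' : IsTri X' Y Z') (h₁ : ∀ f : X ⟶ Z', f = 0) (h₂ : ∀ f : X' ⟶ Z, f = 0)
    (h₃ : ∀ f : X⟦(1 : ℤ)⟧ ⟶ Z, f = 0) (h₄ : ∀ f : X'⟦(1 : ℤ)⟧ ⟶ Z', f = 0) :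
    Nonempty (X ≅ X') ∧ Nonempty (Z ≅ Z') := by
  obtain ⟨a, b, c, hT⟩ := h
  obtain ⟨a', b', c', hT'⟩ := h'
  have key {X Z : D} (h₃ : ∀ f : X⟦(1 : ℤ)⟧ ⟶ Z, f = 0) (f : X ⟶ Z⟦(-1 : ℤ)⟧) : f = 0 := by
    apply (shiftFunctor D (1 : ℤ)).map_injective
    let e : (Z⟦(-1 : ℤ)⟧)⟦(1 : ℤ)⟧ ≅ Z := (shiftEquiv D (1 : ℤ)).counitIso.app Z
    rw [← cancel_mono e.hom, h₃ (f⟦(1 : ℤ)⟧' ≫ e.hom), CategoryTheory.Functor.map_zero, zero_comp]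
  obtain ⟨α, hα⟩ := exists_lift₂ hT' a (h₁ _)
  obtain ⟨β, hβ⟩ := exists_lift₂ hT a' (h₂ _)
  have e1 : α ≫ β - 𝟙 X = 0 := eq_zero_of_comp_mor₁ hT (key h₃) _ (by
    rw [Preadditive.sub_comp, Category.assoc, ← hβ, ← hα, Category.id_comp, sub_self])
  have e2 : β ≫ α - 𝟙 X' = 0 := eq_zero_of_comp_mor₁ hT' (key h₄) _ (by
    rw [Preadditive.sub_comp, Category.assoc, ← hα, ← hβ, Category.id_comp, sub_self])
  let i : X ≅ X' := ⟨α, β, sub_eq_zero.1 e1, sub_eq_zero.1 e2⟩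
  refine ⟨⟨i⟩, ⟨Triangle.π₃.mapIso (isoTriangleOfIso₁₂ _ _ hT hT' i (Iso.refl _) ?_)⟩⟩
  exact (Category.comp_id _).trans hα

variable {I : D ⥤ D'} {R : D' ⥤ D} (T : AmbiAdjunction I R) [R.CommShift ℤ] [R.IsTriangulated]
  [I.CommShift ℤ] [I.IsTriangulated]
include T

/-- A distinguished triangle `B ⟶ R E ⟶ A` lifts to a distinguished triangle on `E` if there are no
nonzero morphisms to `A` from the members of a class of objects which contains `B` and is stable
under positive shifts and under `R I`. As `E` is a direct summand of `I R E`, the lift is cut out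
of the triangle `I B ⟶ I R E ⟶ I A` by an idempotent. -/
lemma exists_isTri_lift [IsIdempotentComplete D'] {E : D'} {A B : D} (h : IsTri B (R.obj E) A)
    (Q : D → Prop) (hQ₁ : ∀ X, Q X → Q (X⟦(1 : ℤ)⟧)) (hQ₂ : ∀ X, Q X → Q (R.obj (I.obj X)))
    (hB : Q B) (hA : ∀ X, Q X → ∀ f : X ⟶ A, f = 0) :
    ∃ E' F : D', IsTri E' E F ∧ Nonempty (B ≅ R.obj E') ∧ Nonempty (A ≅ R.obj F) := by
  have hIA (X : D) (hX : Q X) : ∀ f : I.obj X ⟶ I.obj A, f = 0 :=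
    adj_eq_zero T.adj₂ (hA _ (hQ₂ X hX))
  obtain ⟨a, b, c, hT⟩ := id h
  obtain ⟨c', hT'⟩ : ∃ c', Triangle.mk (I.map a) (I.map b) c' ∈ distTriang D' :=
    ⟨_, I.map_distinguished _ hT⟩
  let u : E ⟶ I.obj (R.obj E) := T.adj₂.unit.app E
  let v : I.obj (R.obj E) ⟶ E := T.adj₁.counit.app E ≫ inv (T.trace E)
  have huv : u ≫ v = 𝟙 E := by
    have : u ≫ v = T.trace E ≫ inv (T.trace E) := (Category.assoc _ _ _).symm
    rw [this, IsIso.hom_inv_id]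
  -- the idempotent `v ≫ u` of `I R E` induces an idempotent `p` of `I B`
  obtain ⟨p, hp⟩ := exists_lift₂ hT' (I.map a ≫ v ≫ u) (hIA B hB _)
  have hpp : p ≫ p = p := by
    have hB1 : ∀ f : I.obj B ⟶ (I.obj A)⟦(-1 : ℤ)⟧, f = 0 := fun f => by
      apply (shiftFunctor D' (1 : ℤ)).map_injective
      let e : ((I.obj A)⟦(-1 : ℤ)⟧)⟦(1 : ℤ)⟧ ≅ I.obj A :=
        (shiftEquiv D' (1 : ℤ)).counitIso.app (I.obj A)
      let e' : I.obj (B⟦(1 : ℤ)⟧) ≅ (I.obj B)⟦(1 : ℤ)⟧ := (I.commShiftIso (1 : ℤ)).app B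
      rw [← cancel_mono e.hom, ← cancel_epi e'.hom, hIA _ (hQ₁ B hB) (e'.hom ≫ f⟦(1 : ℤ)⟧' ≫ e.hom),
        CategoryTheory.Functor.map_zero, zero_comp, comp_zero]
    rw [← sub_eq_zero]
    refine eq_zero_of_comp_mor₁ hT' hB1 _ ?_
    rw [Preadditive.sub_comp, Category.assoc, ← hp, ← reassoc_of% hp, reassoc_of% huv, sub_self]
  obtain ⟨E', s, r, hsr, hrs⟩ := IsIdempotentComplete.idempotents_split _ p hpp
  let e : E' ⟶ E := s ≫ I.map a ≫ v
  have hs : s ≫ I.map a = e ≫ u := by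
    have : s ≫ p = s := by rw [← hrs, reassoc_of% hsr]
    rw [Category.assoc, Category.assoc, hp, reassoc_of% this]
  have hr : r ≫ e = I.map a ≫ v := by
    have : r ≫ e = (r ≫ s) ≫ I.map a ≫ v := (Category.assoc _ _ _).symm
    rw [this, hrs, ← reassoc_of% hp, huv, Category.comp_id]
  obtain ⟨F, q, δ, hF⟩ := distinguished_cocone_triangle e
  have hF0 (X : D') (hX : ∀ f : X ⟶ I.obj A, f = 0) (f : X ⟶ F) : f = 0 := by
    have h1 : f ≫ δ = 0 := by
      have hδ : δ ≫ e⟦(1 : ℤ)⟧' = 0 := comp_distTriang_mor_zero₃₁ _ hF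
      have h2 : (f ≫ δ ≫ s⟦(1 : ℤ)⟧') ≫ (I.map a)⟦(1 : ℤ)⟧' = 0 := by
        rw [Category.assoc, Category.assoc, ← Functor.map_comp, hs, Functor.map_comp,
          reassoc_of% hδ, zero_comp, comp_zero]
      obtain ⟨g, hg⟩ : ∃ g : X ⟶ I.obj A, f ≫ δ ≫ s⟦(1 : ℤ)⟧' = g ≫ c' :=
        Triangle.coyoneda_exact₁ _ hT' _ h2
      rw [hX g, zero_comp] at hg
      have h3 : s⟦(1 : ℤ)⟧' ≫ r⟦(1 : ℤ)⟧' = 𝟙 (E'⟦(1 : ℤ)⟧) := by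
        rw [← Functor.map_comp, hsr, CategoryTheory.Functor.map_id]
      rw [← Category.comp_id (f ≫ δ), ← h3, Category.assoc, reassoc_of% hg, zero_comp]
    obtain ⟨g, rfl⟩ := exists_lift₃ hF f h1
    obtain ⟨t, ht⟩ := exists_lift₂ hT' (g ≫ u) (hX _)
    have h2 : g = t ≫ r ≫ e := by
      rw [hr, ← reassoc_of% ht, huv, Category.comp_id]
    rw [h2, Category.assoc, Category.assoc, mor₁_comp_mor₂ hF, comp_zero, comp_zero]
  have hRF (X : D) (hX : Q X) : ∀ f : X ⟶ R.obj F, f = 0 :=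
    adj_eq_zero T.adj₁ (hF0 _ (hIA X hX))
  have hsr' : R.map s ≫ R.map r = 𝟙 _ := by rw [← R.map_comp, hsr, R.map_id]
  have hsr'' : (R.map s)⟦(1 : ℤ)⟧' ≫ (R.map r)⟦(1 : ℤ)⟧' = 𝟙 _ := by
    rw [← Functor.map_comp, hsr', CategoryTheory.Functor.map_id]
  have hE : IsTri E' E F := ⟨_, _, _, hF⟩
  refine ⟨E', F, hE, exists_iso_of_hom_eq_zero h (hE.map R) (hRF B hB) (fun f => ?_)
    (hA _ (hQ₁ B hB)) (fun f => ?_)⟩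
  · rw [← Category.id_comp f, ← hsr', Category.assoc, hA _ (hQ₂ B hB) (R.map r ≫ f), comp_zero]
  · rw [← Category.id_comp f, ← hsr'', Category.assoc,
      hRF _ (hQ₁ _ (hQ₂ B hB)) ((R.map r)⟦(1 : ℤ)⟧' ≫ f), comp_zero]

end AmbiAdjunction

namespace StabilityData

open Pretriangulated

variable {D : Type*} [Category* D] [Preadditive D] [HasZeroObject D] [HasShift D ℤ]
  [∀ n : ℤ, (shiftFunctor D n).Additive] [Pretriangulated D]
  {D' : Type*} [Category* D'] [Preadditive D'] [HasZeroObject D'] [HasShift D' ℤ]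
  [∀ n : ℤ, (shiftFunctor D' n).Additive] [Pretriangulated D']

/-- The pair `(Z ∘ R, R⁻¹ P)`. -/
def inverseImage (σ : StabilityData D) (R : D' ⥤ D) [R.CommShift ℤ] [R.IsTriangulated] :
    StabilityData D' where
  Z := σ.Z.comp (K0.map R)
  P φ := (σ.P φ).inverseImage R

namespace IsStabilityCondition

variable {σ : StabilityData D} (hσ : σ.IsStabilityCondition)
  {I : D ⥤ D'} {R : D' ⥤ D} (T : AmbiAdjunction I R) [R.CommShift ℤ] [R.IsTriangulated]
  [I.CommShift ℤ] [I.IsTriangulated] (hRI : ∀ φ M, σ.P φ M → σ.P φ (R.obj (I.obj M)))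
include hσ T hRI

lemma hasHN_ind {l : List ℝ} {M : D} (h : HasHN σ.P l M) :
    HasHN (σ.inverseImage R).P l (I.obj M) :=
  h.map I hRI fun _ => T.isZero_of_isZero_map'

omit hσ hRI in
lemma hasHN_res {l : List ℝ} {E : D'} (h : HasHN (σ.inverseImage R).P l E) :
    HasHN σ.P l (R.obj E) :=
  h.map R (fun _ _ h => h) fun _ => T.isZero_of_isZero_map

/-- Every Harder-Narasimhan filtration of `R E` lifts to one of `E`, as the triangles of the
filtration do by `AmbiAdjunction.exists_isTri_lift`. That lemma is applied to the class of
objects all of whose phases are greater than the phase of the last factor. -/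
lemma hasHN_lift [IsIdempotentComplete D'] {l : List ℝ} {M : D} (h : HasHN σ.P l M) (E : D')
    (e : R.obj E ≅ M) : HasHN (σ.inverseImage R).P l E := by
  induction h generalizing E with
  | nil hE => exact .nil (T.isZero_of_isZero_map (hE.of_iso e))
  | @cons φ l M' M A h hT hA h0 hlt ih =>
    obtain ⟨E', F, hE, ⟨e₁⟩, ⟨e₂⟩⟩ := T.exists_isTri_lift
      (hT.of_iso (Iso.refl _) e.symm (Iso.refl _)) (fun X => ∃ l, HasHN σ.P l X ∧ ∀ ψ ∈ l, φ < ψ)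
      (fun X ⟨l, hl, hl'⟩ => ⟨_, hσ.hasHN_shift hl 1, fun ψ hψ => by
        obtain ⟨χ, hχ, rfl⟩ := List.mem_map.1 hψ
        have := hl' χ hχ
        push_cast
        linarith⟩)
      (fun X ⟨l, hl, hl'⟩ => ⟨l, hasHN_res T (hσ.hasHN_ind T hRI hl), hl'⟩) ⟨l, h, hlt⟩
      (fun X ⟨l, hl, hl'⟩ f => by
        obtain ⟨m, hm, hm'⟩ := hσ.hasHN_of_mem hA
        exact hσ.hom_eq_zero_of_hasHN hl hm (fun ψ hψ χ hχ => by
          rw [hm' χ hχ]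
          exact hl' ψ hψ) f)
    exact .cons (ih E' e₁.symm) hE (hσ.of_iso hA e₂)
      (fun hF => h0 ((R.map_isZero hF).of_iso e₂)) hlt

/-- Finite length descends along `R`, which maps strict subobjects to strict subobjects and, by
averaging, reflects inclusions between subobjects. -/
lemma isFiniteLength_inverseImage {J : Set ℝ} (h : IsFiniteLength (σ.PInterval J)) :
    IsFiniteLength ((σ.inverseImage R).PInterval J) := fun E => by
  have hR (E : D') (hE : (σ.inverseImage R).PInterval J E) : σ.PInterval J (R.obj E) := by
    obtain ⟨l, hl, hl'⟩ := pInterval_iff.1 hE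
    exact pInterval_iff.2 ⟨l, hasHN_res T hl, hl'⟩
  have hI (M : D) (hM : σ.PInterval J M) : (σ.inverseImage R).PInterval J (I.obj M) := by
    obtain ⟨l, hl, hl'⟩ := pInterval_iff.1 hM
    exact pInterval_iff.2 ⟨l, hσ.hasHN_ind T hRI hl, hl'⟩
  let F : ((σ.inverseImage R).PInterval J).FullSubcategory ⥤ (σ.PInterval J).FullSubcategory :=
    ObjectProperty.lift _ (ObjectProperty.ι _ ⋙ R) fun E => hR E.obj E.property
  refine wellFounded_subobject_of_functor F E (fun S => Nonempty (NormalMono S.arrow))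
    (fun S hS => ?_) (fun S S' _ _ k hk => ?_) (h _)
  · -- by adjunction, the inclusion of a kernel is mapped to the inclusion of a kernel
    obtain ⟨Z, g, w, hZ⟩ := exists_of_normalMono hS
    have : Mono (F.map S.arrow) := Preadditive.mono_of_cancel_zero _ fun {W} t ht => by
      apply ObjectProperty.hom_ext
      apply (T.adj₁.homEquiv _ _).symm.injective
      have h0 : (ObjectProperty.homMk ((T.adj₁.homEquiv _ _).symm t.hom) :
          (⟨I.obj W.obj, hI _ W.property⟩ : ((σ.inverseImage R).PInterval J).FullSubcategory) ⟶ S)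
          = 0 := by
        rw [← cancel_mono S.arrow, zero_comp]
        apply ObjectProperty.hom_ext
        have : t.hom ≫ R.map S.arrow.hom = 0 := congr(($ht).hom)
        refine (T.adj₁.homEquiv_naturality_right_symm t.hom S.arrow.hom).symm.trans ?_
        rw [this]
        simp
      have h1 : (T.adj₁.homEquiv _ _).symm t.hom = 0 := congr(($h0).hom)
      rw [h1]
      simp
    have hw : F.map S.arrow ≫ F.map g = 0 := by
      rw [← F.map_comp, w]
      exact ObjectProperty.hom_ext _ (R.map_zero _ _)
    refine nonempty_normalMono _ (F.map g) hw fun W t ht => ?_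
    obtain ⟨l, hl⟩ := hZ ⟨I.obj W.obj, hI _ W.property⟩
      (ObjectProperty.homMk ((T.adj₁.homEquiv _ _).symm t.hom)) (by
        apply ObjectProperty.hom_ext
        have : t.hom ≫ R.map g.hom = 0 := congr(($ht).hom)
        refine (T.adj₁.homEquiv_naturality_right_symm t.hom g.hom).symm.trans ?_
        rw [this]
        simp)
    refine ⟨ObjectProperty.homMk (T.adj₁.homEquiv _ _ l.hom), ObjectProperty.hom_ext _ ?_⟩
    have h1 : l.hom ≫ S.arrow.hom = (T.adj₁.homEquiv _ _).symm t.hom := congr(($hl).hom)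
    refine (T.adj₁.homEquiv_naturality_right l.hom S.arrow.hom).symm.trans ?_
    rw [h1]
    exact Equiv.apply_symm_apply _ _
  · have hk' : k.hom ≫ R.map S'.arrow.hom = R.map S.arrow.hom := congr(($hk).hom)
    refine Subobject.le_of_comm
      (ObjectProperty.homMk (inv (T.trace (Subobject.underlying.obj S).obj) ≫ T.avg k.hom))
      (ObjectProperty.hom_ext _ ?_)
    change (inv (T.trace _) ≫ T.avg k.hom) ≫ S'.arrow.hom = S.arrow.hom
    rw [Category.assoc, IsIso.inv_comp_eq, ← T.avg_map, hk', T.trace_comp, ← T.avg_id, ← T.map_avg,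
      Category.comp_id]

/-- Stability conditions descend along ambidextrous adjunctions. -/
theorem inverseImage [IsIdempotentComplete D'] :
    (σ.inverseImage R).IsStabilityCondition where
  closedUnderIsomorphisms φ := by
    have := hσ.closedUnderIsomorphisms φ
    dsimp [StabilityData.inverseImage]
    infer_instance
  closedUnderFiniteProducts φ := by
    have := hσ.closedUnderIsomorphisms φ
    have := hσ.closedUnderFiniteProducts φ
    exact ⟨fun J _ => ObjectProperty.IsClosedUnderLimitsOfShape.inverseImage _ (σ.P φ) R⟩
  exists_Z_eq φ E hE h0 := hσ.exists_Z_eq φ _ hE fun h => h0 (T.isZero_of_isZero_map h)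
  shift_iff φ E := by
    have e : R.obj (E⟦(1 : ℤ)⟧) ≅ (R.obj E)⟦(1 : ℤ)⟧ := (R.commShiftIso (1 : ℤ)).app E
    refine Iff.trans ?_ (hσ.shift_iff φ (R.obj E))
    exact ⟨fun h => hσ.of_iso h e, fun h => hσ.of_iso h e.symm⟩
  hom_eq_zero φ₁ φ₂ A₁ A₂ h h₁ h₂ f := by
    have := T.faithful
    exact R.map_injective (by rw [hσ.hom_eq_zero _ _ _ _ h h₁ h₂ (R.map f), R.map_zero])
  exists_hn E _ := by
    obtain ⟨l, hl⟩ := hσ.exists_hasHN (R.obj E)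
    obtain ⟨F, -⟩ := (hσ.hasHN_lift T hRI hl E (Iso.refl _)).exists_hnFiltration
    exact ⟨F⟩
  locallyFinite := by
    obtain ⟨η, h₁, h₂, h₃⟩ := hσ.locallyFinite
    exact ⟨η, h₁, h₂, fun t => hσ.isFiniteLength_inverseImage T hRI (h₃ t)⟩

/-- If `R X` is semisimple in `P φ`, then `X` is semisimple in `R⁻¹ P φ`: retractions can be
averaged. -/
lemma isSemisimpleObj_inverseImage {φ : ℝ} {X : D'} (hX : σ.P φ (R.obj X))
    (hs : IsSemisimpleObj (⟨R.obj X, hX⟩ : (σ.P φ).FullSubcategory)) :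
    IsSemisimpleObj (⟨X, hX⟩ : ((σ.inverseImage R).P φ).FullSubcategory) := fun Y f _ => by
  let g : (⟨R.obj Y.obj, Y.property⟩ : (σ.P φ).FullSubcategory) ⟶ ⟨R.obj X, hX⟩ :=
    ObjectProperty.homMk (R.map f.hom)
  have : Mono g := Preadditive.mono_of_cancel_zero _ fun {W} t ht => by
    apply ObjectProperty.hom_ext
    apply (T.adj₁.homEquiv _ _).symm.injective
    have h0 : (ObjectProperty.homMk ((T.adj₁.homEquiv _ _).symm t.hom) :
        (⟨I.obj W.obj, hRI _ _ W.property⟩ : ((σ.inverseImage R).P φ).FullSubcategory) ⟶ Y)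
        = 0 := by
      rw [← cancel_mono f, zero_comp]
      apply ObjectProperty.hom_ext
      have : t.hom ≫ R.map f.hom = 0 := congr(($ht).hom)
      refine (T.adj₁.homEquiv_naturality_right_symm t.hom f.hom).symm.trans ?_
      rw [this]
      simp
    have h1 : (T.adj₁.homEquiv _ _).symm t.hom = 0 := congr(($h0).hom)
    rw [h1]
    simp
  have hg := hs _ g
  have h1 : R.map f.hom ≫ (retraction g).hom = 𝟙 _ := congr(($(IsSplitMono.id g)).hom)
  refine ⟨⟨⟨ObjectProperty.homMk (T.avg (retraction g).hom ≫ inv (T.trace Y.obj)),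
    ObjectProperty.hom_ext _ ?_⟩⟩⟩
  change f.hom ≫ T.avg (retraction g).hom ≫ inv (T.trace Y.obj) = 𝟙 _
  rw [← Category.assoc, ← T.map_avg, h1, T.avg_id, IsIso.hom_inv_id]

/-- If `R X` is semisimple in `P φ` and `X` has only trivial idempotents, then `X` is stable. -/
lemma isStable_inverseImage {φ : ℝ} {X : D'} (hX : σ.P φ (R.obj X))
    (hs : IsSemisimpleObj (⟨R.obj X, hX⟩ : (σ.P φ).FullSubcategory)) (h0 : 𝟙 X ≠ 0)
    (hi : HasTrivialIdempotents X) : (σ.inverseImage R).IsStable φ X :=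
  ⟨hX, (hσ.isSemisimpleObj_inverseImage T hRI hX hs).simple (fun h => h0 congr(($h).hom))
    (.of_map (ObjectProperty.ι _) hi)⟩

/-- If `X` is stable and `R I` maps simple objects to semisimple objects, then `R X` is semisimple:
a simple subobject `S` of `R X` provides an epimorphism `I S ⟶ X`, so that `R X` is a quotient of
`R I S`. -/
lemma isSemisimpleObj_of_isStable_inverseImage [IsTriangulated D] [IsTriangulated D']
    [IsIdempotentComplete D'] {φ : ℝ} {X : D'} (h : (σ.inverseImage R).IsStable φ X)
    (hS : ∀ (S : D) (hS : σ.P φ S), Simple (⟨S, hS⟩ : (σ.P φ).FullSubcategory) →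
      IsSemisimpleObj (⟨R.obj (I.obj S), hRI φ S hS⟩ : (σ.P φ).FullSubcategory)) :
    ∃ hX : σ.P φ (R.obj X), IsSemisimpleObj (⟨R.obj X, hX⟩ : (σ.P φ).FullSubcategory) := by
  obtain ⟨hX, hsimple⟩ := h
  have hX0 : ¬ IsZero (R.obj X) := fun h => by
    have := T.isZero_of_isZero_map h
    exact id_nonzero (⟨X, hX⟩ : ((σ.inverseImage R).P φ).FullSubcategory)
      (ObjectProperty.hom_ext _ (this.eq_of_src _ _))
  obtain ⟨S, i, hS', hi⟩ := hσ.exists_simple_subobject ⟨R.obj X, hX⟩ hX0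
  let := hσ.abelian φ
  let := (hσ.inverseImage T hRI).abelian φ
  let f : (⟨I.obj S.obj, hRI _ _ S.property⟩ : ((σ.inverseImage R).P φ).FullSubcategory) ⟶
      ⟨X, hX⟩ := ObjectProperty.homMk ((T.adj₁.homEquiv _ _).symm i.hom)
  have hf : f ≠ 0 := fun h => hi (ObjectProperty.hom_ext _
    ((T.adj₁.homEquiv _ _).symm.injective (by
      have h1 : (T.adj₁.homEquiv _ _).symm i.hom = 0 := congr(($h).hom)
      rw [h1]
      simp)))
  have hepi : Epi f := epi_of_nonzero_to_simple hf
  let g : (⟨R.obj (I.obj S.obj), hRI _ _ S.property⟩ : (σ.P φ).FullSubcategory) ⟶ ⟨R.obj X, hX⟩ :=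
    ObjectProperty.homMk (R.map f.hom)
  have : Epi g := Preadditive.epi_of_cancel_zero _ fun {W} t ht => by
    apply ObjectProperty.hom_ext
    apply (T.adj₂.homEquiv _ _).injective
    have h0 : (ObjectProperty.homMk (T.adj₂.homEquiv _ _ t.hom) :
        (⟨X, hX⟩ : ((σ.inverseImage R).P φ).FullSubcategory) ⟶
          ⟨I.obj W.obj, hRI _ _ W.property⟩) = 0 := by
      rw [← cancel_epi f, comp_zero]
      apply ObjectProperty.hom_ext
      have : R.map f.hom ≫ t.hom = 0 := congr(($ht).hom)
      refine (T.adj₂.homEquiv_naturality_left f.hom t.hom).symm.trans ?_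
      rw [this]
      simp
    have h1 : T.adj₂.homEquiv _ _ t.hom = 0 := congr(($h0).hom)
    rw [h1]
    simp
  exact ⟨hX, (hS _ S.property hS').of_epi g⟩

end IsStabilityCondition
end StabilityData

/-! ### Idempotent completeness of bounded derived categories -/

section Idempotents

/-- The idempotent endomorphism `e` splits. -/
def Splits {C : Type*} [Category* C] {X : C} (e : X ⟶ X) : Prop :=
  ∃ (Y : C) (s : Y ⟶ X) (r : X ⟶ Y), s ≫ r = 𝟙 Y ∧ r ≫ s = e

lemma Splits.of_iso {C : Type*} [Category* C] {X Y : C} (i : X ≅ Y) {e : Y ⟶ Y}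
    (h : Splits (i.hom ≫ e ≫ i.inv)) : Splits e := by
  obtain ⟨Z, s, r, h₁, h₂⟩ := h
  exact ⟨Z, s ≫ i.hom, i.inv ≫ r, by simp [h₁], by simp [reassoc_of% h₂]⟩

lemma Splits.map {C D : Type*} [Category* C] [Category* D] (F : C ⥤ D) {X : C} {e : X ⟶ X}
    (h : Splits e) : Splits (F.map e) := by
  obtain ⟨Z, s, r, h₁, h₂⟩ := h
  exact ⟨_, F.map s, F.map r, by rw [← F.map_comp, h₁, F.map_id], by rw [← F.map_comp, h₂]⟩

open Pretriangulated

variable {D : Type*} [Category* D] [Preadditive D] [HasZeroObject D] [HasShift D ℤ]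
  [∀ n : ℤ, (shiftFunctor D n).Additive] [Pretriangulated D]

/-- An idempotent endomorphism of a distinguished triangle whose outer components split has a split
middle component. The images of the outer components are the ends of a distinguished triangle whose
middle object is the image `Y₁` of an idempotent `q` below `e`; the idempotent `e - q` has vanishing
outer components and thus square zero. -/
lemma splits_of_distTriang {T : Triangle D} (hT : T ∈ distTriang D) (e : T ⟶ T)
    (he : e.hom₂ ≫ e.hom₂ = e.hom₂) (h₁ : Splits e.hom₁) (h₃ : Splits e.hom₃) :
    Splits e.hom₂ := by
  obtain ⟨X₁, s₁, r₁, hsr₁, hrs₁⟩ := h₁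
  obtain ⟨Z₁, s₃, r₃, hsr₃, hrs₃⟩ := h₃
  obtain ⟨Y₁, f, g, hT₁⟩ := distinguished_cocone_triangle₂ (s₃ ≫ T.mor₃ ≫ r₁⟦(1 : ℤ)⟧')
  have c₃ : T.mor₃ ≫ e.hom₁⟦(1 : ℤ)⟧' = e.hom₃ ≫ T.mor₃ := e.comm₃
  have hs₃ : s₃ ≫ e.hom₃ = s₃ := by rw [← hrs₃, reassoc_of% hsr₃]
  have hs₁ : s₁ ≫ e.hom₁ = s₁ := by rw [← hrs₁, reassoc_of% hsr₁]
  have hr₁ : e.hom₁ ≫ r₁ = r₁ := by rw [← hrs₁, Category.assoc, hsr₁, Category.comp_id]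
  have hr₃ : e.hom₃ ≫ r₃ = r₃ := by rw [← hrs₃, Category.assoc, hsr₃, Category.comp_id]
  have hs : (s₃ ≫ T.mor₃ ≫ r₁⟦(1 : ℤ)⟧') ≫ s₁⟦(1 : ℤ)⟧' = s₃ ≫ T.mor₃ := by
    rw [Category.assoc, Category.assoc, ← Functor.map_comp, hrs₁, c₃, reassoc_of% hs₃]
  have hr : T.mor₃ ≫ r₁⟦(1 : ℤ)⟧' = r₃ ≫ s₃ ≫ T.mor₃ ≫ r₁⟦(1 : ℤ)⟧' := by
    rw [reassoc_of% hrs₃, ← reassoc_of% c₃, ← Functor.map_comp, hr₁]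
  obtain ⟨s, hs1, hs2⟩ : ∃ s : Y₁ ⟶ T.obj₂, f ≫ s = s₁ ≫ T.mor₁ ∧ g ≫ s₃ = s ≫ T.mor₂ :=
    complete_distinguished_triangle_morphism₂ _ _ hT₁ hT s₁ s₃ hs
  obtain ⟨r, hr1, hr2⟩ : ∃ r : T.obj₂ ⟶ Y₁, T.mor₁ ≫ r = r₁ ≫ f ∧ T.mor₂ ≫ r₃ = r ≫ g :=
    complete_distinguished_triangle_morphism₂ _ _ hT hT₁ r₁ r₃ hr
  have c₁ : T.mor₁ ≫ e.hom₂ = e.hom₁ ≫ T.mor₁ := e.comm₁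
  have c₂ : T.mor₂ ≫ e.hom₃ = e.hom₂ ≫ T.mor₂ := e.comm₂
  let a : Y₁ ⟶ Y₁ := s ≫ e.hom₂ ≫ r
  have ha1 : f ≫ a = f := by
    simp only [a]
    rw [reassoc_of% hs1, reassoc_of% c₁, reassoc_of% hs₁, hr1, reassoc_of% hsr₁]
  have ha2 : a ≫ g = g := by
    simp only [a, Category.assoc]
    rw [← hr2, ← reassoc_of% c₂, ← reassoc_of% hs2, hr₃, hsr₃, Category.comp_id]
  have : IsIso a := isIso₂_of_isIso₁₃
    (Triangle.homMk (Triangle.mk f g _) (Triangle.mk f g _) (𝟙 X₁) a (𝟙 Z₁)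
      (ha1.trans (Category.id_comp f).symm) ((Category.comp_id g).trans ha2.symm)
      (by
        refine ((congr_arg _ (CategoryTheory.Functor.map_id _ _)).trans (Category.comp_id _)).trans
          (Category.id_comp _).symm)) hT₁ hT₁ (IsIso.id X₁) (IsIso.id Z₁)
  have ha1' : f ≫ inv a = f := by rw [IsIso.comp_inv_eq, ha1]
  have ha2' : inv a ≫ g = g := by rw [IsIso.inv_comp_eq, ha2]
  have hsa : s ≫ e.hom₂ ≫ r ≫ inv a = 𝟙 _ := by
    have h := IsIso.hom_inv_id a
    simp only [a, Category.assoc] at h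
    exact h
  let q := e.hom₂ ≫ r ≫ inv a ≫ s ≫ e.hom₂
  have hq : q = e.hom₂ := by
    have hq0 : (e.hom₂ ≫ r ≫ inv a ≫ s ≫ e.hom₂) ≫ (e.hom₂ ≫ r ≫ inv a ≫ s ≫ e.hom₂) =
        e.hom₂ ≫ r ≫ inv a ≫ s ≫ e.hom₂ := by
      simp only [Category.assoc, reassoc_of% he]
      rw [reassoc_of% hsa]
    have hq1 : q ≫ e.hom₂ = q := by simp only [q, Category.assoc, he]
    have hq2 : e.hom₂ ≫ q = q := by simp only [q, reassoc_of% he]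
    have hq3 : T.mor₁ ≫ q = T.mor₁ ≫ e.hom₂ := by
      simp only [q]
      rw [reassoc_of% c₁, reassoc_of% hr1, reassoc_of% ha1', reassoc_of% hs1, c₁, reassoc_of% hs₁,
        reassoc_of% hrs₁, ← c₁, ← reassoc_of% c₁, he]
    have hq4 : q ≫ T.mor₂ = e.hom₂ ≫ T.mor₂ := by
      simp only [q, Category.assoc]
      rw [← c₂, ← reassoc_of% hs2, hs₃, reassoc_of% ha2', ← reassoc_of% hr2, hrs₃, c₂,
        reassoc_of% he]
    have hd : (e.hom₂ - q) ≫ (e.hom₂ - q) = e.hom₂ - q := by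
      have hqq : q ≫ q = q := hq0
      simp only [Preadditive.sub_comp, Preadditive.comp_sub, he, hq1, hq2, hqq]
      abel
    obtain ⟨t, ht⟩ := Triangle.yoneda_exact₂ _ hT (e.hom₂ - q)
      (by rw [Preadditive.comp_sub, hq3, sub_self])
    have : e.hom₂ - q = 0 := by
      rw [← hd]
      nth_rw 2 [ht]
      rw [← Category.assoc, Preadditive.sub_comp, hq4, sub_self, zero_comp]
    rw [← sub_eq_zero, ← neg_sub, this, neg_zero]
  refine ⟨Y₁, s ≫ e.hom₂, e.hom₂ ≫ r ≫ inv a, ?_, ?_⟩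
  · rw [Category.assoc, reassoc_of% he]
    exact hsa
  · simpa only [q, Category.assoc] using hq

open DerivedCategory

variable {A : Type*} [Category* A] [Abelian A] [HasDerivedCategory A]

lemma splits_of_isGE_of_isLE_self (X : DerivedCategory A) (n : ℤ) [X.IsGE n] [X.IsLE n]
    (e : X ⟶ X) (he : e ≫ e = e) : Splits e := by
  obtain ⟨Y, ⟨i⟩⟩ := exists_iso_singleFunctor_obj_of_isGE_of_isLE X n
  apply Splits.of_iso i.symm
  have := IsIdempotentComplete.idempotents_split Y
    ((singleFunctor A n).preimage (i.symm.hom ≫ e ≫ i.symm.inv))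
    ((singleFunctor A n).map_injective (by simp [reassoc_of% he]))
  obtain ⟨Z, s, r, h⟩ := this
  have h' : Splits ((singleFunctor A n).preimage (i.symm.hom ≫ e ≫ i.symm.inv)) := ⟨Z, s, r, h⟩
  simpa using h'.map (singleFunctor A n)

/-- Idempotents of bounded objects split: by induction on the amplitude, using the truncation
triangles. -/
lemma splits_of_isGE_of_isLE (d : ℕ) (X : DerivedCategory A) (n : ℤ) [X.IsGE n]
    [X.IsLE (n + d)] (e : X ⟶ X) (he : e ≫ e = e) : Splits e := by
  induction d generalizing X with
  | zero =>
    have : X.IsLE n := TStructure.t.isLE_of_le X (n + (0 : ℕ)) n (by simp)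
    exact splits_of_isGE_of_isLE_self X n e he
  | succ d ih =>
    have hX : TStructure.t.IsGE X n := inferInstance
    have hX' : TStructure.t.IsLE X (n + d + 1) :=
      TStructure.t.isLE_of_le X (n + (d + 1 : ℕ)) (n + d + 1) (by push_cast; omega)
    let F := (TStructure.t (C := A)).triangleLTGE (n + d + 1)
    have hT : F.obj X ∈ distTriang _ := TStructure.t.triangleLTGE_distinguished _ X
    have hF : F.map e ≫ F.map e = F.map e := by rw [← F.map_comp, he]
    refine splits_of_distTriang hT (F.map e) he ?_ ?_
    · have h1 : TStructure.t.IsLE ((TStructure.t.truncLT (n + d + 1)).obj X) (n + d) :=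
        inferInstance
      have h2 : TStructure.t.IsGE ((TStructure.t.truncLT (n + d + 1)).obj X) n := inferInstance
      have h3 : (F.obj X).obj₁.IsGE n := h2
      have h4 : (F.obj X).obj₁.IsLE (n + d) := h1
      exact ih _ _ (congr_arg (·.hom₁) hF)
    · have h1 : TStructure.t.IsLE ((TStructure.t.truncGE (n + d + 1)).obj X) (n + d + 1) :=
        inferInstance
      have h2 : TStructure.t.IsGE ((TStructure.t.truncGE (n + d + 1)).obj X) (n + d + 1) :=
        inferInstance
      have h3 : (F.obj X).obj₃.IsGE (n + d + 1) := h2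
      have h4 : (F.obj X).obj₃.IsLE (n + d + 1) := h1
      exact splits_of_isGE_of_isLE_self _ (n + d + 1) _ (congr_arg (·.hom₃) hF)

instance : IsIdempotentComplete (Bounded A) where
  idempotents_split X e he := by
    obtain ⟨⟨a, ha⟩, ⟨b, hb⟩⟩ := X.property
    have h1 : X.obj.IsGE a := ha
    obtain ⟨d, hd⟩ := Int.eq_ofNat_of_zero_le (le_max_right (b - a) 0)
    have h2' : TStructure.t.IsLE X.obj b := hb
    have h2 : TStructure.t.IsLE X.obj (a + d) :=
      TStructure.t.isLE_of_le X.obj b (a + d) (by have := le_max_left (b - a) 0; omega)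
    have h3 : X.obj.IsLE (a + d) := h2
    obtain ⟨Y, s, r, hsr, hrs⟩ := splits_of_isGE_of_isLE d X.obj a e.hom
      (congr_arg (·.hom) he)
    have hY : TStructure.t.bounded Y := by
      refine ⟨⟨a, (TStructure.t.isGE_iff_orthogonal (a - 1) a (by simp) Y).2 fun Z f hZ => ?_⟩,
        ⟨a + d, (TStructure.t.isLE_iff_orthogonal (a + d) (a + d + 1) rfl Y).2 fun Z f hZ => ?_⟩⟩
      · have := TStructure.t.zero (f ≫ s) (a - 1) a (by simp)
        rw [← Category.comp_id f, ← hsr, ← Category.assoc, this, zero_comp]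
      · have := TStructure.t.zero (r ≫ f) (a + d) (a + d + 1) (by simp)
        rw [← Category.id_comp f, ← hsr, Category.assoc, this, comp_zero]
    exact ⟨⟨Y, hY⟩, ObjectProperty.homMk s, ObjectProperty.homMk r, ObjectProperty.hom_ext _ hsr,
      ObjectProperty.hom_ext _ hrs⟩

end Idempotents

/-! ### Adjunctions between bounded derived categories -/

section DerivedAdjunction

open DerivedCategory

variable {A : Type*} [Category* A] [Abelian A] [HasDerivedCategory A]
  {B : Type*} [Category* B] [Abelian B] [HasDerivedCategory B]

/-- The adjunction between categories of complexes induced by an adjunction `F ⊣ F'`. -/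
def mapComplexAdj {F : A ⥤ B} {F' : B ⥤ A} [F.Additive] [F'.Additive] (adj : F ⊣ F') :
    F.mapHomologicalComplex (ComplexShape.up ℤ) ⊣ F'.mapHomologicalComplex (ComplexShape.up ℤ) :=
  Adjunction.mkOfUnitCounit
    { unit :=
        { app K :=
            { f n := adj.unit.app (K.X n)
              comm' i j _ := (adj.unit.naturality (K.d i j)).symm }
          naturality K L f := by ext n; exact adj.unit.naturality (f.f n) }
      counit :=
        { app K :=
            { f n := adj.counit.app (K.X n)
              comm' i j _ := (adj.counit.naturality (K.d i j)).symm }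
          naturality K L f := by ext n; exact adj.counit.naturality (f.f n) }
      left_triangle := by
        ext K n
        exact (congr_arg (F.map (adj.unit.app (K.X n)) ≫ ·) (Category.id_comp _)).trans
          (adj.left_triangle_components (K.X n))
      right_triangle := by
        ext K n
        exact (congr_arg (adj.unit.app (F'.obj (K.X n)) ≫ ·) (Category.id_comp _)).trans
          (adj.right_triangle_components (K.X n)) }

variable (F : A ⥤ B) [F.Additive] [PreservesFiniteLimits F] [PreservesFiniteColimits F]
  (F' : B ⥤ A) [F'.Additive] [PreservesFiniteLimits F'] [PreservesFiniteColimits F']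

/-- The square relating an exact functor on complexes and on derived categories. -/
abbrev catCommSqQ : CatCommSq (F.mapHomologicalComplex (ComplexShape.up ℤ)) Q Q
    F.mapDerivedCategory where
  iso := F.mapDerivedCategoryFactors.symm

attribute [local instance] catCommSqQ

variable {F F'}

/-- The adjunction between derived categories induced by an adjunction between exact functors. -/
def mapDerivedAdj (adj : F ⊣ F') : F.mapDerivedCategory ⊣ F'.mapDerivedCategory :=
  (mapComplexAdj adj).localization Q (HomologicalComplex.quasiIso A _) Q
    (HomologicalComplex.quasiIso B _) _ _

lemma mapDerivedAdj_unit_app (adj : F ⊣ F') (K : CochainComplex A ℤ) :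
    (mapDerivedAdj adj).unit.app (Q.obj K) = Q.map ((mapComplexAdj adj).unit.app K) ≫
      F'.mapDerivedCategoryFactors.inv.app ((F.mapHomologicalComplex _).obj K) ≫
        F'.mapDerivedCategory.map (F.mapDerivedCategoryFactors.inv.app K) :=
  Adjunction.localization_unit_app ..

lemma mapDerivedAdj_counit_app (adj : F ⊣ F') (K : CochainComplex B ℤ) :
    (mapDerivedAdj adj).counit.app (Q.obj K) =
      F.mapDerivedCategory.map (F'.mapDerivedCategoryFactors.hom.app K) ≫
      F.mapDerivedCategoryFactors.hom.app ((F'.mapHomologicalComplex _).obj K) ≫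
        Q.map ((mapComplexAdj adj).counit.app K) :=
  Adjunction.localization_counit_app ..

lemma exists_iso_Q_obj (X : DerivedCategory A) : ∃ K : CochainComplex A ℤ, Nonempty (X ≅ Q.obj K) :=
  ⟨_, ⟨(Q.objObjPreimageIso X).symm⟩⟩

variable (F) in
/-- `mapBounded F` is the restriction of the functor between derived categories. -/
def mapBoundedCompι : Bounded.ι ⋙ F.mapDerivedCategory ≅ mapBounded F ⋙ Bounded.ι :=
  Iso.refl _

/-- The adjunction between bounded derived categories induced by an adjunction between exact
functors. -/
def mapBoundedAdj (adj : F ⊣ F') : mapBounded F ⊣ mapBounded F' :=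
  (mapDerivedAdj adj).restrictFullyFaithful (iC := Bounded.ι) (iD := Bounded.ι)
    (ObjectProperty.fullyFaithfulι _) (ObjectProperty.fullyFaithfulι _) (mapBoundedCompι F)
    (mapBoundedCompι F')

lemma mapBoundedAdj_unit_app (adj : F ⊣ F') (X : Bounded A) :
    Bounded.ι.map ((mapBoundedAdj adj).unit.app X) = (mapDerivedAdj adj).unit.app X.obj := by
  rw [mapBoundedAdj, Adjunction.map_restrictFullyFaithful_unit_app]
  exact (congr_arg (_ ≫ ·) ((Category.comp_id _).trans
    (F'.mapDerivedCategory.map_id _))).trans (Category.comp_id _)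

lemma mapBoundedAdj_counit_app (adj : F ⊣ F') (X : Bounded B) :
    Bounded.ι.map ((mapBoundedAdj adj).counit.app X) = (mapDerivedAdj adj).counit.app X.obj := by
  rw [mapBoundedAdj, Adjunction.map_restrictFullyFaithful_counit_app]
  exact (Category.id_comp _).trans ((congr_arg (· ≫ _)
    (F.mapDerivedCategory.map_id _)).trans (Category.id_comp _))

/-- A natural endomorphism of the identity of a derived category is invertible if it is on
complexes. -/
lemma isIso_app_of_isIso_app_Q {τ : 𝟭 (DerivedCategory A) ⟶ 𝟭 (DerivedCategory A)}
    (h : ∀ K, IsIso (τ.app (Q.obj K))) (X : DerivedCategory A) : IsIso (τ.app X) := by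
  obtain ⟨K, ⟨e⟩⟩ := exists_iso_Q_obj X
  exact (NatTrans.isIso_app_iff_of_iso τ e).2 (h K)

lemma isIso_of_isIso_f {K L : CochainComplex A ℤ} (f : K ⟶ L) (h : ∀ n, IsIso (f.f n)) :
    IsIso f := HomologicalComplex.Hom.isIso_of_components f

/-- An exact functor which is fully faithful and has an exact right adjoint induces a fully faithful
functor on bounded derived categories. -/
def mapBoundedFullyFaithful (adj : F ⊣ F') [F.Full] [F.Faithful] :
    (mapBounded F).FullyFaithful := by
  have (X : Bounded A) : IsIso ((mapBoundedAdj adj).unit.app X) := by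
    have h : IsIso (Bounded.ι.map ((mapBoundedAdj adj).unit.app X)) := by
      rw [mapBoundedAdj_unit_app]
      obtain ⟨K, ⟨e⟩⟩ := exists_iso_Q_obj X.obj
      refine (NatTrans.isIso_app_iff_of_iso _ e).2 ?_
      rw [mapDerivedAdj_unit_app]
      have : IsIso ((mapComplexAdj adj).unit.app K) := isIso_of_isIso_f _ fun n =>
        inferInstanceAs (IsIso (adj.unit.app (K.X n)))
      infer_instance
    exact isIso_of_fully_faithful Bounded.ι _
  have : IsIso (mapBoundedAdj adj).unit := NatIso.isIso_of_isIso_app _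
  exact (mapBoundedAdj adj).fullyFaithfulLOfIsIsoUnit

/-- The composites of units and counits of induced adjunctions are induced by the composites. -/
lemma mapDerivedAdj_unit_counit_app (adj₁ : F ⊣ F') (adj₂ : F' ⊣ F) (K : CochainComplex A ℤ) :
    (mapDerivedAdj adj₁).unit.app (Q.obj K) ≫ (mapDerivedAdj adj₂).counit.app (Q.obj K) =
      Q.map ((mapComplexAdj adj₁).unit.app K ≫ (mapComplexAdj adj₂).counit.app K) := by
  rw [mapDerivedAdj_unit_app, mapDerivedAdj_counit_app]
  have h1 : F'.mapDerivedCategory.map (F.mapDerivedCategoryFactors.inv.app K) ≫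
      F'.mapDerivedCategory.map (F.mapDerivedCategoryFactors.hom.app K) = 𝟙 _ := by
    rw [← Functor.map_comp, Iso.inv_hom_id_app, CategoryTheory.Functor.map_id]
  have h2 := F'.mapDerivedCategoryFactors.inv_hom_id_app ((F.mapHomologicalComplex _).obj K)
  simp only [Category.assoc, Functor.map_comp]
  erw [reassoc_of% h1, reassoc_of% h2]

lemma isIso_mapBoundedAdj_unit_counit_app (adj₁ : F ⊣ F') (adj₂ : F' ⊣ F)
    (h : ∀ X, IsIso (adj₁.unit.app X ≫ adj₂.counit.app X)) (X : Bounded A) :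
    IsIso ((mapBoundedAdj adj₁).unit.app X ≫ (mapBoundedAdj adj₂).counit.app X) := by
  have h' : IsIso (Bounded.ι.map ((mapBoundedAdj adj₁).unit.app X ≫
      (mapBoundedAdj adj₂).counit.app X)) := by
    rw [Functor.map_comp, mapBoundedAdj_unit_app, mapBoundedAdj_counit_app]
    refine isIso_app_of_isIso_app_Q
      (τ := (mapDerivedAdj adj₁).unit ≫ (mapDerivedAdj adj₂).counit) (fun K => ?_) X.obj
    rw [NatTrans.comp_app, mapDerivedAdj_unit_counit_app]
    have : IsIso ((mapComplexAdj adj₁).unit.app K ≫ (mapComplexAdj adj₂).counit.app K) :=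
      isIso_of_isIso_f _ fun n => h (K.X n)
    infer_instance
  exact isIso_of_fully_faithful Bounded.ι _

/-- Ambidextrous adjunctions between exact functors induce ambidextrous adjunctions of bounded
derived categories. -/
def AmbiAdjunction.mapBounded (T : AmbiAdjunction F F') :
    AmbiAdjunction (mapBounded F) (mapBounded F') where
  adj₁ := mapBoundedAdj T.adj₁
  adj₂ := mapBoundedAdj T.adj₂
  isIso_trace := isIso_mapBoundedAdj_unit_counit_app _ _ T.isIso_trace
  isIso_trace' := isIso_mapBoundedAdj_unit_counit_app _ _ T.isIso_trace'

/-- If `F ⋙ F'` is the direct sum of exact functors `S i`, then so is the composition of the induced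
functors on bounded derived categories. -/
lemma exists_mapBounded_comp_biproduct {ι : Type*} [Fintype ι] [DecidableEq ι] (S : ι → A ⥤ A)
    [∀ i, (S i).Additive] [∀ i, PreservesFiniteLimits (S i)] [∀ i, PreservesFiniteColimits (S i)]
    (a : ∀ i, S i ⟶ F ⋙ F') (p : ∀ i, F ⋙ F' ⟶ S i)
    (hap : ∀ i X, (a i).app X ≫ (p i).app X = 𝟙 _)
    (h : ∀ X, ∑ i, (p i).app X ≫ (a i).app X = 𝟙 _) (M : Bounded A) :
    ∃ (a : ∀ i, (mapBounded (S i)).obj M ⟶ (mapBounded F').obj ((mapBounded F).obj M))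
      (p : ∀ i, (mapBounded F').obj ((mapBounded F).obj M) ⟶ (mapBounded (S i)).obj M),
      (∀ i, a i ≫ p i = 𝟙 _) ∧ ∑ i, p i ≫ a i = 𝟙 _ := by
  obtain ⟨K, ⟨e⟩⟩ := exists_iso_Q_obj M.obj
  let U : F'.mapDerivedCategory.obj (F.mapDerivedCategory.obj M.obj) ≅
      Q.obj ((F'.mapHomologicalComplex _).obj ((F.mapHomologicalComplex _).obj K)) :=
    F'.mapDerivedCategory.mapIso (F.mapDerivedCategory.mapIso e ≪≫
      F.mapDerivedCategoryFactors.app K) ≪≫ F'.mapDerivedCategoryFactors.app _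
  let V (i : ι) : (S i).mapDerivedCategory.obj M.obj ≅
      Q.obj (((S i).mapHomologicalComplex _).obj K) :=
    (S i).mapDerivedCategory.mapIso e ≪≫ (S i).mapDerivedCategoryFactors.app K
  let α (i : ι) : ((S i).mapHomologicalComplex (ComplexShape.up ℤ)).obj K ⟶
      (F'.mapHomologicalComplex _).obj ((F.mapHomologicalComplex _).obj K) :=
    { f n := (a i).app (K.X n)
      comm' j l _ := ((a i).naturality (K.d j l)).symm }
  let π (i : ι) : (F'.mapHomologicalComplex _).obj ((F.mapHomologicalComplex _).obj K) ⟶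
      ((S i).mapHomologicalComplex (ComplexShape.up ℤ)).obj K :=
    { f n := (p i).app (K.X n)
      comm' j l _ := ((p i).naturality (K.d j l)).symm }
  have hαπ (i) : α i ≫ π i = 𝟙 _ := by ext n; exact hap i (K.X n)
  have hπα : ∑ i, π i ≫ α i = 𝟙 _ := by
    ext n
    refine Eq.trans ?_ (h (K.X n))
    exact map_sum (HomologicalComplex.eval _ _ n).mapAddHom (fun i => π i ≫ α i) _
  refine ⟨fun i => ObjectProperty.homMk ((V i).hom ≫ Q.map (α i) ≫ U.inv),
    fun i => ObjectProperty.homMk (U.hom ≫ Q.map (π i) ≫ (V i).inv), fun i => ?_, ?_⟩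
  · apply ObjectProperty.hom_ext
    change ((V i).hom ≫ Q.map (α i) ≫ U.inv) ≫ U.hom ≫ Q.map (π i) ≫ (V i).inv = 𝟙 _
    simp only [Category.assoc, Iso.inv_hom_id_assoc]
    rw [← Functor.map_comp_assoc, hαπ, CategoryTheory.Functor.map_id, Category.id_comp,
      Iso.hom_inv_id]
  · apply ObjectProperty.hom_ext
    refine (map_sum Bounded.ι.mapAddHom _ _).trans ?_
    have h' (i) : (U.hom ≫ Q.map (π i) ≫ (V i).inv) ≫ (V i).hom ≫ Q.map (α i) ≫ U.inv =
        U.hom ≫ Q.map (π i ≫ α i) ≫ U.inv := by simp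
    refine (Finset.sum_congr rfl fun i _ => h' i).trans ?_
    rw [← Preadditive.comp_sum, ← Preadditive.sum_comp, ← Functor.map_sum, hπα,
      CategoryTheory.Functor.map_id, Category.id_comp, Iso.hom_inv_id]
    rfl

variable (A) in
/-- The functor embedding an abelian category into its bounded derived category. -/
def singleBounded : A ⥤ Bounded A :=
  ObjectProperty.lift _ (singleFunctor A 0) fun E => (single E).property

variable (A) in
/-- The embedding of an abelian category into its bounded derived category is fully faithful. -/
def singleBoundedFullyFaithful : (singleBounded A).FullyFaithful where
  preimage f := (singleFunctor A 0).preimage f.hom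
  map_preimage f := ObjectProperty.hom_ext _ ((singleFunctor A 0).map_preimage f.hom)
  preimage_map f := (singleFunctor A 0).preimage_map f

instance : (singleBounded A).Additive where
  map_add := ObjectProperty.hom_ext _ ((singleFunctor A 0).map_add)

variable (F) in
/-- The functor induced by `F` extends `F`. -/
def mapBoundedSingle (E : A) : (mapBounded F).obj (single E) ≅ single (F.obj E) :=
  ObjectProperty.isoMk _ ((F.mapDerivedCategorySingleFunctor 0).app E)

end DerivedAdjunction

/-! ### Induction of equivariant objects from the trivial group -/

namespace RightAction

variable {G : Type w} [Group G] {C : Type u} [Category.{v} C] (A : RightAction G C)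

section Unit

/-- The isomorphism `φ_1 M ≅ M`, characterized by the fact that its image under `φ_1` is
`ε_{1,1}`. -/
def unitIso (M : C) : (A.φ 1).obj M ≅ M :=
  (A.φ 1).preimageIso ((A.ε 1 1 1 (mul_one 1)).app M)

lemma map_one_unitIso_hom (M : C) :
    (A.φ 1).map (A.unitIso M).hom = (A.ε 1 1 1 (mul_one 1)).hom.app M := by
  simp [unitIso]

/-- The isomorphisms `unitIso` form a natural transformation. -/
lemma unitIso_hom_naturality {M N : C} (f : M ⟶ N) :
    (A.φ 1).map f ≫ (A.unitIso N).hom = (A.unitIso M).hom ≫ f := by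
  apply (A.φ 1).map_injective
  rw [Functor.map_comp, Functor.map_comp, map_one_unitIso_hom, map_one_unitIso_hom]
  exact (A.ε 1 1 1 (mul_one 1)).hom.naturality f

lemma unitIso_inv_naturality {M N : C} (f : M ⟶ N) :
    f ≫ (A.unitIso N).inv = (A.unitIso M).inv ≫ (A.φ 1).map f := by
  rw [Iso.comp_inv_eq, Category.assoc, unitIso_hom_naturality, Iso.inv_hom_id_assoc]

/-- The image of `unitIso` under any `φ_g` is an `ε`: compare with the case of `g = 1` by means of
the associativity of `ε`. -/
lemma map_unitIso_hom (g : G) (M : C) :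
    (A.φ g).map (A.unitIso M).hom = (A.ε g 1 g (one_mul g)).hom.app M := by
  have h1 := A.assoc g 1 1 g 1 g (one_mul g) (mul_one 1) (one_mul g) (one_mul g) M
  rw [← map_one_unitIso_hom] at h1
  have h2 : (A.φ g).map ((A.φ 1).map (A.unitIso M).hom) ≫ (A.ε g 1 g (one_mul g)).hom.app M =
      (A.ε g 1 g (one_mul g)).hom.app ((A.φ 1).obj M) ≫ (A.φ g).map (A.unitIso M).hom :=
    (A.ε g 1 g (one_mul g)).hom.naturality (A.unitIso M).hom
  exact (cancel_epi _).1 (h2.symm.trans h1)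

variable {A} in
/-- The linearization of an equivariant object is normalized: its component for the neutral element
is inverse to `unitIso`. -/
lemma Equivariant.θ_one_unitIso_hom (E : A.Equivariant) :
    (E.θ 1).hom ≫ (A.unitIso E.obj).hom = 𝟙 _ := by
  have h := E.θ_mul 1 1 1 (mul_one 1)
  rw [← map_one_unitIso_hom, ← Functor.map_comp] at h
  apply (A.φ 1).map_injective
  rw [← cancel_epi (E.θ 1).hom, ← h, CategoryTheory.Functor.map_id, Category.comp_id]

end Unit

variable [Abelian C] [Fintype G]

attribute [local instance] Abelian.hasFiniteBiproducts

/-- The object `⨁ φ_g M`, the sum being over all `g`. -/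
abbrev sumObj (M : C) : C := ⨁ fun g : G => (A.φ g).obj M

/-- The projection of `⨁ φ_g M` to a summand. -/
abbrev sumπ (M : C) (g : G) : A.sumObj M ⟶ (A.φ g).obj M :=
  biproduct.π (fun g : G => (A.φ g).obj M) g

/-- The inclusion of a summand into `⨁ φ_g M`. -/
abbrev sumι (M : C) (g : G) : (A.φ g).obj M ⟶ A.sumObj M :=
  biproduct.ι (fun g : G => (A.φ g).obj M) g

lemma sumι_π_self (M : C) (g : G) : A.sumι M g ≫ A.sumπ M g = 𝟙 _ :=
  biproduct.ι_π_self _ _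

lemma sumι_π_ne (M : C) {g h : G} (e : g ≠ h) : A.sumι M g ≫ A.sumπ M h = 0 :=
  biproduct.ι_π_ne _ e

lemma sum_sumπ_ι (M : C) : ∑ g, A.sumπ M g ≫ A.sumι M g = 𝟙 _ :=
  biproduct.hom_ext _ _ fun h => by
    rw [Preadditive.sum_comp, Finset.sum_eq_single h, Category.assoc, sumι_π_self, Category.comp_id,
      Category.id_comp]
    · intro g _ e
      rw [Category.assoc, sumι_π_ne _ _ e, comp_zero]
    · simp

variable {A}

lemma sum_comp_π {M X : C} (f : ∀ g : G, X ⟶ (A.φ g).obj M) (h : G) :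
    (∑ g, f g ≫ A.sumι M g) ≫ A.sumπ M h = f h := by
  rw [Preadditive.sum_comp, Finset.sum_eq_single h, Category.assoc, sumι_π_self, Category.comp_id]
  · intro g _ e
    rw [Category.assoc, sumι_π_ne _ _ e, comp_zero]
  · simp

lemma ι_comp_sum {M X : C} (f : ∀ g : G, (A.φ g).obj M ⟶ X) (h : G) :
    A.sumι M h ≫ (∑ g, A.sumπ M g ≫ f g) = f h := by
  rw [Preadditive.comp_sum, Finset.sum_eq_single h, ← Category.assoc, sumι_π_self,
    Category.id_comp]
  · intro g _ e
    rw [← Category.assoc, sumι_π_ne _ _ e.symm, zero_comp]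
  · simp

lemma map_sum_ext (k : G) {M X : C} {a b : X ⟶ (A.φ k).obj (A.sumObj M)}
    (h : ∀ g, a ≫ (A.φ k).map (A.sumπ M g) = b ≫ (A.φ k).map (A.sumπ M g)) : a = b := by
  have h1 : ∑ g, (A.φ k).map (A.sumπ M g) ≫ (A.φ k).map (A.sumι M g) = 𝟙 _ := by
    simp only [← Functor.map_comp]
    rw [← Functor.map_sum, sum_sumπ_ι, CategoryTheory.Functor.map_id]
  rw [← Category.comp_id a, ← Category.comp_id b, ← h1, Preadditive.comp_sum, Preadditive.comp_sum]
  exact Finset.sum_congr rfl fun g _ => by rw [reassoc_of% h g]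

/-- The linearization `⨁ φ_g M ⟶ φ_k (⨁ φ_g M)`, whose component towards `φ_k φ_g M` is the
inverse of `ε` on the summand `φ_{g k} M`. -/
def sumHom (M : C) (k : G) : A.sumObj M ⟶ (A.φ k).obj (A.sumObj M) :=
  ∑ g, A.sumπ M (g * k) ≫ (A.ε k g (g * k) rfl).inv.app M ≫ (A.φ k).map (A.sumι M g)

/-- The inverse of `sumHom`. -/
def sumInv (M : C) (k : G) : (A.φ k).obj (A.sumObj M) ⟶ A.sumObj M :=
  ∑ g, (A.φ k).map (A.sumπ M g) ≫ (A.ε k g (g * k) rfl).hom.app M ≫ A.sumι M (g * k)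

lemma sumHom_map_π (M : C) (k g l : G) (e : g * k = l) :
    sumHom M k ≫ (A.φ k).map (A.sumπ M g) = A.sumπ M l ≫ (A.ε k g l e).inv.app M := by
  subst e
  rw [sumHom, Preadditive.sum_comp, Finset.sum_eq_single g]
  · simp only [Category.assoc]
    rw [← Functor.map_comp, sumι_π_self, CategoryTheory.Functor.map_id]
    exact congr_arg (A.sumπ M (g * k) ≫ ·) (Category.comp_id _)
  · intro h _ e
    simp only [Category.assoc]
    rw [← Functor.map_comp, sumι_π_ne _ _ e, CategoryTheory.Functor.map_zero]
    simp
  · simp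

lemma map_ι_sumInv (M : C) (k g l : G) (e : g * k = l) :
    (A.φ k).map (A.sumι M g) ≫ sumInv M k = (A.ε k g l e).hom.app M ≫ A.sumι M l := by
  subst e
  rw [sumInv, Preadditive.comp_sum, Finset.sum_eq_single g]
  · rw [← Functor.map_comp_assoc, sumι_π_self, CategoryTheory.Functor.map_id]
    exact Category.id_comp _
  · intro h _ e
    rw [← Functor.map_comp_assoc, sumι_π_ne _ _ e.symm, CategoryTheory.Functor.map_zero, zero_comp]
  · simp

lemma sumInv_π (M : C) (k g l : G) (e : g * k = l) :
    sumInv M k ≫ A.sumπ M l = (A.φ k).map (A.sumπ M g) ≫ (A.ε k g l e).hom.app M := by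
  subst e
  rw [sumInv, Preadditive.sum_comp, Finset.sum_eq_single g]
  · simp only [Category.assoc]
    rw [sumι_π_self, Category.comp_id]
  · intro h _ e
    simp only [Category.assoc]
    rw [sumι_π_ne _ _ (fun h' => e (mul_right_cancel h')), comp_zero, comp_zero]
  · simp

lemma sumHom_sumInv (M : C) (k : G) : sumHom M k ≫ sumInv (A := A) M k = 𝟙 _ := by
  refine biproduct.hom_ext _ _ fun l => ?_
  have e : l * k⁻¹ * k = l := by simp
  rw [Category.assoc]
  refine (congr_arg (_ ≫ ·) (sumInv_π M k _ l e)).trans ?_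
  rw [← Category.assoc, sumHom_map_π M k _ l e, Category.assoc, Iso.inv_hom_id_app,
    Category.comp_id, Category.id_comp]

lemma sumInv_sumHom (M : C) (k : G) : sumInv M k ≫ sumHom (A := A) M k = 𝟙 _ := by
  refine map_sum_ext k fun g => ?_
  rw [Category.assoc, sumHom_map_π M k g _ rfl, ← Category.assoc, sumInv_π M k g _ rfl,
    Category.assoc, Iso.hom_inv_id_app, Category.id_comp]
  exact Category.comp_id _

/-- The cocycle condition for the linearization of `⨁ φ_g M`. -/
lemma sumHom_mul (M : C) (g h k : G) (e : h * g = k) :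
    sumHom M k = sumHom M g ≫ (A.φ g).map (sumHom M h) ≫ (A.ε g h k e).hom.app (A.sumObj M) := by
  refine map_sum_ext k fun j => ?_
  have h1 : (A.φ g).map ((A.φ h).map (A.sumπ M j)) ≫ (A.ε g h k e).hom.app ((A.φ j).obj M) =
      (A.ε g h k e).hom.app (A.sumObj M) ≫ (A.φ k).map (A.sumπ M j) :=
    (A.ε g h k e).hom.naturality (A.sumπ M j)
  have e' : j * h * g = j * k := by simp [← e, mul_assoc]
  have h2 := A.assoc g h j k (j * h) (j * k) e rfl rfl e' M
  have h5 : (A.ε g (j * h) (j * k) e').inv.app M ≫ (A.φ g).map ((A.ε h j (j * h) rfl).inv.app M) ≫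
      (A.ε g h k e).hom.app ((A.φ j).obj M) = (A.ε k j (j * k) rfl).inv.app M := by
    rw [← cancel_mono ((A.ε k j (j * k) rfl).hom.app M), Category.assoc, Category.assoc, ← h2,
      ← Functor.map_comp_assoc, Iso.inv_hom_id_app, Iso.inv_hom_id_app]
    dsimp only [Functor.comp_obj]
    erw [CategoryTheory.Functor.map_id, Category.id_comp]
    exact Iso.inv_hom_id_app _ _
  rw [Category.assoc, Category.assoc, ← h1, ← Functor.map_comp_assoc, sumHom_map_π M k j _ rfl,
    sumHom_map_π M h j _ rfl, Functor.map_comp, Category.assoc, ← Category.assoc,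
    sumHom_map_π M g (j * h) (j * k) e', Category.assoc, ← h5]

/-- The morphism `⨁ φ_g M ⟶ ⨁ φ_g N` induced by `M ⟶ N`. -/
def sumMap {M N : C} (f : M ⟶ N) : A.sumObj M ⟶ A.sumObj N :=
  ∑ g, A.sumπ M g ≫ (A.φ g).map f ≫ A.sumι N g

lemma sumMap_π {M N : C} (f : M ⟶ N) (g : G) :
    sumMap f ≫ A.sumπ N g = A.sumπ M g ≫ (A.φ g).map f := by
  rw [← sum_comp_π (fun g => A.sumπ M g ≫ (A.φ g).map f) g]
  simp only [sumMap, Category.assoc]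

lemma ι_sumMap {M N : C} (f : M ⟶ N) (g : G) :
    A.sumι M g ≫ sumMap f = (A.φ g).map f ≫ A.sumι N g :=
  ι_comp_sum (fun g => (A.φ g).map f ≫ A.sumι N g) g

lemma sum_hom_ext {M X : C} {a b : X ⟶ A.sumObj M} (h : ∀ g, a ≫ A.sumπ M g = b ≫ A.sumπ M g) :
    a = b := biproduct.hom_ext _ _ h

lemma sum_hom_ext' {M X : C} {a b : A.sumObj M ⟶ X} (h : ∀ g, A.sumι M g ≫ a = A.sumι M g ≫ b) :
    a = b := biproduct.hom_ext' _ _ h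

lemma sumHom_map_sumMap {M N : C} (f : M ⟶ N) (k : G) :
    sumHom M k ≫ (A.φ k).map (sumMap f) = sumMap f ≫ sumHom N k := by
  refine map_sum_ext k fun g => ?_
  have h2 : (A.φ k).map ((A.φ g).map f) ≫ (A.ε k g (g * k) rfl).hom.app N =
    (A.ε k g (g * k) rfl).hom.app M ≫ (A.φ (g * k)).map f :=
      (A.ε k g (g * k) rfl).hom.naturality f
  rw [← cancel_mono ((A.ε k g (g * k) rfl).hom.app N)]
  simp only [Category.assoc]
  rw [← Functor.map_comp_assoc, sumMap_π, Functor.map_comp, Category.assoc, h2,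
    ← Category.assoc, sumHom_map_π M k g _ rfl, ← Category.assoc (sumHom N k),
    sumHom_map_π N k g _ rfl, Category.assoc, Category.assoc, Iso.inv_hom_id_app,
    Iso.inv_hom_id_app_assoc, ← sumMap_π]
  exact congr_arg (_ ≫ ·) (Category.comp_id _).symm

/-- The linearization of `⨁ φ_g M`. -/
def sumθ (M : C) (k : G) : A.sumObj M ≅ (A.φ k).obj (A.sumObj M) where
  hom := sumHom M k
  inv := sumInv M k
  hom_inv_id := sumHom_sumInv M k
  inv_hom_id := sumInv_sumHom M k

/-- The unit of the adjunction `sumAdj`. -/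
def toSum (M : C) : M ⟶ A.sumObj M := (A.unitIso M).inv ≫ A.sumι M 1

/-- The counit of the adjunction `adjSum`. -/
def fromSum (M : C) : A.sumObj M ⟶ M := A.sumπ M 1 ≫ (A.unitIso M).hom

lemma toSum_fromSum (M : C) : toSum M ≫ fromSum (A := A) M = 𝟙 M := by
  rw [toSum, fromSum, Category.assoc, ← Category.assoc (A.sumι M 1), sumι_π_self,
    Category.id_comp, Iso.inv_hom_id]

lemma toSum_naturality {M N : C} (f : M ⟶ N) :
    f ≫ toSum N = toSum M ≫ sumMap (A := A) f := by
  rw [toSum, toSum, ← Category.assoc, unitIso_inv_naturality, Category.assoc, Category.assoc,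
    ι_sumMap]

lemma fromSum_naturality {M N : C} (f : M ⟶ N) :
    sumMap (A := A) f ≫ fromSum N = fromSum M ≫ f := by
  rw [fromSum, fromSum, ← Category.assoc, sumMap_π, Category.assoc, Category.assoc,
    unitIso_hom_naturality]

lemma map_toSum (g : G) (M : C) : (A.φ g).map (toSum M) =
    (A.ε g 1 g (one_mul g)).inv.app M ≫ (A.φ g).map (A.sumι M 1) := by
  rw [toSum, Functor.map_comp]
  congr 1
  rw [← cancel_mono ((A.ε g 1 g (one_mul g)).hom.app M), Iso.inv_hom_id_app, ← map_unitIso_hom,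
    ← Functor.map_comp, Iso.inv_hom_id, CategoryTheory.Functor.map_id]

lemma map_fromSum (g : G) (M : C) : (A.φ g).map (fromSum M) =
    (A.φ g).map (A.sumπ M 1) ≫ (A.ε g 1 g (one_mul g)).hom.app M := by
  rw [fromSum, Functor.map_comp, map_unitIso_hom]

/-- The morphism to `⨁ φ_g M` with given components `M ≅ φ_g M`. -/
def toSumOf {M : C} (θ : ∀ g : G, M ≅ (A.φ g).obj M) : M ⟶ A.sumObj M :=
  ∑ g, (θ g).hom ≫ A.sumι M g

/-- The morphism from `⨁ φ_g M` whose components are the inverses of given isomorphisms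
`M ≅ φ_g M`. -/
def fromSumOf {M : C} (θ : ∀ g : G, M ≅ (A.φ g).obj M) : A.sumObj M ⟶ M :=
  ∑ g, A.sumπ M g ≫ (θ g).inv

section

variable {M : C} (θ : ∀ g : G, M ≅ (A.φ g).obj M)

lemma toSumOf_π (g : G) : toSumOf θ ≫ A.sumπ M g = (θ g).hom := sum_comp_π _ _

lemma ι_fromSumOf (g : G) : A.sumι M g ≫ fromSumOf θ = (θ g).inv := ι_comp_sum _ _

/-- This composite is the reason why the order of the group has to be invertible. -/
lemma toSumOf_fromSumOf : toSumOf θ ≫ fromSumOf θ = Nat.card G • 𝟙 M := by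
  rw [fromSumOf, Preadditive.comp_sum]
  have (g : G) : toSumOf θ ≫ A.sumπ M g ≫ (θ g).inv = 𝟙 M := by
    rw [← Category.assoc, toSumOf_π, Iso.hom_inv_id]
  rw [Finset.sum_congr rfl fun g _ => this g, Finset.sum_const, Finset.card_univ,
    Nat.card_eq_fintype_card]

variable (hθ : ∀ (g h k : G) (e : h * g = k),
    (θ k).hom = (θ g).hom ≫ (A.φ g).map (θ h).hom ≫ (A.ε g h k e).hom.app M)
include hθ

/-- If the isomorphisms `θ g` satisfy the cocycle condition, `toSumOf θ` is equivariant. -/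
lemma toSumOf_comm (k : G) :
    (θ k).hom ≫ (A.φ k).map (toSumOf θ) = toSumOf θ ≫ (sumθ M k).hom := by
  refine map_sum_ext k fun g => ?_
  have h : (sumθ M k).hom ≫ (A.φ k).map (A.sumπ M g) =
    A.sumπ M (g * k) ≫ (A.ε k g (g * k) rfl).inv.app M := sumHom_map_π M k g _ rfl
  rw [Category.assoc, ← Functor.map_comp, toSumOf_π, Category.assoc, h, ← Category.assoc,
    toSumOf_π, hθ k g _ rfl, Category.assoc, Category.assoc, Iso.hom_inv_id_app]
  exact congr_arg (_ ≫ ·) (Category.comp_id _).symm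

/-- If the isomorphisms `θ g` satisfy the cocycle condition, `fromSumOf θ` is equivariant. -/
lemma fromSumOf_comm (k : G) :
    (sumθ M k).hom ≫ (A.φ k).map (fromSumOf θ) = fromSumOf θ ≫ (θ k).hom := by
  rw [← Iso.eq_inv_comp]
  conv_rhs => rw [fromSumOf]
  rw [fromSumOf, Functor.map_sum, Preadditive.sum_comp, Preadditive.comp_sum]
  refine Fintype.sum_equiv (Equiv.mulRight k) _ _ fun g => ?_
  have h : (sumθ M k).inv ≫ A.sumπ M (g * k) =
    (A.φ k).map (A.sumπ M g) ≫ (A.ε k g (g * k) rfl).hom.app M := sumInv_π M k g _ rfl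
  rw [Equiv.coe_mulRight, Category.assoc, ← Category.assoc, h, Functor.map_comp, Category.assoc]
  congr 1
  rw [← cancel_mono ((A.φ k).map (θ g).hom), ← Functor.map_comp, Iso.inv_hom_id,
    CategoryTheory.Functor.map_id, Category.assoc, Category.assoc, ← cancel_mono
    ((A.ε k g (g * k) rfl).hom.app M)]
  simp only [Category.assoc]
  rw [← hθ k g _ rfl, Iso.inv_hom_id]
  exact (Category.id_comp _).trans (Category.comp_id _).symm

end

lemma sumMap_toSum_fromSumOf (M : C) : sumMap (toSum M) ≫ fromSumOf (A := A) (sumθ M) = 𝟙 _ := by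
  refine sum_hom_ext' fun g => ?_
  rw [← Category.assoc, ι_sumMap, Category.assoc, ι_fromSumOf, map_toSum, Category.assoc]
  exact (congr_arg (_ ≫ ·) (map_ι_sumInv M g 1 g (one_mul g))).trans
    ((Iso.inv_hom_id_app_assoc _ _ _).trans (Category.comp_id _).symm)

lemma toSumOf_sumMap_fromSum (M : C) :
    toSumOf (sumθ M) ≫ sumMap (fromSum (A := A) M) = 𝟙 _ := by
  refine sum_hom_ext fun g => ?_
  rw [Category.assoc, sumMap_π, ← Category.assoc, toSumOf_π, map_fromSum, ← Category.assoc]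
  refine (congr_arg (· ≫ _) (sumHom_map_π M g 1 g (one_mul g))).trans ?_
  rw [Category.assoc, Iso.inv_hom_id_app]
  exact (Category.comp_id _).trans (Category.id_comp _).symm

lemma fromSumOf_naturality {E F : A.Equivariant} (f : E ⟶ F) :
    sumMap f.hom ≫ fromSumOf F.θ = fromSumOf E.θ ≫ f.hom := by
  refine sum_hom_ext' fun g => ?_
  rw [← Category.assoc, ι_sumMap, Category.assoc, ι_fromSumOf, ← Category.assoc, ι_fromSumOf,
    Iso.comp_inv_eq, Category.assoc, ← f.comm, Iso.inv_hom_id_assoc]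

lemma toSumOf_naturality {E F : A.Equivariant} (f : E ⟶ F) :
    f.hom ≫ toSumOf F.θ = toSumOf E.θ ≫ sumMap f.hom := by
  refine sum_hom_ext fun g => ?_
  rw [Category.assoc, toSumOf_π, Category.assoc, sumMap_π, ← Category.assoc, toSumOf_π, f.comm]

lemma toSum_fromSumOf (E : A.Equivariant) : toSum E.obj ≫ fromSumOf E.θ = 𝟙 E.obj := by
  rw [toSum, Category.assoc, ι_fromSumOf, ← Iso.trans_inv, ← Iso.refl_inv]
  congr 1
  exact Iso.ext E.θ_one_unitIso_hom

lemma toSumOf_fromSum (E : A.Equivariant) : toSumOf E.θ ≫ fromSum E.obj = 𝟙 E.obj := by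
  rw [fromSum, ← Category.assoc, toSumOf_π, E.θ_one_unitIso_hom]

lemma sumMap_id (M : C) : sumMap (A := A) (𝟙 M) = 𝟙 _ := sum_hom_ext fun g => by
  rw [sumMap_π, CategoryTheory.Functor.map_id, Category.comp_id, Category.id_comp]

lemma sumMap_comp {M N L : C} (f : M ⟶ N) (g : N ⟶ L) :
    sumMap (A := A) (f ≫ g) = sumMap f ≫ sumMap g := sum_hom_ext fun h => by
  rw [sumMap_π, Category.assoc, sumMap_π, ← Category.assoc, sumMap_π, Functor.map_comp,
    Category.assoc]

variable (A)

/-- The functor `M ↦ ⨁ φ_g M` to equivariant objects. -/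
def sumFunctor : C ⥤ A.Equivariant where
  obj M :=
    { obj := A.sumObj M
      θ := sumθ M
      θ_mul g h k e := sumHom_mul M g h k e }
  map f :=
    { hom := sumMap f
      comm k := sumHom_map_sumMap f k }
  map_id M := Equivariant.hom_ext (sumMap_id M)
  map_comp f g := Equivariant.hom_ext (sumMap_comp f g)

/-- The functor `M ↦ ⨁ φ_g M` is left adjoint to the forgetful functor. -/
def sumAdj : A.sumFunctor ⊣ Equivariant.forget A :=
  Adjunction.mkOfUnitCounit
    { unit :=
        { app M := toSum M
          naturality M N f := toSum_naturality f }
      counit :=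
        { app E :=
            { hom := fromSumOf E.θ
              comm := fromSumOf_comm E.θ E.θ_mul }
          naturality E F f := Equivariant.hom_ext (fromSumOf_naturality f) }
      left_triangle := by
        ext M : 2
        exact Equivariant.hom_ext ((congr_arg (sumMap (toSum M) ≫ ·) (Category.id_comp _)).trans
          (sumMap_toSum_fromSumOf M))
      right_triangle := by
        ext E
        exact (congr_arg (toSum E.obj ≫ ·) (Category.id_comp _)).trans (toSum_fromSumOf E) }

/-- The functor `M ↦ ⨁ φ_g M` is right adjoint to the forgetful functor. -/
def adjSum : Equivariant.forget A ⊣ A.sumFunctor :=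
  Adjunction.mkOfUnitCounit
    { unit :=
        { app E :=
            { hom := toSumOf E.θ
              comm := toSumOf_comm E.θ E.θ_mul }
          naturality E F f := Equivariant.hom_ext (toSumOf_naturality f) }
      counit :=
        { app M := fromSum M
          naturality M N f := fromSum_naturality f }
      left_triangle := by
        ext E
        exact (congr_arg (toSumOf E.θ ≫ ·) (Category.id_comp _)).trans (toSumOf_fromSum E)
      right_triangle := by
        ext M : 2
        exact Equivariant.hom_ext ((congr_arg (toSumOf (sumθ M) ≫ ·) (Category.id_comp _)).trans
          (toSumOf_sumMap_fromSum M)) }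

/-- The forgetful functor and the functor `M ↦ ⨁ φ_g M` form an ambidextrous adjunction if the order
of the group is invertible. -/
def ambiAdjunction (h : ∀ M : C, IsIso (Nat.card G • 𝟙 M)) :
    AmbiAdjunction A.sumFunctor (Equivariant.forget A) where
  adj₁ := A.sumAdj
  adj₂ := A.adjSum
  isIso_trace E := by
    have h1 : IsIso (toSumOf E.θ ≫ fromSumOf E.θ) := by
      rw [toSumOf_fromSumOf]
      exact h _
    exact @isIso_of_reflects_iso _ _ _ _ _ _ (A.adjSum.unit.app E ≫ A.sumAdj.counit.app E)
      (Equivariant.forget A) h1 _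
  isIso_trace' M := by
    have h1 : IsIso (toSum M ≫ fromSum (A := A) M) := by
      rw [toSum_fromSum]
      infer_instance
    exact h1

instance : A.sumFunctor.Additive :=
  A.sumAdj.left_adjoint_additive

instance : PreservesFiniteLimits A.sumFunctor :=
  have := A.adjSum.rightAdjoint_preservesLimits
  ⟨fun _ _ _ => inferInstance⟩

instance : PreservesFiniteColimits A.sumFunctor :=
  have := A.sumAdj.leftAdjoint_preservesColimits
  ⟨fun _ _ _ => inferInstance⟩

/-- The inclusions of the summands, as natural transformations. -/
def sumιNat (g : G) : A.φ g ⟶ A.sumFunctor ⋙ Equivariant.forget A where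
  app M := A.sumι M g
  naturality _ _ f := (ι_sumMap f g).symm

/-- The projections to the summands, as natural transformations. -/
def sumπNat (g : G) : A.sumFunctor ⋙ Equivariant.forget A ⟶ A.φ g where
  app M := A.sumπ M g
  naturality _ _ f := sumMap_π f g

end RightAction

namespace RightAction

/-! ### Idempotents of induced objects -/

section

variable {G : Type w} [Group G] {C : Type u} [Category.{v} C] [Abelian C] {A : RightAction G C}
  {H : Subgroup G} (F : (A.restrict H).Equivariant) [Finite G]

attribute [local instance] Abelian.hasFiniteBiproducts

/-- The inclusion of a summand of the induced object. -/
abbrev indι (i : Cosets H) : (A.φ (rep i)).obj F.obj ⟶ indObj F :=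
  biproduct.ι (fun i : Cosets H => (A.φ (rep i)).obj F.obj) i

lemma indι_π_self (i : Cosets H) : indι F i ≫ indπ F i = 𝟙 _ := biproduct.ι_π_self _ _

variable {F} in
lemma ind_hom_ext {X : C} {a b : X ⟶ indObj F} (h : ∀ i, a ≫ indπ F i = b ≫ indπ F i) : a = b :=
  biproduct.hom_ext _ _ h

variable {F} in
lemma ind_hom_ext' {X : C} {a b : indObj F ⟶ X} (h : ∀ i, indι F i ≫ a = indι F i ≫ b) : a = b :=
  biproduct.hom_ext' _ _ h

lemma sum_indπ_ι [Fintype (Cosets H)] : ∑ i, indπ F i ≫ indι F i = 𝟙 _ :=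
  ind_hom_ext fun j => by
    rw [Preadditive.sum_comp, Finset.sum_eq_single j, Category.assoc, indι_π_self, Category.comp_id,
      Category.id_comp]
    · intro i _ e
      rw [Category.assoc]
      have h : indι F i ≫ indπ F j = 0 := biproduct.ι_π_ne _ e
      rw [h, comp_zero]
    · simp

/-- If there are no morphisms between different summands of the induced object, its endomorphisms
are block diagonal. -/
lemma comp_indπ (h : ∀ (i j : Cosets H), i ≠ j →
      ∀ f : (A.φ (rep i)).obj F.obj ⟶ (A.φ (rep j)).obj F.obj, f = 0)
    (e : indObj F ⟶ indObj F) (i : Cosets H) :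
    e ≫ indπ F i = indπ F i ≫ indι F i ≫ e ≫ indπ F i := by
  refine ind_hom_ext' fun j => ?_
  by_cases hj : j = i
  · subst hj
    rw [← Category.assoc (indι F j) (indπ F j), indι_π_self, Category.id_comp]
  · rw [h j i hj (indι F j ≫ e ≫ indπ F i), ← Category.assoc]
    rw [h j i hj (indι F j ≫ indπ F i), zero_comp]

/-- The equivariant structure of the induced object permutes the summands transitively; hence an
equivariant block diagonal idempotent has either only trivial or only identity blocks. -/
lemma eq_zero_or_eq_id_of_indHom_comm (h : ∀ (i j : Cosets H), i ≠ j →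
      ∀ f : (A.φ (rep i)).obj F.obj ⟶ (A.φ (rep j)).obj F.obj, f = 0)
    (hF : HasTrivialIdempotents F.obj) (e : indObj F ⟶ indObj F) (he : e ≫ e = e)
    (hcomm : ∀ g, indHom F g ≫ (A.φ g).map e = e ≫ indHom F g) : e = 0 ∨ e = 𝟙 _ := by
  let b (i : Cosets H) := indι F i ≫ e ≫ indπ F i
  have hb (i : Cosets H) : e ≫ indπ F i = indπ F i ≫ b i := comp_indπ F h e i
  have hbb (i : Cosets H) : b i ≫ b i = b i := by
    have h2 : b i ≫ b i = indι F i ≫ e ≫ indπ F i ≫ b i :=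
      (Category.assoc _ _ _).trans (congr_arg (_ ≫ ·) (Category.assoc _ _ _))
    rw [h2, ← hb, reassoc_of% he]
  have hc (g : G) (j c : Cosets H) (hcj : coset H (rep j * g) = c) :
      ∃ t : (A.φ (rep c)).obj F.obj ≅ (A.φ g).obj ((A.φ (rep j)).obj F.obj),
        t.hom ≫ (A.φ g).map (b j) = b c ≫ t.hom := by
    subst hcj
    let t : (A.φ (rep (coset H (rep j * g)))).obj F.obj ≅ (A.φ g).obj ((A.φ (rep j)).obj F.obj) :=
      asIso (trans F _ (rep j * g) (rep_coset H _)) ≪≫ ((A.ε g (rep j) _ rfl).app F.obj).symm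
    have ht : indHom F g ≫ (A.φ g).map (indπ F j) = indπ F (coset H (rep j * g)) ≫ t.hom :=
      indHom_map_π F g j
    refine ⟨t, ?_⟩
    have : Epi (indπ F (coset H (rep j * g))) :=
      ⟨fun a b h => by
        rw [← Category.id_comp a, ← Category.id_comp b, ← indι_π_self, Category.assoc, h,
          Category.assoc]⟩
    rw [← cancel_epi (indπ F (coset H (rep j * g))), ← Category.assoc, ← ht, Category.assoc,
      ← Functor.map_comp, ← hb, Functor.map_comp, reassoc_of% hcomm, ht, ← Category.assoc, hb,
      Category.assoc]
  have hci (j c : Cosets H) : ∃ (g : G)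
      (t : (A.φ (rep c)).obj F.obj ≅ (A.φ g).obj ((A.φ (rep j)).obj F.obj)),
        t.hom ≫ (A.φ g).map (b j) = b c ≫ t.hom :=
    ⟨(rep j)⁻¹ * rep c, hc _ j c (by rw [mul_inv_cancel_left, coset_rep])⟩
  -- the block at the coset of `1` determines all the others
  let i₀ : Cosets H := coset H 1
  have hi : b i₀ = 0 ∨ b i₀ = 𝟙 _ := by
    have := HasTrivialIdempotents.of_fullyFaithful (Functor.FullyFaithful.ofFullyFaithful
      (A.φ (rep i₀))) hF
    exact this _ (hbb i₀)
  refine hi.imp (fun h0 => ?_) fun h0 => ?_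
  · refine ind_hom_ext fun c => ?_
    obtain ⟨g, t, ht⟩ := hci i₀ c
    rw [h0, CategoryTheory.Functor.map_zero, comp_zero] at ht
    rw [hb, (cancel_mono t.hom).1 (ht.symm.trans zero_comp.symm), comp_zero,
      zero_comp]
  · refine ind_hom_ext fun c => ?_
    obtain ⟨g, t, ht⟩ := hci i₀ c
    rw [h0, CategoryTheory.Functor.map_id, Category.comp_id] at ht
    rw [hb, (cancel_mono t.hom).1 (ht.symm.trans (Category.id_comp _).symm),
      Category.comp_id, Category.id_comp]

/-- If the summands `φ_g F` of the object induced from `F` are pairwise orthogonal and `F` has only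
trivial idempotents, the same holds for the induced object. -/
lemma hasTrivialIdempotents_ind (h : ∀ (i j : Cosets H), i ≠ j →
      ∀ f : (A.φ (rep i)).obj F.obj ⟶ (A.φ (rep j)).obj F.obj, f = 0)
    (hF : HasTrivialIdempotents F.obj) : HasTrivialIdempotents (ind F) := fun e he =>
  (eq_zero_or_eq_id_of_indHom_comm F h hF e.hom (congr_arg Equivariant.Hom.hom he) e.comm).imp
    Equivariant.hom_ext Equivariant.hom_ext

/-- `F` is a direct summand of the object induced from it. -/
lemma nonempty_retract_ind : Nonempty (Retract F.obj (indObj F)) := by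
  have h : rep (coset H 1) ∈ H := by
    simpa using H.inv_mem (rep_coset H 1)
  let i : F.obj ≅ (A.φ (rep (coset H 1))).obj F.obj := asIso (lin F _ h)
  exact ⟨{
    i := i.hom ≫ indι F _
    r := indπ F _ ≫ i.inv
    retract := by
      rw [Category.assoc, ← Category.assoc (indι F _), indι_π_self, Category.id_comp,
        Iso.hom_inv_id] }⟩

end

end RightAction

/-! ### Skyscraper sheaves -/

section Skyscraper

open TopologicalSpace

/-- Transport of direct images of structure sheaves along an open immersion. -/
def pushUnitRestrictIso {W Y Z : Scheme.{u}} (p' : W ⟶ Y) (h : Y ⟶ Z) [IsOpenImmersion h]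
    (p : W ⟶ Z) (e : p' ≫ h = p) : pushUnit p' ≅ (pushUnit p).restrict h :=
  ((Scheme.Modules.restrictFunctorAdjCounitIso h).app (pushUnit p')).symm ≪≫
    (Scheme.Modules.restrictFunctor h).mapIso ((Scheme.Modules.pushforwardComp p' h).app _ ≪≫
      (Scheme.Modules.pushforwardCongr e).app _)

lemma app_map {Y : Scheme.{u}} {M N : Y.Modules} (f : M ⟶ N) {U V : Y.Opens} (i : V ⟶ U)
    (s : Γ(M, U)) : N.presheaf.map i.op (f.app U s) = f.app V (M.presheaf.map i.op s) :=
  congr($(f.mapPresheaf.naturality i.op) s).symm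

variable {K : Type u} [Field K] {Y : Scheme.{u}}

/-- The image of a `K`-valued point. -/
abbrev imagePt (p : Spec (.of K) ⟶ Y) : Y := p (IsLocalRing.closedPoint K)

lemma preimage_eq_top (p : Spec (.of K) ⟶ Y) {U : Y.Opens} (h : imagePt p ∈ U) :
    p ⁻¹ᵁ U = ⊤ := by
  ext t
  obtain rfl : t = IsLocalRing.closedPoint K := Subsingleton.elim _ _
  exact ⟨fun _ => trivial, fun _ => h⟩

/-- A skyscraper sheaf has no nonzero sections away from its support. -/
lemma subsingleton_pushUnit (p : Spec (.of K) ⟶ Y) {U : Y.Opens} (h : imagePt p ∉ U) :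
    Subsingleton Γ(pushUnit p, U) := by
  have h0 : p ⁻¹ᵁ U = ⊥ := by
    ext t
    obtain rfl : t = IsLocalRing.closedPoint K := Subsingleton.elim _ _
    exact ⟨fun h' => (h h').elim, fun h' => h'.elim⟩
  change Subsingleton Γ(Spec (.of K), p ⁻¹ᵁ U)
  rw [h0]
  infer_instance

lemma isIso_pushUnit_map (p : Spec (.of K) ⟶ Y) {U V : Y.Opens} (i : V ⟶ U)
    (hV : imagePt p ∈ V) : IsIso ((pushUnit p).presheaf.map i.op) := by
  have h : p ⁻¹ᵁ V = p ⁻¹ᵁ U := by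
    rw [preimage_eq_top p hV, preimage_eq_top p (i.le hV)]
  exact inferInstanceAs (IsIso (Scheme.Modules.presheaf
    (SheafOfModules.unit (Spec (.of K)).ringCatSheaf) |>.map (eqToHom h).op))

lemma pushUnit_map_injective (p : Spec (.of K) ⟶ Y) {U V : Y.Opens} (i : V ⟶ U)
    (hV : imagePt p ∈ V) : Function.Injective ((pushUnit p).presheaf.map i.op) := by
  have := isIso_pushUnit_map p i hV
  exact ((ConcreteCategory.isIso_iff_bijective _).1 this).1

/-- There are no nonzero morphisms between skyscraper sheaves of different closed points. -/
lemma pushUnit_hom_eq_zero (p q : Spec (.of K) ⟶ Y) (hp : IsClosed {imagePt p})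
    (h : imagePt p ≠ imagePt q) (f : pushUnit p ⟶ pushUnit q) : f = 0 := by
  refine Scheme.Modules.hom_ext _ _ fun U => ?_
  ext s
  by_cases hq : imagePt q ∈ U
  · let V : Y.Opens := U ⊓ ⟨{imagePt p}ᶜ, hp.isOpen_compl⟩
    let i : V ⟶ U := homOfLE inf_le_left
    have hV : imagePt q ∈ V := ⟨hq, fun h' => h h'.symm⟩
    apply pushUnit_map_injective q i hV
    have h1 : imagePt p ∉ V := fun h' => h'.2 rfl
    have := subsingleton_pushUnit p h1
    rw [app_map, Subsingleton.elim ((pushUnit p).presheaf.map i.op s) 0, map_zero]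
    exact (map_zero _).symm
  · exact (subsingleton_pushUnit q hq).elim _ _

/-- Global sections of a skyscraper sheaf. -/
def pushUnitSec (p : Spec (.of K) ⟶ Y) (s : Γ(Spec (.of K), ⊤)) : Γ(pushUnit p, ⊤) := s

lemma smul_pushUnitSec (p : Spec (.of K) ⟶ Y) (c : Γ(Y, ⊤)) (s : Γ(Spec (.of K), ⊤)) :
    c • pushUnitSec p s = pushUnitSec p (p.appTop c * s) := rfl

/-- Endomorphisms of skyscraper sheaves of rational points are multiplications by the image of the
section `1`. -/
lemma pushUnit_hom_app_top (p : Spec (.of K) ⟶ Y) (q : Y ⟶ Spec (.of K)) (hpq : p ≫ q = 𝟙 _)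
    (f : pushUnit p ⟶ pushUnit p) (t : Γ(Spec (.of K), ⊤))
    (ht : f.app ⊤ (pushUnitSec p 1) = pushUnitSec p t) (s : Γ(Spec (.of K), ⊤)) :
    f.app ⊤ (pushUnitSec p s) = pushUnitSec p (s * t) := by
  have h1 : p.appTop (q.appTop s) = s := by
    have : q.appTop ≫ p.appTop = 𝟙 _ := by
      rw [← Scheme.Hom.comp_appTop, hpq, Scheme.Hom.id_appTop]
    exact congr($this s)
  have h2 : pushUnitSec p s = q.appTop s • pushUnitSec p 1 := by
    rw [smul_pushUnitSec, h1, mul_one]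
  rw [h2, Scheme.Modules.Hom.app_smul, ht, smul_pushUnitSec, h1]

/-- Endomorphisms of the skyscraper sheaf of a rational point are determined by the image of the
global section `1`: they commute with multiplication by scalars and with the restriction maps, which
are isomorphisms for neighbourhoods of the point. -/
lemma pushUnit_hom_ext (p : Spec (.of K) ⟶ Y) (q : Y ⟶ Spec (.of K)) (hpq : p ≫ q = 𝟙 _)
    {f g : pushUnit p ⟶ pushUnit p} (h : f.app ⊤ (pushUnitSec p 1) = g.app ⊤ (pushUnitSec p 1)) :
    f = g := by
  refine Scheme.Modules.hom_ext _ _ fun U => ?_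
  ext s
  by_cases hU : imagePt p ∈ U
  · let i : U ⟶ ⊤ := homOfLE le_top
    have := isIso_pushUnit_map p i hU
    obtain ⟨t, rfl⟩ := ((ConcreteCategory.isIso_iff_bijective _).1 this).2 s
    have h1 : f.app ⊤ t = g.app ⊤ t := (pushUnit_hom_app_top p q hpq f _ rfl t).trans
      (pushUnit_hom_app_top p q hpq g _ h.symm t).symm
    rw [← app_map, ← app_map, h1]
  · exact (subsingleton_pushUnit p hU).elim _ _

/-- An idempotent endomorphism of a skyscraper sheaf is the multiplication by an idempotent of the
field `K`. -/
lemma hasTrivialIdempotents_pushUnit (p : Spec (.of K) ⟶ Y) (q : Y ⟶ Spec (.of K))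
    (hpq : p ≫ q = 𝟙 _) : HasTrivialIdempotents (pushUnit p) := fun e he => by
  let a : Γ(Spec (.of K), ⊤) := e.app ⊤ (pushUnitSec p 1)
  have h1 : e.app ⊤ a = e.app ⊤ (pushUnitSec p 1) :=
    congr_arg (fun f => f.app ⊤ (pushUnitSec p 1)) he
  have h2 : a * a = a := (pushUnit_hom_app_top p q hpq e a rfl a).symm.trans h1
  rcases IsIdempotentElem.iff_eq_zero_or_one.1 h2 with h | h
  · exact Or.inl (pushUnit_hom_ext p q hpq h)
  · exact Or.inr (pushUnit_hom_ext p q hpq h)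

lemma pushUnit_id_ne_zero (p : Spec (.of K) ⟶ Y) : 𝟙 (pushUnit p) ≠ 0 := fun h =>
  one_ne_zero (α := Γ(Spec (.of K), ⊤))
    (congr_arg (fun f : pushUnit p ⟶ pushUnit p => f.app ⊤ (pushUnitSec p 1)) h)

end Skyscraper

section Invertible

variable {K : Type u} [Field K] {Y : Scheme.{u}}

/-- Integers invertible in the base field are invertible in the rings of sections. -/
lemma isUnit_natCast (q : Y ⟶ Spec (.of K)) {n : ℕ} (hn : (n : K) ≠ 0) (U : Y.Opens) :
    IsUnit (n : Γ(Y, U)) := by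
  let φ : K →+* Γ(Y, U) := ((Scheme.ΓSpecIso (.of K)).inv ≫ q.appTop ≫
    Y.presheaf.map (homOfLE le_top : U ⟶ ⊤).op).hom
  simpa using (IsUnit.mk0 _ hn).map φ

/-- Integers invertible in the base field act invertibly on sheaves of modules. -/
lemma isIso_natCast_smul_id (q : Y ⟶ Spec (.of K)) {n : ℕ} (hn : (n : K) ≠ 0) (M : Coh Y)
    [IsLocallyNoetherian Y] : IsIso (n • 𝟙 M) := by
  have h1 : IsIso (n • 𝟙 M.obj) := by
    rw [Scheme.Modules.Hom.isIso_iff_isIso_app]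
    intro U
    rw [ConcreteCategory.isIso_iff_bijective]
    have h2 : ⇑((n • 𝟙 M.obj : M.obj ⟶ M.obj).app U) = fun s => (n : Γ(Y, U)) • s := by
      funext s
      rw [Nat.cast_smul_eq_nsmul]
      clear hn
      induction n with
      | zero => rw [zero_smul, zero_smul]; rfl
      | succ n ih => rw [succ_nsmul, succ_nsmul, ← ih]; rfl
    rw [h2]
    exact (isUnit_natCast q hn U).smul_bijective
  have h3 : IsIso ((IsCoherent Y).ι.map (n • 𝟙 M)) := by
    rw [Functor.map_nsmul]
    exact h1
  exact isIso_of_fully_faithful (IsCoherent Y).ι _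

end Invertible

section SemistableSums

open Pretriangulated StabilityData

variable {D : Type*} [Category* D] [Preadditive D] [HasZeroObject D] [HasShift D ℤ]
  [∀ n : ℤ, (shiftFunctor D n).Additive] [Pretriangulated D] {σ : StabilityData D}
  (hσ : σ.IsStabilityCondition) {φ : ℝ}
include hσ

namespace StabilityData.IsStabilityCondition

/-- Direct summands of direct sums of semistable objects of the same phase are semistable. -/
lemma mem_of_sum_comp_eq_id {ι : Type*} [Fintype ι] {S : ι → D} (hS : ∀ i, σ.P φ (S i)) {Y : D}
    (p : ∀ i, Y ⟶ S i) (a : ∀ i, S i ⟶ Y) (h : ∑ i, p i ≫ a i = 𝟙 Y) : σ.P φ Y := by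
  refine hσ.mem_of_hom_eq_zero (fun ψ hψ A hA f => ?_) (fun ψ hψ A hA f => ?_)
  · rw [← Category.id_comp f, ← h, Preadditive.sum_comp]
    exact Finset.sum_eq_zero fun i _ => by
      rw [Category.assoc, hσ.hom_eq_zero _ _ _ _ hψ (hS i) hA (a i ≫ f), comp_zero]
  · rw [← Category.comp_id f, ← h, Preadditive.comp_sum]
    exact Finset.sum_eq_zero fun i _ => by
      rw [← Category.assoc, hσ.hom_eq_zero _ _ _ _ hψ hA (hS i) (f ≫ p i), zero_comp]

/-- Direct summands of direct sums of semisimple objects of `P φ` are semisimple. -/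
lemma isSemisimpleObj_of_sum_comp_eq_id [IsTriangulated D] {ι : Type*} [Fintype ι] {S : ι → D}
    (hS : ∀ i, σ.P φ (S i))
    (hS' : ∀ i, IsSemisimpleObj (⟨S i, hS i⟩ : (σ.P φ).FullSubcategory)) {Y : D}
    (p : ∀ i, Y ⟶ S i) (a : ∀ i, S i ⟶ Y) (h : ∑ i, p i ≫ a i = 𝟙 Y) (hY : σ.P φ Y) :
    IsSemisimpleObj (⟨Y, hY⟩ : (σ.P φ).FullSubcategory) := by
  let := hσ.abelian φ
  refine isSemisimpleObj_of_jointly_mono hS' (fun i => ObjectProperty.homMk (p i))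
    fun Z f hf => ObjectProperty.hom_ext _ ?_
  change f.hom = 0
  rw [← Category.comp_id f.hom, ← h, Preadditive.comp_sum]
  refine Finset.sum_eq_zero fun i _ => ?_
  have h1 : f.hom ≫ p i = 0 := congr(($(hf i)).hom)
  rw [← Category.assoc, h1, zero_comp]

end StabilityData.IsStabilityCondition

end SemistableSums

lemma IsSemisimpleObj.map_of_isEquivalence {C C' : Type*} [Category* C] [Category* C']
    (F : C ⥤ C') [F.IsEquivalence] {X : C} (hX : IsSemisimpleObj X) :
    IsSemisimpleObj (F.obj X) := fun Y f _ => by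
  let e := F.objObjPreimageIso Y
  let f' : F.objPreimage Y ⟶ X := F.preimage (e.hom ≫ f)
  have hf' : F.map f' = e.hom ≫ f := F.map_preimage _
  have : Mono (F.map f') := by rw [hf']; infer_instance
  have : Mono f' := F.mono_of_mono_map this
  have := hX _ f'
  refine ⟨⟨⟨F.map (retraction f') ≫ e.hom, ?_⟩⟩⟩
  rw [← cancel_epi e.hom, ← reassoc_of% hf', ← Functor.map_comp_assoc, IsSplitMono.id,
    CategoryTheory.Functor.map_id, Category.id_comp, Category.comp_id]

/-! ### Equivariant sheaves on smooth projective varieties -/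

section Points

variable {k : Type u} [Field k] {X : Over (Spec (.of k))} {G : Type w} [Group G] (ρ : G →* Aut X)

/-- The point `x g⁻¹`, whose image under `g` is `x`. -/
def translate (x : Point X) (g : G) : Point X := x ≫ (ρ g⁻¹).hom

lemma translate_act (x : Point X) (g : G) : (translate ρ x g).hom ≫ act ρ g = x.hom := by
  have h : translate ρ x g ≫ (ρ g).hom = x := by
    rw [translate, Category.assoc, map_inv]
    exact (congr_arg (x ≫ ·) (ρ g).inv_hom_id).trans (Category.comp_id x)
  exact congr_arg Over.Hom.left h

/-- `g^* 𝒪_x` is the skyscraper sheaf of the preimage of `x` under `g`. -/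
def pullbackSkyscraperIso (x : Point X) (g : G) :
    ((cohAction ρ).φ g).obj (skyscraper x) ≅ skyscraper (translate ρ x g) :=
  ObjectProperty.isoMk _
    (pushUnitRestrictIso (translate ρ x g).hom (act ρ g) x.hom (translate_act ρ x g)).symm

lemma mem_stab_of_translate_eq (x : Point X) {a b : G} (h : translate ρ x a = translate ρ x b) :
    b * a⁻¹ ∈ stab ρ x := by
  change x ≫ (ρ (b * a⁻¹)).hom = x
  have h1 : (ρ (b * a⁻¹)).hom = (ρ a⁻¹).hom ≫ (ρ b).hom := by rw [map_mul]; rfl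
  have h2 : translate ρ x b ≫ (ρ b).hom = x := by
    rw [translate, Category.assoc, map_inv]
    exact (congr_arg (x ≫ ·) (ρ b).inv_hom_id).trans (Category.comp_id x)
  rw [h1, ← Category.assoc]
  exact (congr_arg (· ≫ (ρ b).hom) h).trans h2

variable [IsAlgClosed k] [LocallyOfFiniteType X.hom]

lemma skyscraper_hom_eq_zero {x y : Point X} (h : x ≠ y) (f : skyscraper x ⟶ skyscraper y) :
    f = 0 := by
  apply ObjectProperty.hom_ext
  refine pushUnit_hom_eq_zero x.hom y.hom (pointEquivClosedPoint X.hom ⟨x.hom, x.hom_comp⟩).2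
    (fun h' => h ?_) f.hom
  exact Over.OverMorphism.ext (ext_of_apply_closedPoint_eq X.hom x.hom_comp y.hom_comp h')

lemma pullback_skyscraper_hom_eq_zero (x : Point X) {a b : G} (h : b * a⁻¹ ∉ stab ρ x)
    (f : ((cohAction ρ).φ a).obj (skyscraper x) ⟶ ((cohAction ρ).φ b).obj (skyscraper x)) :
    f = 0 := by
  have h1 := skyscraper_hom_eq_zero (fun h' => h (mem_stab_of_translate_eq ρ x h'))
    ((pullbackSkyscraperIso ρ x a).inv ≫ f ≫ (pullbackSkyscraperIso ρ x b).hom)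
  rw [← cancel_epi (pullbackSkyscraperIso ρ x a).inv,
    ← cancel_mono (pullbackSkyscraperIso ρ x b).hom, Category.assoc, h1, comp_zero, zero_comp]

omit [IsAlgClosed k] [LocallyOfFiniteType X.hom] in
lemma hasTrivialIdempotents_skyscraper [IsLocallyNoetherian X.left] (x : Point X) :
    HasTrivialIdempotents (skyscraper x) :=
  .of_map (IsCoherent X.left).ι (hasTrivialIdempotents_pushUnit x.hom X.hom x.hom_comp)

omit [IsAlgClosed k] [LocallyOfFiniteType X.hom] in
lemma skyscraper_id_ne_zero [IsLocallyNoetherian X.left] (x : Point X) : 𝟙 (skyscraper x) ≠ 0 :=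
  fun h => pushUnit_id_ne_zero x.hom congr(($h).hom)

lemma hasTrivialIdempotents_pointSheaf [IsLocallyNoetherian X.left] [Finite G] (x : Point X) :
    HasTrivialIdempotents (pointSheaf ρ x) :=
  RightAction.hasTrivialIdempotents_ind (skyscraperLin ρ x)
    (fun i j hij f => pullback_skyscraper_hom_eq_zero ρ x (fun h => hij (by
      rw [← RightAction.coset_rep i, ← RightAction.coset_rep j]
      exact RightAction.coset_eq h)) f)
    (hasTrivialIdempotents_skyscraper x)

end Points

/-- Direct sum decompositions are preserved by additive functors. -/
lemma exists_sum_comp_eq_id_of_iso {A B : Type*} [Category* A] [Category* B] [Preadditive A]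
    [Preadditive B] (F : A ⥤ B) [F.Additive] {ι : Type*} [Fintype ι] {M : A} {S : ι → A}
    (p : ∀ i, M ⟶ S i) (a : ∀ i, S i ⟶ M) (h : ∑ i, p i ≫ a i = 𝟙 M) {Y : B} {T : ι → B}
    (e : Y ≅ F.obj M) (t : ∀ i, T i ≅ F.obj (S i)) :
    ∃ (p : ∀ i, Y ⟶ T i) (a : ∀ i, T i ⟶ Y), ∑ i, p i ≫ a i = 𝟙 Y := by
  refine ⟨fun i => e.hom ≫ F.map (p i) ≫ (t i).inv, fun i => (t i).hom ≫ F.map (a i) ≫ e.inv, ?_⟩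
  have h1 (i) : (e.hom ≫ F.map (p i) ≫ (t i).inv) ≫ (t i).hom ≫ F.map (a i) ≫ e.inv =
      e.hom ≫ F.map (p i ≫ a i) ≫ e.inv := by simp
  rw [Finset.sum_congr rfl fun i _ => h1 i, ← Preadditive.comp_sum, ← Preadditive.sum_comp,
    ← Functor.map_sum, h, CategoryTheory.Functor.map_id, Category.id_comp, e.hom_inv_id]

/-! ### Restriction and induction on bounded derived categories of equivariant sheaves -/

section Descent

open StabilityData

variable {k : Type u} [Field k] {X : Over (Spec (.of k))} [SmoothProjectiveVariety X]
  {G : Type w} [Group G] (ρ : G →* Aut X)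

/-- `g^*` is fully faithful on `D^b(X)`. -/
def pullbackDbFullyFaithful (g : G) : (pullbackDb ρ g).FullyFaithful :=
  let adj : (cohAction ρ).φ g ⊣ ((cohAction ρ).φ g).inv :=
    ((cohAction ρ).φ g).asEquivalence.toAdjunction
  have := adj.right_adjoint_additive
  mapBoundedFullyFaithful adj

/-- The isomorphism between `g^*` in `D^b(X)` and the pullback of a sheaf. -/
def pullbackDbSkyscraperIso (x : Point X) (g : G) :
    (pullbackDb ρ g).obj (skyscraperDb x) ≅ single (((cohAction ρ).φ g).obj (skyscraper x)) :=
  mapBoundedSingle _ _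

variable {ρ} {σ : StabilityData (Db X)} (hσ : σ.IsStabilityCondition) (hinv : IsGInvariant ρ σ)
include hinv

lemma IsGInvariant.mem_pullbackDb {φ : ℝ} {M : Db X} (hM : σ.P φ M) (g : G) :
    σ.P φ ((pullbackDb ρ g).obj M) := by
  rw [← hinv.map_P g φ]
  exact ObjectProperty.prop_map_obj _ _ hM

/-- `g^*` restricts to an autoequivalence of the category of semistable objects of a given phase. -/
lemma IsGInvariant.isSemisimpleObj_pullbackDb {φ : ℝ} {M : Db X} (hM : σ.P φ M)
    (h : IsSemisimpleObj (⟨M, hM⟩ : (σ.P φ).FullSubcategory)) (g : G) :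
    IsSemisimpleObj (⟨(pullbackDb ρ g).obj M, hinv.mem_pullbackDb hM g⟩ :
      (σ.P φ).FullSubcategory) := by
  let F : (σ.P φ).FullSubcategory ⥤ (σ.P φ).FullSubcategory :=
    (σ.P φ).lift ((σ.P φ).ι ⋙ pullbackDb ρ g) fun M => hinv.mem_pullbackDb M.property g
  have hF := pullbackDbFullyFaithful ρ g
  have : F.Faithful :=
    ⟨fun {_ _ _ _} h => ObjectProperty.hom_ext _ (hF.map_injective congr(($h).hom))⟩
  have : F.Full := ⟨fun f => ⟨ObjectProperty.homMk (hF.preimage f.hom),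
    ObjectProperty.hom_ext _ (hF.map_preimage f.hom)⟩⟩
  have : F.EssSurj := ⟨fun N => by
    have hN : ((σ.P φ).map (pullbackDb ρ g)) N.obj := by
      rw [hinv.map_P]
      exact N.property
    obtain ⟨M, hM, ⟨e⟩⟩ := hN
    exact ⟨⟨M, hM⟩, ⟨ObjectProperty.isoMk _ e⟩⟩⟩
  have : F.IsEquivalence := { }
  exact h.map_of_isEquivalence F

variable [Fintype G]

/-- The restriction of the object induced from `M` is the direct sum of the objects `g^* M`. -/
lemma exists_res_ind_biproduct (M : Db X) :
    ∃ (a : ∀ g, (pullbackDb ρ g).obj M ⟶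
        (res ρ).obj ((mapBounded (cohAction ρ).sumFunctor).obj M))
      (p : ∀ g, (res ρ).obj ((mapBounded (cohAction ρ).sumFunctor).obj M) ⟶
        (pullbackDb ρ g).obj M), ∑ g, p g ≫ a g = 𝟙 _ := by
  classical
  obtain ⟨a, p, -, h⟩ := exists_mapBounded_comp_biproduct (fun g => (cohAction ρ).φ g)
    (fun g => (cohAction ρ).sumιNat g) (fun g => (cohAction ρ).sumπNat g)
    (fun g M => (cohAction ρ).sumι_π_self M g) (fun M => (cohAction ρ).sum_sumπ_ι M) M
  exact ⟨a, p, h⟩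

include hσ

/-- Restriction after induction preserves semistability. -/
lemma IsGInvariant.mem_res_ind (φ : ℝ) (M : Db X) (hM : σ.P φ M) :
    σ.P φ ((res ρ).obj ((mapBounded (cohAction ρ).sumFunctor).obj M)) := by
  obtain ⟨a, p, h⟩ := exists_res_ind_biproduct hinv M
  exact hσ.mem_of_sum_comp_eq_id (fun g => hinv.mem_pullbackDb hM g) p a h

lemma IsGInvariant.isSemisimpleObj_res_ind {φ : ℝ} (M : Db X) (hM : σ.P φ M)
    (hs : IsSemisimpleObj (⟨M, hM⟩ : (σ.P φ).FullSubcategory)) :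
    IsSemisimpleObj (⟨(res ρ).obj ((mapBounded (cohAction ρ).sumFunctor).obj M),
      hinv.mem_res_ind hσ φ M hM⟩ : (σ.P φ).FullSubcategory) := by
  obtain ⟨a, p, h⟩ := exists_res_ind_biproduct hinv M
  exact hσ.isSemisimpleObj_of_sum_comp_eq_id _
    (fun g => hinv.isSemisimpleObj_pullbackDb hM hs g) p a h _

/-- If `𝒪_x` is stable, the restriction of `P_x` is a direct sum of the stable objects `g^* 𝒪_x`. -/
lemma IsGInvariant.isSemisimpleObj_res_pointSheafDb {φ : ℝ} (x : Point X)
    (h : σ.IsStable φ (skyscraperDb x)) : ∃ hx : σ.P φ ((res ρ).obj (pointSheafDb ρ x)),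
      IsSemisimpleObj (⟨_, hx⟩ : (σ.P φ).FullSubcategory) := by
  obtain ⟨hx, hs⟩ := h
  have hs' : IsSemisimpleObj (⟨skyscraperDb x, hx⟩ : (σ.P φ).FullSubcategory) := by
    let := hσ.abelian φ
    exact isSemisimpleObj_of_simple _
  have := Fintype.ofFinite (RightAction.Cosets (stab ρ x))
  let L := skyscraperLin ρ x
  obtain ⟨p, a, h⟩ := exists_sum_comp_eq_id_of_iso (singleBounded (Coh X.left))
    (RightAction.indπ L) (RightAction.indι L) (RightAction.sum_indπ_ι L)
    (Y := (res ρ).obj (pointSheafDb ρ x))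
    (T := fun i => (pullbackDb ρ (RightAction.rep i)).obj (skyscraperDb x))
    (mapBoundedSingle _ _) fun i => pullbackDbSkyscraperIso ρ x (RightAction.rep i)
  have hY := hσ.mem_of_sum_comp_eq_id (fun i => hinv.mem_pullbackDb hx (RightAction.rep i)) p a h
  exact ⟨hY, hσ.isSemisimpleObj_of_sum_comp_eq_id _
    (fun i => hinv.isSemisimpleObj_pullbackDb hx hs' (RightAction.rep i)) p a h hY⟩

omit hσ hinv [Fintype G] in
lemma skyscraperDb_id_ne_zero (x : Point X) : 𝟙 (skyscraperDb x) ≠ 0 := fun h =>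
  skyscraper_id_ne_zero x ((singleBoundedFullyFaithful _).map_injective
    (((singleBounded _).map_id _).trans
      (h.trans (CategoryTheory.Functor.map_zero (singleBounded (Coh X.left)) _ _).symm)))

omit hσ hinv [Fintype G] in
variable (ρ) in
/-- `𝒪_x` is a direct summand of the restriction of `P_x`. -/
lemma nonempty_retract_skyscraperDb [Finite G] (x : Point X) :
    Nonempty (Retract (skyscraperDb x) ((res ρ).obj (pointSheafDb ρ x))) := by
  obtain ⟨r⟩ := RightAction.nonempty_retract_ind (skyscraperLin ρ x)
  let e : (res ρ).obj (pointSheafDb ρ x) ≅ single (RightAction.indObj (skyscraperLin ρ x)) :=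
    mapBoundedSingle _ _
  exact ⟨(r.map (singleBounded _)).trans (Retract.ofIso e.symm)⟩

end Descent

end GStab

end

theorem mainTheorem10 {k : Type u} [Field k] [IsAlgClosed k] (X : Over (Spec (.of k)))
    [SmoothProjectiveVariety X] {G : Type w} [Group G] [Finite G] (hG : (Nat.card G : k) ≠ 0)
    (ρ : G →* Aut X) (σ : StabilityData (Db X)) (hσ : σ.IsStabilityCondition)
    (hinv : IsGInvariant ρ σ) :
    (∀ (x : Point X) (φ₀ : ℝ), σ.IsStable φ₀ (skyscraperDb x) →
      (resInv ρ σ).IsStable φ₀ (pointSheafDb ρ x)) ∧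
    (∀ (x : Point X) (φ₀ : ℝ), (resInv ρ σ).IsStable φ₀ (pointSheafDb ρ x) →
      (∀ (hx : σ.P φ₀ (skyscraperDb x)) (A : (σ.P φ₀).FullSubcategory)
        (i : A ⟶ ⟨skyscraperDb x, hx⟩), Mono i →
        ∀ g ∈ stab ρ x, Nonempty ((pullbackDb ρ g).obj A.obj ≅ A.obj)) →
      σ.IsStable φ₀ (skyscraperDb x)) ∧
    (resInv ρ σ).IsStabilityCondition ∧
    (IsGeometric σ → IsGeometricEquivariant ρ (resInv ρ σ)) := by
  have := Fintype.ofFinite G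
  have := (inferInstance : SmoothProjectiveVariety X).smooth
  have : LocallyOfFiniteType X.hom := inferInstance
  let T : AmbiAdjunction (mapBounded (cohAction ρ).sumFunctor) (res ρ) :=
    ((cohAction ρ).ambiAdjunction fun M => isIso_natCast_smul_id X.hom hG M).mapBounded
  have hRI := hinv.mem_res_ind hσ
  have h1 (x : Point X) (φ₀ : ℝ) (h : σ.IsStable φ₀ (skyscraperDb x)) :
      (resInv ρ σ).IsStable φ₀ (pointSheafDb ρ x) := by
    obtain ⟨hx, hs⟩ := hinv.isSemisimpleObj_res_pointSheafDb hσ x h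
    refine hσ.isStable_inverseImage T hRI hx hs (fun h0 => ?_) ?_
    · obtain ⟨r⟩ := nonempty_retract_skyscraperDb ρ x
      have h0' : 𝟙 ((res ρ).obj (pointSheafDb ρ x)) = 0 := by
        rw [← CategoryTheory.Functor.map_id, h0, CategoryTheory.Functor.map_zero]
      apply skyscraperDb_id_ne_zero x
      rw [← r.retract, ← Category.comp_id r.i, h0', comp_zero, zero_comp]
    · exact .of_fullyFaithful (singleBoundedFullyFaithful _) (hasTrivialIdempotents_pointSheaf ρ x)
  have h3 : (resInv ρ σ).IsStabilityCondition := hσ.inverseImage T hRI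
  refine ⟨h1, fun x φ₀ h _ => ?_, h3, fun ⟨_, φ, hφ⟩ => ⟨h3, φ, fun x => h1 x φ (hφ x)⟩⟩
  -- the restriction of `P_x` is semisimple, and `𝒪_x` is a direct summand with trivial idempotents
  obtain ⟨hX, hs⟩ := hσ.isSemisimpleObj_of_isStable_inverseImage T hRI h fun S hS hsimple =>
    hinv.isSemisimpleObj_res_ind hσ S hS (by
      let := hσ.abelian φ₀
      exact isSemisimpleObj_of_simple _)
  obtain ⟨r⟩ := nonempty_retract_skyscraperDb ρ x
  have hx := hσ.mem_of_retract hX r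
  let i : (⟨skyscraperDb x, hx⟩ : (σ.P φ₀).FullSubcategory) ⟶ ⟨_, hX⟩ := ObjectProperty.homMk r.i
  have : IsSplitMono i :=
    ⟨⟨⟨ObjectProperty.homMk r.r, ObjectProperty.hom_ext _ r.retract⟩⟩⟩
  refine ⟨hx, (hs.of_mono i).simple (fun h0 => ?_) (.of_map (ObjectProperty.ι _)
    (.of_fullyFaithful (singleBoundedFullyFaithful _) (hasTrivialIdempotents_skyscraper x)))⟩
  exact skyscraperDb_id_ne_zero x congr(($h0).hom)
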